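/- Setting. Let $(M,d)$ be a proper metric space, let $\le$ be a preorder on $M$ and $\ll$ a transitive relation contained in $\le$, and let $\tau\colon M^2\to[0,\infty]$ be lower semicontinuous with $\tau(x,y)=0$ if $x\not\le y$, with $\tau(x,y)>0$ if and only if $x\ll y$, and with $\tau(x,z)\ge\tau(x,y)+\tau(y,z)$ if $x\le y\le z$. Let $\mathfrak m$ be a Radon measure on $M$ with full support. A causal (timelike) curve is a locally Lipschitz map $\gamma\colon[a,b]\to M$ with $\gamma_s\le\gamma_t$ ($\gamma_s\ll\gamma_t$) for $s<t$; its $\tau$-length is $\mathrm{Len}_\tau(\gamma)=\inf\sum_{i}\tau(\gamma_{t_i},\gamma_{t_{i+1}})$ over all partitions $a=t_0<\dots<t_n=b$. Assume: (1) *Timelike nonbranching*: whenever $\gamma,\eta\colon[0,1]\to M$ are continuous, both satisfy $\tau(\gamma_s,\gamma_t)=(t-s)\,\tau(\gamma_0,\gamma_1)>0$ for all $s<t$, and they coincide on $[0,r]$ or on $[r,1]$ for some $r\in(0,1)$, then they coincide on $[0,1]$. (2) *Locally causally closed*: every point has an open neighbourhood $U$ such that $\{(x,y)\in\bar U^2: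 x\le y\}$ is closed. (3) *$\mathscr K$-globally hyperbolic*: for every compact $C\subset M$ the $d$-arclengths of causal curves in $C$ are uniformly bounded, and for all compact $K_0,K_1\subset M$ the set $\{z: x\le z\le y\text{ for some }x\in K_0,\,y\in K_1\}$ is compact. (4) *Regular* (regularly localizable): every point has an open neighbourhood $\Omega$ such that (i) the $d$-arclengths of causal curves in $\Omega$ are uniformly bounded; (ii) there is a continuous $\omega\colon\Omega^2\to[0,\infty)$ which is a time separation function (i.e. satisfies the above axioms for $\tau$) for the restrictions of $\ll$ and $\le$ to $\Omega$, and for every $y\in\Omega$ there are $z,z'\in\Omega$ with $z\ll y\ll z'$; (iii) for all $x,y\in\Omega$ with $x\le y\ne x$ there is a causal curve $\gamma_{x,y}$ in $\Omega$ from $x$ to $y$ of maximal $\tau$-length among all causal curves in $\Omega$ from $x$ to $y$, and $\mathrm{Len}_\tau(\gamma_{x,y})=\omega(x,y)\le\tau(x,y)$; (iv) if moreover $x\ll y$, then $\gamma_{x,y}$ is timelike and strictly $\tau$-longer than every causal curve in $\Omega$ from $x$ to $y$ containing a nonconstant null segment (a nonconstant restriction to some $[s,t]$ whose endpoints are not related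 by $\ll$). (5) *Geodesic*: for all $x\le y$ with $x\neq y$ there is a causal curve $\gamma$ from $x$ to $y$ with $\mathrm{Len}_\tau(\gamma)=\tau(x,y)$. Optimal transport. Let $p\in(0,1)$. For Borel probability measures $\mu,\nu$ on $M$ let $\Pi_\le(\mu,\nu)$, $\Pi_\ll(\mu,\nu)$ be the sets of couplings concentrated on $\{x\le y\}$, $\{x\ll y\}$, and put $\ell_p(\mu,\nu)=\sup\{\|\tau\|_{L^p(\pi)}:\pi\in\Pi_\le(\mu,\nu)\}$, with $\sup\emptyset=-\infty$. A coupling $\pi\in\Pi_\le(\mu,\nu)$ is $\ell_p$-optimal if it attains this supremum. Let $l^p(x,y)=\tau(x,y)^p$ if $x\le y$ and $l^p(x,y)=-\infty$ otherwise. The pair $(\mu,\nu)$ is *timelike $p$-dualizable* if there are an $\ell_p$-optimal $\pi\in\Pi_\ll(\mu,\nu)$ and Borel functions $a,b\colon M\to\mathbb R$ with $a\oplus b\in L^1(\mu\otimes\nu)$ and $l^p\le a\oplus b$ on $\operatorname{supp}\mu\times\operatorname{supp}\nu$, where $(a\oplus b)(x,y)=a(x)+b(y)$. It is *strongly* timelike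 $p$-dualizable if in addition there is a Borel set $\Gamma\subset\{x\ll y\}\cap(\operatorname{supp}\mu\times\operatorname{supp}\nu)$ that is $l^p$-cyclically monotone (i.e. $\sum_i l^p(x_{i+1},y_i)\le\sum_i l^p(x_i,y_i)$ for all finite cyclic families $(x_i,y_i)$ in $\Gamma$) such that every $\sigma\in\Pi_\le(\mu,\nu)$ is $\ell_p$-optimal if and only if $\sigma(\Gamma)=1$. An *$\ell_p$-geodesic* is a family $(\mu_t)_{t\in[0,1]}$ of Borel probability measures with $\ell_p(\mu_0,\mu_1)\in(0,\infty)$ and $\ell_p(\mu_s,\mu_t)=(t-s)\,\ell_p(\mu_0,\mu_1)$ for all $s<t$. Curvature. Let $K\in\mathbb R$ and $N\in(0,\infty)$. Let $\mathrm{Ent}(\mu)=\int\rho\log\rho\,d\mathfrak m\in[-\infty,\infty)$ if $\mu=\rho\,\mathfrak m$ and $(\rho\log\rho)^+\in L^1(\mathfrak m)$, let $\mathrm{Ent}(\mu)=\infty$ otherwise, and put $\mathcal U_N(\mu)=e^{-\mathrm{Ent}(\mu)/N}$. For $r\in[0,1]$ and $\vartheta\in[0,\infty]$ let $\sigma^{(r)}_{K,N}(\vartheta)$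 be equal to - $\dfrac{\sin(r\vartheta\sqrt{K/N})}{\sin(\vartheta\sqrt{K/N})}$ if $0<K\vartheta^2<N\pi^2$, - $r$ if $K\vartheta^2=0$ (with $0\cdot\infty=0$), - $\dfrac{\sinh(r\vartheta\sqrt{-K/N})}{\sinh(\vartheta\sqrt{-K/N})}$ if $K\vartheta^2<0$ (a limit if $\vartheta=\infty$), - $\infty$ if $K\vartheta^2\ge N\pi^2$. Say that $(\mu_t)_{t\in[0,1]}$ satisfies the *convexity inequality* with respect to $\pi$ if, with $T_\pi=\|\tau\|_{L^2(\pi)}$, $$\mathcal U_N(\mu_t)\ \ge\ \sigma^{(1-t)}_{K,N}(T_\pi)\,\mathcal U_N(\mu_0)+\sigma^{(t)}_{K,N}(T_\pi)\,\mathcal U_N(\mu_1)\qquad\text{for every }t\in[0,1].$$ Assume $\mathrm{wTCD}^e_p(K,N)$: for all compactly supported, strongly timelike $p$-dualizable $(\mu_0,\mu_1)$ with finite entropies and $\ell_p(\mu_0,\mu_1)<\infty$ there are an $\ell_p$-optimal $\pi\in\Pi_\ll(\mu_0,\mu_1)$ and an $\ell_p$-geodesic from $\mu_0$ to $\mu_1$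 satisfying the convexity inequality with respect to $\pi$. Claim. Let $\mu_0=\rho_0\,\mathfrak m$ and $\mu_1=\rho_1\,\mathfrak m$ be compactly supported probability measures with $\rho_0,\rho_1\in L^\infty(M,\mathfrak m)$ such that $(\mu_0,\mu_1)$ is timelike $p$-dualizable. Then there is exactly one $\ell_p$-geodesic $(\mu_t)_{t\in[0,1]}$ from $\mu_0$ to $\mu_1$, and it is *good*, that is: a. there is an $\ell_p$-optimal coupling $\pi\in\Pi_\ll(\mu_0,\mu_1)$ with $\tau\in L^2(M^2,\pi)$ with respect to which $(\mu_t)$ satisfies the convexity inequality, and every $\mu_t=\rho_t\,\mathfrak m$ is $\mathfrak m$-absolutely continuous with finite entropy; b. $\sup_{t\in[0,1]}\|\rho_t\|_{L^\infty(M,\mathfrak m)}<\infty$. -/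

import Mathlib

open MeasureTheory Set Topology
open scoped ENNReal

noncomputable section

/-- A causal space together with a time separation function, on a metric space. (Properness of the
metric is not part of the structure, since the structure is also used on open subsets; it is
the class `ProperSpace` wherever a whole space is considered.) -/
structure LorentzianPreLengthSpace (M : Type*) [MetricSpace M] where
  /-- the chronological (timelike) relation `≪` -/
  ll : M → M → Prop
  /-- the causal relation `≤` -/
  le : M → M → Prop
  le_refl : ∀ x, le x x
  le_trans : ∀ x y z, le x y → le y z → le x z
  ll_trans : ∀ x y z, ll x y → ll y z → ll x z
  le_of_ll : ∀ x y, ll x y → le x y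
  /-- the time separation function -/
  τ : M → M → ℝ≥0∞
  lowerSemicontinuous_τ : LowerSemicontinuous (fun z : M × M => τ z.1 z.2)
  τ_eq_zero : ∀ x y, ¬ le x y → τ x y = 0
  τ_pos_iff : ∀ x y, 0 < τ x y ↔ ll x y
  reverse_triangle : ∀ x y z, le x y → le y z → τ x y + τ y z ≤ τ x z

namespace LorentzianPreLengthSpace

section Geometry

variable {M : Type*} [MetricSpace M] (L : LorentzianPreLengthSpace M)

/-- Every point has an open neighbourhood `U` such that the restriction of `≤` to the closed set
`closure U × closure U` is closed. -/
def LocallyCausallyClosed : Prop :=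
  ∀ x : M, ∃ U : Set M, IsOpen U ∧ x ∈ U ∧
    IsClosed {z : M × M | z.1 ∈ closure U ∧ z.2 ∈ closure U ∧ L.le z.1 z.2}

/-- Future-directed causal curves `γ : [a, b] → M`. -/
def IsCausalCurve (γ : ℝ → M) (a b : ℝ) : Prop :=
  a < b ∧ LocallyLipschitzOn (Icc a b) γ ∧
    ∀ s ∈ Icc a b, ∀ t ∈ Icc a b, s < t → L.le (γ s) (γ t)

/-- Future-directed timelike curves `γ : [a, b] → M`. -/
def IsTimelikeCurve (γ : ℝ → M) (a b : ℝ) : Prop :=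
  a < b ∧ LocallyLipschitzOn (Icc a b) γ ∧
    ∀ s ∈ Icc a b, ∀ t ∈ Icc a b, s < t → L.ll (γ s) (γ t)

/-- The curve has a nonconstant null piece: it is not constant on some `[s, t]`, and its endpoints
there are not chronologically related. (Pieces on which a causal curve rests are not null
segments.) -/
def ContainsNullSegment (γ : ℝ → M) (a b : ℝ) : Prop :=
  ∃ s ∈ Icc a b, ∃ t ∈ Icc a b, s < t ∧ (∃ u ∈ Icc s t, γ u ≠ γ s) ∧ ¬ L.ll (γ s) (γ t)

/-- The `τ`-length of a curve on `[a, b]`: infimum over all partitions `a = t₀ < ⋯ < tₙ = b`. -/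
def length (γ : ℝ → M) (a b : ℝ) : ℝ≥0∞ :=
  ⨅ (n : ℕ) (t : Fin (n + 1) → ℝ) (_ : StrictMono t) (_ : t 0 = a) (_ : t (Fin.last n) = b),
    ∑ i : Fin n, L.τ (γ (t i.castSucc)) (γ (t i.succ))

/-- Any two distinct causally related points are joined by a maximal causal curve. -/
def IsGeodesicSpace : Prop :=
  ∀ x y : M, L.le x y → x ≠ y →
    ∃ (γ : ℝ → M) (a b : ℝ), L.IsCausalCurve γ a b ∧ γ a = x ∧ γ b = y ∧
      L.length γ a b = L.τ x y

/-- Causal curves in a compact set have uniformly bounded arclength with respect to the metric. -/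
def NonTotallyImprisoning : Prop :=
  ∀ C : Set M, IsCompact C → ∃ c : ℝ, 0 < c ∧ ∀ (γ : ℝ → M) (a b : ℝ),
    L.IsCausalCurve γ a b → (∀ t ∈ Icc a b, γ t ∈ C) →
      eVariationOn γ (Icc a b) ≤ ENNReal.ofReal c

/-- `J(A, B) = J⁺(A) ∩ J⁻(B)`. -/
def causalDiamond (A B : Set M) : Set M :=
  {z | (∃ x ∈ A, L.le x z) ∧ ∃ y ∈ B, L.le z y}

/-- `𝒦`-global hyperbolicity. -/
def KGloballyHyperbolic : Prop :=
  L.NonTotallyImprisoning ∧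
    ∀ K₀ K₁ : Set M, IsCompact K₀ → IsCompact K₁ → IsCompact (L.causalDiamond K₀ K₁)

/-- `γ : [a, b] → Ω` is a causal curve from `x` to `y` inside `Ω`. -/
def IsCausalCurveIn (Ω : Set M) (x y : M) (γ : ℝ → M) (a b : ℝ) : Prop :=
  L.IsCausalCurve γ a b ∧ (∀ t ∈ Icc a b, γ t ∈ Ω) ∧ γ a = x ∧ γ b = y

/-- `Ω` is a regular localizing neighbourhood: (i) causal curves in `Ω` have bounded arclength;
(ii) `Ω`, with the restricted relations, carries a finite continuous time separation function `ω`,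
and every point of `Ω` has chronological future and past points in `Ω`; (iii) `x < y` in `Ω` are
joined by a causal curve in `Ω` which has maximal `τ`-length among all such curves, namely
`ω x y ≤ τ x y`; (iv) if `x ≪ y` that curve is timelike, and strictly longer than any causal curve
in `Ω` from `x` to `y` that contains a null segment. -/
def IsRegularLocalizing (Ω : Set M) : Prop :=
  (∃ C : ℝ, 0 < C ∧ ∀ (γ : ℝ → M) (a b : ℝ), L.IsCausalCurve γ a b →
    (∀ t ∈ Icc a b, γ t ∈ Ω) → eVariationOn γ (Icc a b) ≤ ENNReal.ofReal C) ∧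
  (∀ y ∈ Ω, (∃ z ∈ Ω, L.ll y z) ∧ ∃ z ∈ Ω, L.ll z y) ∧
  ∃ W : LorentzianPreLengthSpace Ω,
    (∀ x y : Ω, W.ll x y ↔ L.ll x y) ∧ (∀ x y : Ω, W.le x y ↔ L.le x y) ∧
    Continuous (fun z : Ω × Ω => W.τ z.1 z.2) ∧ (∀ x y : Ω, W.τ x y ≠ ∞) ∧
    ∀ x y : Ω, L.le x y → x ≠ y →
      ∃ (γ : ℝ → M) (a b : ℝ), L.IsCausalCurveIn Ω x y γ a b ∧
        (∀ (σ : ℝ → M) (c d : ℝ), L.IsCausalCurveIn Ω x y σ c d →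
          L.length σ c d ≤ L.length γ a b) ∧
        L.length γ a b = W.τ x y ∧ W.τ x y ≤ L.τ x y ∧
        (L.ll x y → L.IsTimelikeCurve γ a b ∧
          ∀ (σ : ℝ → M) (c d : ℝ), L.IsCausalCurveIn Ω x y σ c d →
            L.ContainsNullSegment σ c d → L.length σ c d < L.length γ a b)

/-- Regularity, i.e. regular localizability. -/
def IsRegular : Prop :=
  ∀ x : M, ∃ Ω : Set M, IsOpen Ω ∧ x ∈ Ω ∧ L.IsRegularLocalizing Ω

/-- Continuous timelike geodesics `γ : [0, 1] → M` parametrized proportionally to `τ`-arclength. -/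
def IsTGeo (γ : ℝ → M) : Prop :=
  ContinuousOn γ (Icc 0 1) ∧ ∀ s ∈ Icc (0 : ℝ) 1, ∀ t ∈ Icc (0 : ℝ) 1, s < t →
    L.τ (γ s) (γ t) = ENNReal.ofReal (t - s) * L.τ (γ 0) (γ 1) ∧ 0 < L.τ (γ s) (γ t)

/-- Timelike nonbranching, both forward and backward. -/
def TimelikeNonbranching : Prop :=
  ∀ γ η : ℝ → M, L.IsTGeo γ → L.IsTGeo η →
    ((∃ r ∈ Ioo (0 : ℝ) 1, ∀ t ∈ Icc 0 r, γ t = η t) → ∀ t ∈ Icc (0 : ℝ) 1, γ t = η t) ∧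
    ((∃ r ∈ Ioo (0 : ℝ) 1, ∀ t ∈ Icc r 1, γ t = η t) → ∀ t ∈ Icc (0 : ℝ) 1, γ t = η t)

end Geometry

section Transport

variable {M : Type*} [MetricSpace M] [MeasurableSpace M] (L : LorentzianPreLengthSpace M)

/-- Couplings of `μ` and `ν`. -/
def IsCoupling (μ ν : ProbabilityMeasure M) (π : Measure (M × M)) : Prop :=
  π.fst = (μ : Measure M) ∧ π.snd = (ν : Measure M)

/-- Causal couplings, the set `Π_≤(μ, ν)`. -/
def IsCausalCoupling (μ ν : ProbabilityMeasure M) (π : Measure (M × M)) : Prop :=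
  IsCoupling μ ν π ∧ ∀ᵐ z ∂π, L.le z.1 z.2

/-- Chronological couplings, the set `Π_≪(μ, ν)`. -/
def IsChronologicalCoupling (μ ν : ProbabilityMeasure M) (π : Measure (M × M)) : Prop :=
  IsCoupling μ ν π ∧ ∀ᵐ z ∂π, L.ll z.1 z.2

/-- `‖τ‖_{L^q(π)}` for real `q > 0`. -/
def τNorm (q : ℝ) (π : Measure (M × M)) : ℝ≥0∞ :=
  (∫⁻ z, L.τ z.1 z.2 ^ q ∂π) ^ (1 / q)

/-- The `p`-Lorentz–Wasserstein distance, with values in `[0, ∞] ∪ {-∞}`; it is `-∞` if there is no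
causal coupling. -/
def lorentzWasserstein (p : ℝ) (μ ν : ProbabilityMeasure M) : EReal :=
  ⨆ (π : Measure (M × M)) (_ : L.IsCausalCoupling μ ν π), (L.τNorm p π : EReal)

/-- `ℓ_p`-optimal couplings. -/
def IsOptimalCoupling (p : ℝ) (μ ν : ProbabilityMeasure M) (π : Measure (M × M)) : Prop :=
  L.IsCausalCoupling μ ν π ∧ L.lorentzWasserstein p μ ν = (L.τNorm p π : EReal)

open Classical in
/-- The cost `l^p`: it is `τ^p` on causally related pairs and `-∞` elsewhere. -/
def cost (p : ℝ) (x y : M) : EReal :=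
  if L.le x y then ((L.τ x y ^ p : ℝ≥0∞) : EReal) else ⊥

/-- `l^p`-cyclical monotonicity. Indices in `Fin (n + 1)` are cyclic, and `∞ + (-∞) = -∞`. -/
def CyclicallyMonotone (p : ℝ) (Γ : Set (M × M)) : Prop :=
  ∀ (n : ℕ) (z : Fin (n + 1) → M × M), (∀ i, z i ∈ Γ) →
    ∑ i, L.cost p (z (i + 1)).1 (z i).2 ≤ ∑ i, L.cost p (z i).1 (z i).2

/-- `(μ, ν)` is timelike `p`-dualizable by `π`. -/
def IsTimelikeDualizableBy (p : ℝ) (μ ν : ProbabilityMeasure M) (π : Measure (M × M)) : Prop :=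
  L.IsChronologicalCoupling μ ν π ∧ L.IsOptimalCoupling p μ ν π ∧
    ∃ a b : M → ℝ, Measurable a ∧ Measurable b ∧
      Integrable (fun z : M × M => a z.1 + b z.2) ((μ : Measure M).prod (ν : Measure M)) ∧
      ∀ x ∈ (μ : Measure M).support, ∀ y ∈ (ν : Measure M).support,
        L.cost p x y ≤ ((a x + b y : ℝ) : EReal)

/-- Timelike `p`-dualizability. -/
def IsTimelikeDualizable (p : ℝ) (μ ν : ProbabilityMeasure M) : Prop :=
  ∃ π : Measure (M × M), L.IsTimelikeDualizableBy p μ ν π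

/-- Strong timelike `p`-dualizability. -/
def IsStronglyTimelikeDualizable (p : ℝ) (μ ν : ProbabilityMeasure M) : Prop :=
  (∃ π : Measure (M × M), L.IsTimelikeDualizableBy p μ ν π) ∧
    ∃ Γ : Set (M × M), MeasurableSet Γ ∧ L.CyclicallyMonotone p Γ ∧
      (∀ z ∈ Γ, L.ll z.1 z.2 ∧ z.1 ∈ (μ : Measure M).support ∧ z.2 ∈ (ν : Measure M).support) ∧
      ∀ σ : Measure (M × M), L.IsCausalCoupling μ ν σ → (L.IsOptimalCoupling p μ ν σ ↔ σ Γ = 1)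

/-- `(μ_t)_{t ∈ [0, 1]}` is an `ℓ_p`-geodesic from `μ₀` to `μ₁`. -/
def IsGeodesicFromTo (p : ℝ) (μ₀ μ₁ : ProbabilityMeasure M)
    (μ : unitInterval → ProbabilityMeasure M) : Prop :=
  μ 0 = μ₀ ∧ μ 1 = μ₁ ∧
    0 < L.lorentzWasserstein p (μ 0) (μ 1) ∧ L.lorentzWasserstein p (μ 0) (μ 1) < ⊤ ∧
    ∀ s t : unitInterval, s < t →
      L.lorentzWasserstein p (μ s) (μ t) =
        (((t : ℝ) - (s : ℝ) : ℝ) : EReal) * L.lorentzWasserstein p (μ 0) (μ 1)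

/-- The `L^∞(m)`-norm of the density of the absolutely continuous part of `μ`. -/
def densityNorm (m : Measure M) (μ : ProbabilityMeasure M) : ℝ≥0∞ :=
  essSup ((μ : Measure M).rnDeriv m) m

open Classical in
/-- The relative entropy `∫ ρ log ρ dm` of `μ = ρ m`, as the difference of the integrals of the
positive and the negative part of `ρ log ρ`; it is `∞` unless `μ` is absolutely continuous and the
positive part is integrable, and it may be `-∞`. -/
def entropy (m : Measure M) (μ : ProbabilityMeasure M) : EReal :=
  let f : M → ℝ := fun x =>
    ((μ : Measure M).rnDeriv m x).toReal * Real.log ((μ : Measure M).rnDeriv m x).toReal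
  if (μ : Measure M) ≪ m ∧ ∫⁻ x, ENNReal.ofReal (f x) ∂m ≠ ∞ then
    ((∫⁻ x, ENNReal.ofReal (f x) ∂m : ℝ≥0∞) : EReal) -
      ((∫⁻ x, ENNReal.ofReal (-f x) ∂m : ℝ≥0∞) : EReal)
  else ⊤

/-- The finiteness domain of the relative entropy. -/
def FiniteEntropy (m : Measure M) (μ : ProbabilityMeasure M) : Prop :=
  entropy m μ ≠ ⊤ ∧ entropy m μ ≠ ⊥

/-- The exponentiated entropy `exp (-Ent(μ) / N)`, with values in `[0, ∞]`. -/
def expEntropy (m : Measure M) (N : ℝ) (μ : ProbabilityMeasure M) : ℝ≥0∞ :=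
  EReal.exp (-entropy m μ / (N : EReal))

/-- The distortion coefficient `σ_{K,N}^{(r)}(θ)` for `r ∈ [0, 1]` and `θ ∈ [0, ∞]`. For `θ = ∞` and
`K < 0` the quotient of hyperbolic sines is understood as a limit. -/
def distortion (K N r : ℝ) (θ : ℝ≥0∞) : ℝ≥0∞ :=
  if θ = ∞ then
    if 0 < K then ∞ else if K = 0 then ENNReal.ofReal r else if r = 1 then 1 else 0
  else if K * θ.toReal ^ 2 = 0 then ENNReal.ofReal r
  else if K * θ.toReal ^ 2 < 0 then
    ENNReal.ofReal
      (Real.sinh (r * θ.toReal * √(-K / N)) / Real.sinh (θ.toReal * √(-K / N)))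
  else if K * θ.toReal ^ 2 < N * Real.pi ^ 2 then
    ENNReal.ofReal (Real.sin (r * θ.toReal * √(K / N)) / Real.sin (θ.toReal * √(K / N)))
  else ∞

/-- The `(K, N)`-convexity inequality for the exponentiated entropy along `(μ_t)`, at all times,
with respect to the coupling `π`. -/
def ConvexityInequality (m : Measure M) (K N : ℝ) (π : Measure (M × M))
    (μ : unitInterval → ProbabilityMeasure M) : Prop :=
  ∀ t : unitInterval,
    distortion K N (1 - (t : ℝ)) (L.τNorm 2 π) * expEntropy m N (μ 0) +
      distortion K N (t : ℝ) (L.τNorm 2 π) * expEntropy m N (μ 1) ≤ expEntropy m N (μ t)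

/-- The weak entropic timelike curvature-dimension condition `wTCD_p^e(K, N)`. -/
def WTCD (m : Measure M) (p K N : ℝ) : Prop :=
  ∀ μ₀ μ₁ : ProbabilityMeasure M, L.IsStronglyTimelikeDualizable p μ₀ μ₁ →
    IsCompact (μ₀ : Measure M).support → IsCompact (μ₁ : Measure M).support →
    FiniteEntropy m μ₀ → FiniteEntropy m μ₁ → L.lorentzWasserstein p μ₀ μ₁ < ⊤ →
    ∃ (π : Measure (M × M)) (μ : unitInterval → ProbabilityMeasure M),
      L.IsChronologicalCoupling μ₀ μ₁ π ∧ L.IsOptimalCoupling p μ₀ μ₁ π ∧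
      L.IsGeodesicFromTo p μ₀ μ₁ μ ∧ L.ConvexityInequality m K N π μ

/-- Goodness of an `ℓ_p`-geodesic `(μ_t)`: the convexity inequality holds with respect to some
chronological `ℓ_p`-optimal coupling, all `μ_t` are absolutely continuous of finite entropy, and
their densities are uniformly bounded. -/
def IsGood (m : Measure M) (p K N : ℝ) (μ : unitInterval → ProbabilityMeasure M) : Prop :=
  (∃ π : Measure (M × M), L.IsChronologicalCoupling (μ 0) (μ 1) π ∧
    L.IsOptimalCoupling p (μ 0) (μ 1) π ∧ L.τNorm 2 π < ∞ ∧ L.ConvexityInequality m K N π μ) ∧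
  (∀ t, (μ t : Measure M) ≪ m ∧ FiniteEntropy m (μ t)) ∧
  (⨆ t, densityNorm m (μ t)) < ∞

end Transport

end LorentzianPreLengthSpace

end

/-!
The curvature condition is only assumed for strongly dualizable pairs of measures, and geodesics
need not be unique a priori. Both gaps are closed by one principle: maximal transport from an
absolutely continuous measure is unique, because transport rays do not cross and fill too much
space to do so independently.

*Geometry.* The axioms are first reduced to the properties collected in `RegularGeometry`: `τ` is
continuous and finite, `≤` is closed, chronologically related points are joined by geodesics which
branch nowhere, and `τ x y = τ z y` with `x ≤ z ≪ y` forces `x = z`. Continuity follows by cutting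
maximal curves into pieces on which `τ` agrees with a continuous local time separation. The rigidity
statement holds because maximal curves of positive length have no null pieces.

*Filling of space.* Let `A` and `C` be compact and chronologically related. The convexity inequality,
combined with Jensen's inequality, shows that the points at time `s` of a maximal transport from the
uniform distribution on `A` to a measure on `C` fill a set of measure at least `(1 - o(1)) m A`, as
`s → 0`. Strong dualizability is automatic here, by Kantorovich potentials, if the target has bounded
density. Arbitrary targets, even singular ones, are weak limits of such
(`WTCD.exists_intermediate_large`). On the other hand, two rays of a monotone set which meet at the
same time `s` have the same endpoint, by strict concavity of `r ↦ r ^ p` and by nonbranching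
(`TimelikeMonotone.eq_of_isIntermediate`). Hence a monotone set cannot send the mass of `A` to two
disjoint targets: their rays would fill disjoint sets, each of almost full measure, in a small
neighbourhood of `A` (`WTCD.not_disjoint_targets`). So two couplings carried by one monotone set, with
the same absolutely continuous first marginal, agree (`WTCD.coupling_unique`).

*Null pairs.* The cost is `-∞` off the causal relation, so that the support of a maximal coupling is
monotone only for rearrangements into chronologically related pairs, and maximal couplings might
charge null pairs. If they did, while another maximal coupling is chronological, then a set of
positive measure would carry a bounded function which drops by at least `τ ^ p` upon arrival in the
set. Along a short flow in `n` steps it would drop by a multiple of `n * (1 / n) ^ p`, which is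
unbounded as `p < 1` (`WTCD.chronological_of_isMaximal`). Hence the maximal coupling is unique
(`WTCD.eq_of_isMaximal`). The same flow shows that achronal sets are negligible, so that almost every
pair of the support can be approximated by pairs with initial points in its past. This yields cyclical
monotonicity for all causal rearrangements, and thereby strong dualizability
(`WTCD.isStronglyTimelikeDualizable`). The curvature condition now provides a geodesic with the
convexity inequality.

*Uniqueness and density bounds.* Every geodesic consists of distributions of intermediate points along
the unique coupling, and these are unique because `WTCD.coupling_unique` applies to the first parts of
the rays (`WTCD.geodesic_unique`). For the density bound, the transport is restricted to the rays which
lie in a set `S` at time `t`, and normalized. By uniqueness, the geodesic for the restricted transport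
is carried by `S` at time `t`, and by the convexity inequality its entropy is controlled by the density
bounds of its end measures. Jensen's inequality turns this into a lower bound for the measure of `S`
(`WTCD.le_smul_of_isGeodesicFromTo`).
-/

open Filter

set_option linter.unusedSectionVars false

namespace LorentzianPreLengthSpace

/-! ### Consequences of the axioms, and lengths of curves -/

section Geometry

variable {M : Type*} [MetricSpace M] {L : LorentzianPreLengthSpace M}

lemma ll_of_ll_of_le {x y z : M} (h₁ : L.ll x y) (h₂ : L.le y z) : L.ll x z :=
  (L.τ_pos_iff x z).1 (((L.τ_pos_iff x y).2 h₁).trans_le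
    (le_self_add.trans (L.reverse_triangle x y z (L.le_of_ll _ _ h₁) h₂)))

lemma isOpen_ll (L : LorentzianPreLengthSpace M) : IsOpen {z : M × M | L.ll z.1 z.2} := by
  have h := L.lowerSemicontinuous_τ.isOpen_preimage 0
  convert h using 1
  ext z
  simp [← L.τ_pos_iff]

lemma τ_eq_zero_of_not_ll {x y : M} (h : ¬ L.ll x y) : L.τ x y = 0 := by
  by_contra h0
  exact h ((L.τ_pos_iff x y).1 (pos_iff_ne_zero.2 h0))

lemma le_of_monotone_chain {n : ℕ} {z : ℕ → M} (h : ∀ i < n, L.le (z i) (z (i + 1))) :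
    L.le (z 0) (z n) := by
  induction n with
  | zero => exact L.le_refl _
  | succ n ih =>
    exact L.le_trans _ _ _ (ih fun i hi => h i (by omega)) (h n (by omega))

lemma sum_τ_le_of_chain {n : ℕ} {z : ℕ → M} (h : ∀ i < n, L.le (z i) (z (i + 1))) :
    ∑ i ∈ Finset.range n, L.τ (z i) (z (i + 1)) ≤ L.τ (z 0) (z n) := by
  induction n with
  | zero => simp
  | succ n ih =>
    rw [Finset.sum_range_succ]
    exact (add_le_add_left (ih fun i hi => h i (by omega)) _).trans
      (L.reverse_triangle _ _ _ (le_of_monotone_chain fun i hi => h i (by omega)) (h n (by omega)))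

lemma length_le_sum (γ : ℝ → M) {a b : ℝ} (n : ℕ) (T : ℕ → ℝ) (hT : ∀ i < n, T i < T (i + 1))
    (h0 : T 0 = a) (hn : T n = b) :
    L.length γ a b ≤ ∑ i ∈ Finset.range n, L.τ (γ (T i)) (γ (T (i + 1))) := by
  rw [← Fin.sum_univ_eq_sum_range (fun i => L.τ (γ (T i)) (γ (T (i + 1))))]
  refine iInf_le_of_le n (iInf_le_of_le (fun i : Fin (n + 1) => T i) ?_)
  refine iInf_le_of_le (Fin.strictMono_iff_lt_succ.2 fun i => ?_)
    (iInf_le_of_le (by simpa using h0) (iInf_le_of_le (by simpa using hn) ?_))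
  · simpa using hT i i.2
  · simp

lemma exists_partition_sum_lt (γ : ℝ → M) {a b : ℝ} {r : ℝ≥0∞} (h : L.length γ a b < r) :
    ∃ (n : ℕ) (T : ℕ → ℝ), (∀ i < n, T i < T (i + 1)) ∧ T 0 = a ∧ T n = b ∧
      ∑ i ∈ Finset.range n, L.τ (γ (T i)) (γ (T (i + 1))) < r := by
  simp only [length, iInf_lt_iff] at h
  obtain ⟨n, t, ht, h0, hn, h⟩ := h
  refine ⟨n, fun i => t ⟨min i n, by omega⟩, fun i hi => ht ?_, ?_, ?_, ?_⟩
  · simp only [Fin.mk_lt_mk]; omega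
  · simpa using h0
  · simp only [min_self]; exact hn
  · rw [← Fin.sum_univ_eq_sum_range
      (fun i => L.τ (γ (t ⟨min i n, by omega⟩)) (γ (t ⟨min (i + 1) n, by omega⟩)))]
    refine lt_of_le_of_lt (le_of_eq (Finset.sum_congr rfl fun i _ => ?_)) h
    have h1 : (⟨min (i : ℕ) n, by omega⟩ : Fin (n + 1)) = i.castSucc := by
      ext; simp
    have h2 : (⟨min ((i : ℕ) + 1) n, by omega⟩ : Fin (n + 1)) = i.succ := by
      ext; simp
    rw [h1, h2]

lemma length_le_τ (γ : ℝ → M) {a b : ℝ} (h : a < b) : L.length γ a b ≤ L.τ (γ a) (γ b) := by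
  have := L.length_le_sum γ (a := a) (b := b) 1 (fun i => if i = 0 then a else b)
    (by intro i hi; obtain rfl : i = 0 := by omega
        simpa using h) (by simp) (by simp)
  simpa using this

lemma length_ne_top_of_split (γ : ℝ → M) {a b c : ℝ} (h₁ : L.length γ a c ≠ ∞)
    (h₂ : L.length γ c b ≠ ∞) : L.length γ a b ≠ ∞ := by
  obtain ⟨n, T, hT, h0, hn, hs⟩ := L.exists_partition_sum_lt γ h₁.lt_top
  obtain ⟨n', T', hT', h0', hn', hs'⟩ := L.exists_partition_sum_lt γ h₂.lt_top
  set S : ℕ → ℝ := fun i => if i ≤ n then T i else T' (i - n) with hS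
  have e1 : ∀ i ≤ n, S i = T i := fun i hi => by simp [hS, hi]
  have e2 : ∀ i, S (n + i) = T' i := fun i => by
    rcases Nat.eq_zero_or_pos i with rfl | hi
    · rw [add_zero, e1 n le_rfl, hn, h0']
    · simp only [hS]; rw [if_neg (by omega)]; congr 1; omega
  have := L.length_le_sum γ (a := a) (b := b) (n + n') S (fun i hi => ?_)
    (by rw [e1 0 (by omega), h0]) (by rw [e2, hn'])
  · refine (this.trans_lt ?_).ne
    rw [Finset.sum_range_add]
    refine ENNReal.add_lt_top.2 ⟨lt_of_le_of_lt (le_of_eq (Finset.sum_congr rfl fun i hi => ?_)) hs,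
      lt_of_le_of_lt (le_of_eq (Finset.sum_congr rfl fun i hi => ?_)) hs'⟩
    · have := Finset.mem_range.1 hi
      rw [e1 i (by omega), e1 (i + 1) (by omega)]
    · rw [add_assoc, e2, e2]
  · rcases lt_or_ge i n with h | h
    · rw [e1 i (by omega), e1 (i + 1) (by omega)]; exact hT i h
    · obtain ⟨j, rfl⟩ := Nat.exists_eq_add_of_le h
      rw [add_assoc, e2, e2]; exact hT' j (by omega)

lemma IsCausalCurve.continuousOn {γ : ℝ → M} {a b : ℝ} (h : L.IsCausalCurve γ a b) :
    ContinuousOn γ (Icc a b) := h.2.1.continuousOn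

lemma IsCausalCurve.le {γ : ℝ → M} {a b : ℝ} (h : L.IsCausalCurve γ a b) {s t : ℝ}
    (hs : s ∈ Icc a b) (ht : t ∈ Icc a b) (hst : s ≤ t) : L.le (γ s) (γ t) := by
  rcases hst.eq_or_lt with rfl | hst
  · exact L.le_refl _
  · exact h.2.2 s hs t ht hst

lemma IsCausalCurve.mono {γ : ℝ → M} {a b c d : ℝ} (h : L.IsCausalCurve γ a b) (hac : a ≤ c)
    (hcd : c < d) (hdb : d ≤ b) : L.IsCausalCurve γ c d :=
  ⟨hcd, h.2.1.mono (Icc_subset_Icc hac hdb), fun s hs t ht hst =>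
    h.2.2 s (Icc_subset_Icc hac hdb hs) t (Icc_subset_Icc hac hdb ht) hst⟩

/-- In a regular space no point is chronologically related to itself: otherwise the reverse
triangle inequality would force the local time separation to be infinite there. -/
lemma not_ll_self (hreg : L.IsRegular) (x : M) : ¬ L.ll x x := by
  obtain ⟨Ω, -, hx, -, -, W, hll, hle, -, hfin, -⟩ := hreg x
  intro h
  have h1 : W.ll ⟨x, hx⟩ ⟨x, hx⟩ := (hll _ _).2 h
  have h2 := W.reverse_triangle ⟨x, hx⟩ ⟨x, hx⟩ ⟨x, hx⟩ (W.le_refl _) (W.le_refl _)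
  have h3 := (W.τ_pos_iff _ _).2 h1
  exact absurd h2 (not_le.2 (ENNReal.lt_add_right (hfin _ _) h3.ne'))

lemma τ_self (hreg : L.IsRegular) (x : M) : L.τ x x = 0 := τ_eq_zero_of_not_ll (not_ll_self hreg x)

/-- Causal curves have finite length: finitely many localizing neighbourhoods cover the curve, and
the length of each piece is bounded by the finite local time separation. -/
lemma length_ne_top (hreg : L.IsRegular) {γ : ℝ → M} {a b : ℝ} (hγ : L.IsCausalCurve γ a b) :
    L.length γ a b ≠ ∞ := by
  choose Ω hΩo hΩ hloc using hreg
  -- A piece of the curve inside one localizing neighbourhood has finite length.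
  have piece : ∀ x : M, ∀ u ∈ Icc a b, ∀ v ∈ Icc a b, u < v → (∀ t ∈ Icc u v, γ t ∈ Ω x) →
      L.length γ u v ≠ ∞ := by
    intro x u hu v hv huv hsub
    by_cases huv' : γ u = γ v
    · refine ((L.length_le_τ γ huv).trans_lt ?_).ne
      rw [huv', τ_self fun y => ⟨Ω y, hΩo y, hΩ y, hloc y⟩]
      exact ENNReal.zero_lt_top
    · obtain ⟨-, -, W, hll, hle, -, hfin, hmax⟩ := hloc x
      obtain ⟨η, c, d, -, hη, hlen, -⟩ := hmax ⟨γ u, hsub u ⟨le_rfl, huv.le⟩⟩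
        ⟨γ v, hsub v ⟨huv.le, le_rfl⟩⟩ (hγ.le hu hv huv.le) (by simpa [Subtype.ext_iff] using huv')
      refine ((hη γ u v ⟨hγ.mono hu.1 huv hv.2, hsub, rfl, rfl⟩).trans_lt ?_).ne
      rw [hlen]
      exact (hfin _ _).lt_top
  have hc : Continuous ((Icc a b).domRestrict γ) := hγ.continuousOn.domRestrict
  obtain ⟨t, ht0, htm, ⟨N, hN⟩, ht⟩ := exists_monotone_Icc_subset_open_cover_Icc hγ.1.le
    (c := fun x : M => (Icc a b).domRestrict γ ⁻¹' Ω x) (fun x => (hΩo x).preimage hc)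
    (fun s _ => mem_iUnion.2 ⟨γ s, hΩ _⟩)
  have key : ∀ n, (t n : ℝ) = a ∨ L.length γ a (t n) ≠ ∞ := by
    intro n
    induction n with
    | zero => left; simpa using ht0
    | succ n ih =>
      have hle : (t n : ℝ) ≤ t (n + 1) := htm (Nat.le_succ n)
      rcases hle.eq_or_lt with h | h
      · rwa [← h]
      · obtain ⟨x, hx⟩ := ht n
        have hp := piece x (t n) (t n).2 (t (n + 1)) (t (n + 1)).2 h
          (fun s hs => hx (show (⟨s, (t n).2.1.trans hs.1, hs.2.trans (t (n + 1)).2.2⟩ : Icc a b) ∈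
            Icc (t n) (t (n + 1)) from ⟨hs.1, hs.2⟩))
        rcases ih with ih | ih
        · right; rwa [ih] at hp
        · right; exact L.length_ne_top_of_split γ ih hp
  rcases key N with h | h
  · have := hN N le_rfl
    rw [this] at h
    exact absurd h hγ.1.ne'
  · rwa [hN N le_rfl] at h

lemma τ_ne_top (hreg : L.IsRegular) (hgeo : L.IsGeodesicSpace) (x y : M) : L.τ x y ≠ ∞ := by
  by_cases h : L.le x y
  · by_cases hxy : x = y
    · rw [hxy, τ_self hreg]; exact ENNReal.zero_ne_top
    · obtain ⟨γ, a, b, hγ, -, -, hlen⟩ := hgeo x y h hxy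
      rw [← hlen]
      exact length_ne_top hreg hγ
  · rw [L.τ_eq_zero x y h]; exact ENNReal.zero_ne_top

/-- The time separation is additive along a curve, with primitive `φ`; this is how maximality of
a causal curve is used throughout. -/
def IsAdditiveAlong (L : LorentzianPreLengthSpace M) (γ : ℝ → M) (φ : ℝ → ℝ) (a b : ℝ) : Prop :=
  ∀ s ∈ Icc a b, ∀ t ∈ Icc a b, s ≤ t → φ s ≤ φ t ∧ L.τ (γ s) (γ t) = ENNReal.ofReal (φ t - φ s)

lemma IsAdditiveAlong.mono {γ : ℝ → M} {φ : ℝ → ℝ} {a b c d : ℝ}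
    (h : L.IsAdditiveAlong γ φ a b) (hac : a ≤ c) (hdb : d ≤ b) : L.IsAdditiveAlong γ φ c d :=
  fun s hs t ht => h s (Icc_subset_Icc hac hdb hs) t (Icc_subset_Icc hac hdb ht)

lemma IsAdditiveAlong.sum_eq {γ : ℝ → M} {φ : ℝ → ℝ} {a b : ℝ} (h : L.IsAdditiveAlong γ φ a b)
    {n : ℕ} {T : ℕ → ℝ} (hT : ∀ i < n, T i ≤ T (i + 1)) (hTm : ∀ i ≤ n, T i ∈ Icc a b) :
    ∑ i ∈ Finset.range n, L.τ (γ (T i)) (γ (T (i + 1))) = L.τ (γ (T 0)) (γ (T n)) := by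
  have hmono : ∀ k ≤ n, T 0 ≤ T k := by
    intro k hk
    induction k with
    | zero => exact le_rfl
    | succ k ih => exact (ih (by omega)).trans (hT k (by omega))
  rw [(h _ (hTm 0 (by omega)) _ (hTm n le_rfl) (hmono n le_rfl)).2,
    ← Finset.sum_range_sub (fun i => φ (T i)), ENNReal.ofReal_sum_of_nonneg]
  · refine Finset.sum_congr rfl fun i hi => ?_
    have := Finset.mem_range.1 hi
    exact (h _ (hTm i (by omega)) _ (hTm (i + 1) (by omega)) (hT i this)).2
  · intro i hi
    have := Finset.mem_range.1 hi
    exact sub_nonneg.2 (h _ (hTm i (by omega)) _ (hTm (i + 1) (by omega)) (hT i this)).1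

lemma IsAdditiveAlong.τ_le_length {γ : ℝ → M} {φ : ℝ → ℝ} {a b : ℝ}
    (h : L.IsAdditiveAlong γ φ a b) : L.τ (γ a) (γ b) ≤ L.length γ a b := by
  by_contra hlt
  obtain ⟨n, T, hT, h0, hn, hs⟩ := L.exists_partition_sum_lt γ (not_le.1 hlt)
  have hm : ∀ i j, i ≤ j → j ≤ n → T i ≤ T j := by
    intro i j hij
    induction j, hij using Nat.le_induction with
    | base => intro _; exact le_rfl
    | succ j hj ih => intro hjn; exact (ih (by omega)).trans (hT j (by omega)).le
  have := h.sum_eq (n := n) (T := T) (fun i hi => (hT i hi).le)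
    (fun i hi => ⟨h0 ▸ hm 0 i (by omega) hi, hn ▸ hm i n hi le_rfl⟩)
  rw [this, h0, hn] at hs
  exact lt_irrefl _ hs

/-- A maximal causal curve makes `τ` additive. -/
lemma IsCausalCurve.isAdditiveAlong (hreg : L.IsRegular) (hgeo : L.IsGeodesicSpace)
    {γ : ℝ → M} {a b : ℝ} (hγ : L.IsCausalCurve γ a b) (hlen : L.length γ a b = L.τ (γ a) (γ b)) :
    L.IsAdditiveAlong γ (fun t => (L.τ (γ a) (γ t)).toReal) a b := by
  have ha : a ∈ Icc a b := ⟨le_rfl, hγ.1.le⟩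
  have hb : b ∈ Icc a b := ⟨hγ.1.le, le_rfl⟩
  have hfin := τ_ne_top hreg hgeo
  -- Splitting the curve at an interior time cannot lose length.
  have split : ∀ s ∈ Icc a b, L.τ (γ a) (γ s) + L.τ (γ s) (γ b) = L.τ (γ a) (γ b) := by
    intro s hs
    refine le_antisymm (L.reverse_triangle _ _ _ (hγ.le ha hs hs.1) (hγ.le hs hb hs.2)) ?_
    rcases hs.1.eq_or_lt with h | h
    · rw [← h]; exact le_add_self
    rcases hs.2.eq_or_lt with h' | h'
    · rw [h']; exact le_self_add
    rw [← hlen]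
    have := L.length_le_sum γ (a := a) (b := b) 2
      (fun i => if i = 0 then a else if i = 1 then s else b)
      (by intro i hi; interval_cases i <;> simp [h, h']) (by simp) (by simp)
    simpa [Finset.sum_range_succ] using this
  intro s hs t ht hst
  have h1 : L.τ (γ a) (γ s) + L.τ (γ s) (γ t) = L.τ (γ a) (γ t) := by
    refine le_antisymm (L.reverse_triangle _ _ _ (hγ.le ha hs hs.1) (hγ.le hs ht hst)) ?_
    have e1 := split s hs
    have e2 := split t ht
    have e3 := L.reverse_triangle _ _ _ (hγ.le hs ht hst) (hγ.le ht hb ht.2)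
    rcases hs.1.eq_or_lt with h | h
    · rw [← h]; exact le_add_self
    rcases ht.2.eq_or_lt with h' | h'
    · rw [h', split s hs]
    rcases hst.eq_or_lt with h'' | h''
    · rw [h'']; exact le_self_add
    -- A partition through `s` and `t` bounds the total length, which is also split at `t`.
    have := L.length_le_sum γ (a := a) (b := b) 3
      (fun i => if i = 0 then a else if i = 1 then s else if i = 2 then t else b)
      (by intro i hi; interval_cases i <;> simp [h, h', h'']) (by simp) (by simp)
    simp only [Finset.sum_range_succ, Finset.sum_range_zero, hlen] at this
    simp only [zero_add, if_true, one_ne_zero, if_false] at this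
    norm_num at this
    rw [← e2] at this
    exact (ENNReal.add_le_add_iff_right (hfin _ _)).1 this
  refine ⟨ENNReal.toReal_mono (hfin _ _) (h1 ▸ le_self_add), ?_⟩
  simp only
  rw [← h1, ENNReal.toReal_add (hfin _ _) (hfin _ _), add_sub_cancel_left,
    ENNReal.ofReal_toReal (hfin _ _)]

end Geometry

end LorentzianPreLengthSpace

namespace LorentzianPreLengthSpace

/-! ### Limits of causal curves, closedness of the causal relation and continuity of `τ` -/

section Geometry

variable {M : Type*} [MetricSpace M] {L : LorentzianPreLengthSpace M}

/-- A curve of variation less than `n ε` can be cut into `n` pieces, each of which stays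
`ε`-close to its initial point. -/
lemma exists_chain_of_eVariationOn_lt {γ : ℝ → M} {ε : ℝ} (hε : 0 < ε) {b : ℝ} (n : ℕ) :
    ∀ a, a ≤ b → ContinuousOn γ (Icc a b) → eVariationOn γ (Icc a b) < n * ENNReal.ofReal ε →
      ∃ T : ℕ → ℝ, Monotone T ∧ T 0 = a ∧ (∀ i, n ≤ i → T i = b) ∧
        ∀ i, ∀ u ∈ Icc (T i) (T (i + 1)), dist (γ u) (γ (T i)) ≤ ε := by
  induction n with
  | zero => intro a _ _ h; simp at h
  | succ n ih =>
    intro a hab hc hv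
    by_cases hall : ∀ u ∈ Icc a b, dist (γ u) (γ a) ≤ ε
    · refine ⟨fun i => if i = 0 then a else b, ?_, by simp, fun i hi => by simp; omega, ?_⟩
      · refine monotone_nat_of_le_succ fun i => ?_
        by_cases h : i = 0 <;> simp [h, hab]
      · intro i u hu
        by_cases h : i = 0
        · subst h; simpa using hall u (by simpa using hu)
        · simp only [h, if_false, Nat.succ_ne_zero, Icc_self, mem_singleton_iff] at hu ⊢
          rw [hu, dist_self]; exact hε.le
    · push Not at hall
      obtain ⟨v, hv1, hv2⟩ := hall
      have hd : ContinuousOn (fun u => dist (γ u) (γ a)) (Icc a b) :=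
        (continuous_id.dist continuous_const).comp_continuousOn hc
      have hcl : IsCompact {u ∈ Icc a b | ε ≤ dist (γ u) (γ a)} := by
        have := hd.preimage_isClosed_of_isClosed isClosed_Icc (isClosed_Ici (a := ε))
        exact isCompact_Icc.of_isClosed_subset this (fun u hu => hu.1)
      obtain ⟨t, ⟨ht, hte⟩, htmin⟩ := hcl.exists_isMinOn ⟨v, hv1, hv2.le⟩ continuousOn_id
      have hta : a ≤ t := ht.1
      -- The first exit time from the ball has distance exactly `ε` to the initial point.
      have hteq : dist (γ t) (γ a) = ε := by
        obtain ⟨u, hu, hue⟩ : ε ∈ (fun u => dist (γ u) (γ a)) '' Icc a t :=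
          intermediate_value_Icc hta (hd.mono (Icc_subset_Icc le_rfl ht.2))
            ⟨by simpa using hε.le, hte⟩
        have h1 := htmin (show u ∈ {u ∈ Icc a b | ε ≤ dist (γ u) (γ a)} from
          ⟨⟨hu.1, hu.2.trans ht.2⟩, hue.ge⟩)
        have h2 : u = t := le_antisymm hu.2 h1
        rw [← h2]; exact hue
      have hbef : ∀ u ∈ Icc a t, dist (γ u) (γ a) ≤ ε := by
        intro u hu
        by_contra hlt
        have h1 := htmin (show u ∈ {u ∈ Icc a b | ε ≤ dist (γ u) (γ a)} from
          ⟨⟨hu.1, hu.2.trans ht.2⟩, (not_le.1 hlt).le⟩)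
        have h2 : u = t := le_antisymm hu.2 h1
        rw [h2] at hlt
        exact hlt hteq.le
      have hv' : eVariationOn γ (Icc t b) < n * ENNReal.ofReal ε := by
        have h1 := eVariationOn.Icc_add_Icc γ (s := univ) hta ht.2 (mem_univ _)
        simp only [univ_inter] at h1
        have h2 : ENNReal.ofReal ε ≤ eVariationOn γ (Icc a t) := by
          have := eVariationOn.edist_le γ (s := Icc a t) (x := t) (y := a) ⟨hta, le_rfl⟩ ⟨le_rfl, hta⟩
          rwa [edist_dist, hteq] at this
        rw [← h1] at hv
        by_contra hge
        refine absurd hv (not_lt.2 ?_)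
        push_cast
        rw [add_mul, one_mul, add_comm]
        exact add_le_add h2 (not_lt.1 hge)
      obtain ⟨T, hTm, hT0, hTn, hT⟩ := ih t ht.2 (hc.mono (Icc_subset_Icc hta le_rfl)) hv'
      refine ⟨fun i => Nat.casesOn i a T, monotone_nat_of_le_succ fun i => ?_, rfl, fun i hi => ?_, ?_⟩
      · cases i with
        | zero => simpa [hT0] using hta
        | succ i => exact hTm (Nat.le_succ i)
      · cases i with
        | zero => omega
        | succ i => exact hTn i (by omega)
      · intro i
        cases i with
        | zero => simpa [hT0] using hbef
        | succ i => exact hT i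

/-- Limits of causal curves, in discretized form: curves between converging endpoints can be cut
into a fixed number of pieces, the `i`-th piece lying in one member of a given open cover, with
converging division points along a subsequence. -/
lemma exists_limit_chain (hhyp : L.KGloballyHyperbolic) {P : Set M → Prop}
    (hP : ∀ x, ∃ U, IsOpen U ∧ x ∈ U ∧ P U) {x y : M} {γ : ℕ → ℝ → M} {a b : ℕ → ℝ}
    (hγ : ∀ k, L.IsCausalCurve (γ k) (a k) (b k))
    (hx : Tendsto (fun k => γ k (a k)) atTop (𝓝 x))
    (hy : Tendsto (fun k => γ k (b k)) atTop (𝓝 y)) :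
    ∃ (n : ℕ) (T : ℕ → ℕ → ℝ) (z : ℕ → M) (U : ℕ → Set M) (φ : ℕ → ℕ), StrictMono φ ∧
      z 0 = x ∧ z n = y ∧ (∀ i, IsOpen (U i) ∧ z i ∈ U i ∧ z (i + 1) ∈ U i ∧ P (U i)) ∧
      (∀ k, Monotone (T k)) ∧ (∀ k, T k 0 = a (φ k)) ∧ (∀ k, T k n = b (φ k)) ∧
      (∀ k i, T k i ∈ Icc (a (φ k)) (b (φ k))) ∧
      (∀ i, Tendsto (fun k => γ (φ k) (T k i)) atTop (𝓝 (z i))) ∧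
      ∀ i, ∀ᶠ k in atTop, ∀ u ∈ Icc (T k i) (T k (i + 1)), γ (φ k) u ∈ U i := by
  set C := L.causalDiamond (insert x (range fun k => γ k (a k))) (insert y (range fun k => γ k (b k)))
    with hC
  have hCc : IsCompact C := hhyp.2 _ _ hx.isCompact_insert_range hy.isCompact_insert_range
  have hmem : ∀ k, ∀ t ∈ Icc (a k) (b k), γ k t ∈ C := fun k t ht =>
    ⟨⟨_, mem_insert_of_mem _ (mem_range_self k), (hγ k).le ⟨le_rfl, (hγ k).1.le⟩ ht ht.1⟩,
      ⟨_, mem_insert_of_mem _ (mem_range_self k), (hγ k).le ht ⟨(hγ k).1.le, le_rfl⟩ ht.2⟩⟩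
  obtain ⟨c, hc0, hc⟩ := hhyp.1 C hCc
  choose U hUo hU hUP using hP
  obtain ⟨δ, hδ, hleb⟩ := lebesgue_number_lemma_of_metric hCc hUo
    (fun z _ => mem_iUnion.2 ⟨z, hU z⟩)
  set ε := δ / 2 with hε
  have hε0 : 0 < ε := by positivity
  obtain ⟨n, hn⟩ := exists_nat_gt (c / ε)
  have hvar : ∀ k, eVariationOn (γ k) (Icc (a k) (b k)) < n * ENNReal.ofReal ε := by
    intro k
    refine (hc (γ k) (a k) (b k) (hγ k) (hmem k)).trans_lt ?_
    rw [← ENNReal.ofReal_natCast, ← ENNReal.ofReal_mul (by positivity)]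
    have : c < n * ε := (div_lt_iff₀ hε0).1 hn
    exact (ENNReal.ofReal_lt_ofReal_iff (hc0.trans this)).2 this
  choose T hTm hT0 hTn hT using fun k =>
    exists_chain_of_eVariationOn_lt hε0 n (a k) (hγ k).1.le (hγ k).continuousOn (hvar k)
  have hTI : ∀ k i, T k i ∈ Icc (a k) (b k) := fun k i =>
    ⟨(hT0 k) ▸ hTm k (Nat.zero_le i), by
      rw [← hTn k (max i n) (le_max_right _ _)]; exact hTm k (le_max_left _ _)⟩
  obtain ⟨z, hz, φ, hφ, hlim⟩ := (isCompact_univ_pi fun _ : ℕ => hCc).tendsto_subseq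
    (x := fun k i => γ k (T k i)) (fun k i _ => hmem k _ (hTI k i))
  have hlim' : ∀ i, Tendsto (fun k => γ (φ k) (T (φ k) i)) atTop (𝓝 (z i)) :=
    fun i => (tendsto_pi_nhds.1 hlim) i
  have hzd : ∀ i, dist (z (i + 1)) (z i) ≤ ε := fun i =>
    le_of_tendsto' ((hlim' (i + 1)).dist (hlim' i)) fun k =>
      hT (φ k) i _ ⟨hTm (φ k) (Nat.le_succ i), le_rfl⟩
  choose V hV using fun i => hleb (z i) (hz i (mem_univ i))
  refine ⟨n, fun k => T (φ k), z, fun i => U (V i), φ, hφ, ?_, ?_, fun i => ⟨hUo _, ?_, ?_, hUP _⟩,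
    fun k => hTm _, fun k => hT0 _, fun k => hTn _ n le_rfl, fun k i => hTI _ i, hlim', fun i => ?_⟩
  · refine tendsto_nhds_unique (hlim' 0) ?_
    simp only [hT0]
    exact hx.comp hφ.tendsto_atTop
  · refine tendsto_nhds_unique (hlim' n) ?_
    simp only [hTn _ n le_rfl]
    exact hy.comp hφ.tendsto_atTop
  · exact hV i (Metric.mem_ball_self hδ)
  · exact hV i (Metric.mem_ball.2 ((hzd i).trans_lt (by rw [hε]; linarith)))
  · filter_upwards [(hlim' i).eventually (Metric.ball_mem_nhds (z i) hε0)] with k hk u hu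
    refine hV i (Metric.mem_ball.2 ?_)
    have h1 := hT (φ k) i u hu
    have h2 := dist_triangle (γ (φ k) u) (γ (φ k) (T (φ k) i)) (z i)
    have h3 : dist (γ (φ k) (T (φ k) i)) (z i) < ε := hk
    rw [hε] at h1 h3
    linarith

/-- The local closedness of the causal relation is global: causal curves between the points of a
convergent sequence of pairs are subdivided, and the relation passes to the limit piece by piece. -/
lemma isClosed_le (hclosed : L.LocallyCausallyClosed) (hhyp : L.KGloballyHyperbolic)
    (hgeo : L.IsGeodesicSpace) : IsClosed {z : M × M | L.le z.1 z.2} := by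
  refine IsSeqClosed.isClosed fun u w hu hw => ?_
  have hx : Tendsto (fun k => (u k).1) atTop (𝓝 w.1) := (continuous_fst.tendsto _).comp hw
  have hy : Tendsto (fun k => (u k).2) atTop (𝓝 w.2) := (continuous_snd.tendsto _).comp hw
  by_cases hfr : ∃ᶠ k in atTop, (u k).1 = (u k).2
  · have : w ∈ {z : M × M | z.1 = z.2} :=
      (isClosed_eq continuous_fst continuous_snd).mem_of_frequently_of_tendsto hfr hw
    show L.le w.1 w.2
    rw [show w.1 = w.2 from this]
    exact L.le_refl _
  obtain ⟨k₀, hk₀⟩ := eventually_atTop.1 (not_frequently.1 hfr)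
  choose γ a b hγ hγa hγb _ using fun k => hgeo (u (k + k₀)).1 (u (k + k₀)).2 (hu _)
    (hk₀ (k + k₀) (by omega))
  obtain ⟨n, T, z, U, φ, hφ, hz0, hzn, hU, hTm, -, -, hTI, hlim, hin⟩ :=
    exists_limit_chain hhyp hclosed (x := w.1) (y := w.2) hγ
      (by simp only [hγa]; exact (tendsto_add_atTop_iff_nat k₀).2 hx)
      (by simp only [hγb]; exact (tendsto_add_atTop_iff_nat k₀).2 hy)
  show L.le w.1 w.2
  rw [← hz0, ← hzn]
  refine le_of_monotone_chain fun i _ => ?_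
  have h := (hU i).2.2.2.mem_of_tendsto ((hlim i).prodMk_nhds (hlim (i + 1))) (by
    filter_upwards [hin i] with k hk
    exact ⟨subset_closure (hk _ ⟨le_rfl, hTm k (Nat.le_succ i)⟩),
      subset_closure (hk _ ⟨hTm k (Nat.le_succ i), le_rfl⟩),
      (hγ (φ k)).le (hTI k i) (hTI k (i + 1)) (hTm k (Nat.le_succ i))⟩)
  exact h.2.2

/-- Upper semicontinuity of `τ` comes from the continuity of the local time separations, which
agree with `τ` on short pieces of maximal curves. -/
lemma continuous_τ (hclosed : L.LocallyCausallyClosed)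
    (hhyp : L.KGloballyHyperbolic) (hreg : L.IsRegular) (hgeo : L.IsGeodesicSpace) :
    Continuous fun z : M × M => L.τ z.1 z.2 := by
  rw [continuous_iff_lower_upperSemicontinuous]
  refine ⟨L.lowerSemicontinuous_τ, fun w r hr => ?_⟩
  by_contra hcon
  obtain ⟨u, hu, hur⟩ := exists_seq_forall_of_frequently (not_eventually.1 hcon)
  have hr0 : 0 < r := pos_of_gt hr
  have hll : ∀ k, L.ll (u k).1 (u k).2 := fun k =>
    (L.τ_pos_iff _ _).1 (hr0.trans_le (not_lt.1 (hur k)))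
  choose γ a b hγ hγa hγb hlen using fun k => hgeo (u k).1 (u k).2 (L.le_of_ll _ _ (hll k))
    (fun h => not_ll_self hreg (u k).2 (by have := hll k; rwa [h] at this))
  have hadd := fun k => (hγ k).isAdditiveAlong hreg hgeo (by rw [hlen, hγa, hγb])
  obtain ⟨n, T, z, U, φ, hφ, hz0, hzn, hU, hTm, hT0, hTn, hTI, hlim, hin⟩ :=
    exists_limit_chain hhyp hreg (x := w.1) (y := w.2) hγ
      (by simp only [hγa]; exact (continuous_fst.tendsto _).comp hu)
      (by simp only [hγb]; exact (continuous_snd.tendsto _).comp hu)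
  have hzle : ∀ i, L.le (z i) (z (i + 1)) := fun i =>
    (isClosed_le hclosed hhyp hgeo).mem_of_tendsto ((hlim i).prodMk_nhds (hlim (i + 1)))
      (.of_forall fun k => (hγ (φ k)).le (hTI k i) (hTI k (i + 1)) (hTm k (Nat.le_succ i)))
  choose W hWll hWle hWc hWfin hWmax using fun i => (hU i).2.2.2.2.2
  -- The local time separations, extended by zero.
  classical
  set ω : ℕ → M → M → ℝ≥0∞ := fun i p q =>
    if h : p ∈ U i ∧ q ∈ U i then (W i).τ ⟨p, h.1⟩ ⟨q, h.2⟩ else 0 with hω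
  -- Between the limits of the division points, where the pair may be degenerate, `ω ≤ τ`.
  have hωτ : ∀ i, ω i (z i) (z (i + 1)) ≤ L.τ (z i) (z (i + 1)) := by
    intro i
    simp only [hω]
    rw [dif_pos ⟨(hU i).2.1, (hU i).2.2.1⟩]
    by_cases h : z i = z (i + 1)
    · have : ¬ (W i).ll ⟨z i, (hU i).2.1⟩ ⟨z (i + 1), (hU i).2.2.1⟩ := by
        rw [hWll]; simp only; rw [h]; exact not_ll_self hreg _
      rw [τ_eq_zero_of_not_ll this]
      exact zero_le
    · obtain ⟨_, _, _, -, -, -, h, -⟩ := hWmax i ⟨z i, (hU i).2.1⟩ ⟨z (i + 1), (hU i).2.2.1⟩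
        (hzle i) (by simpa [Subtype.ext_iff] using h)
      exact h
  -- Along the approximating curves, `τ` is the length of the piece, hence at most `ω`.
  have hτω : ∀ i, ∀ᶠ k in atTop,
      L.τ (γ (φ k) (T k i)) (γ (φ k) (T k (i + 1))) ≤
        ω i (γ (φ k) (T k i)) (γ (φ k) (T k (i + 1))) := by
    intro i
    filter_upwards [hin i] with k hk
    have hle := hTm k (Nat.le_succ i)
    have m1 := hk _ ⟨le_rfl, hle⟩
    have m2 := hk _ ⟨hle, le_rfl⟩
    simp only [hω]
    rw [dif_pos ⟨m1, m2⟩]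
    by_cases h : γ (φ k) (T k i) = γ (φ k) (T k (i + 1))
    · have h0 : L.τ (γ (φ k) (T k i)) (γ (φ k) (T k (i + 1))) = 0 := by rw [h, τ_self hreg]
      rw [h0]; exact zero_le
    · have hlt : T k i < T k (i + 1) := lt_of_le_of_ne hle fun h' => h (by rw [h'])
      obtain ⟨η, c, d, -, hη, hηl, -⟩ := hWmax i ⟨_, m1⟩ ⟨_, m2⟩
        ((hγ (φ k)).le (hTI k i) (hTI k (i + 1)) hle) (by simpa [Subtype.ext_iff] using h)
      rw [← hηl]
      refine _root_.le_trans ?_ (hη (γ (φ k)) (T k i) (T k (i + 1))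
        ⟨(hγ (φ k)).mono (hTI k i).1 hlt (hTI k (i + 1)).2, hk, rfl, rfl⟩)
      exact ((hadd (φ k)).mono (hTI k i).1 (hTI k (i + 1)).2).τ_le_length
  have hωlim : ∀ i, Tendsto (fun k => ω i (γ (φ k) (T k i)) (γ (φ k) (T k (i + 1)))) atTop
      (𝓝 (ω i (z i) (z (i + 1)))) := by
    intro i
    have hcont : ContinuousOn (fun q : M × M => ω i q.1 q.2) (U i ×ˢ U i) := by
      rw [continuousOn_iff_continuous_domRestrict]
      have : Continuous fun q : (U i ×ˢ U i : Set (M × M)) =>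
          (W i).τ ⟨q.1.1, q.2.1⟩ ⟨q.1.2, q.2.2⟩ :=
        (hWc i).comp (((continuous_fst.comp continuous_subtype_val).subtype_mk _).prodMk
          ((continuous_snd.comp continuous_subtype_val).subtype_mk _))
      refine this.congr fun q => ?_
      simp only [domRestrict_apply, hω]
      rw [dif_pos (show q.1.1 ∈ U i ∧ q.1.2 ∈ U i from q.2)]
    have hnhds : U i ×ˢ U i ∈ 𝓝 (z i, z (i + 1)) :=
      ((hU i).1.prod (hU i).1).mem_nhds ⟨(hU i).2.1, (hU i).2.2.1⟩
    exact (hcont.continuousAt hnhds).tendsto.comp ((hlim i).prodMk_nhds (hlim (i + 1)))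
  have hbound : r ≤ ∑ i ∈ Finset.range n, ω i (z i) (z (i + 1)) := by
    refine ge_of_tendsto (tendsto_finsetSum _ fun i _ => hωlim i) ?_
    have : ∀ᶠ k in atTop, ∀ i ∈ Finset.range n, L.τ (γ (φ k) (T k i)) (γ (φ k) (T k (i + 1))) ≤
        ω i (γ (φ k) (T k i)) (γ (φ k) (T k (i + 1))) :=
      (Filter.eventually_all_finset _).2 fun i _ => hτω i
    filter_upwards [this] with k hk
    refine _root_.le_trans ?_ (Finset.sum_le_sum hk)
    rw [(hadd (φ k)).sum_eq (fun i _ => hTm k (Nat.le_succ i)) (fun i _ => hTI k i), hT0, hTn, hγa,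
      hγb]
    exact not_lt.1 (hur _)
  refine absurd hr (not_lt.2 (hbound.trans ?_))
  show _ ≤ L.τ w.1 w.2
  rw [← hz0, ← hzn]
  exact (Finset.sum_le_sum fun i _ => hωτ i).trans (sum_τ_le_of_chain fun i _ => hzle i)

end Geometry

end LorentzianPreLengthSpace

namespace LorentzianPreLengthSpace

/-! ### Maximal curves of positive length contain no null pieces -/

section Geometry

variable {M : Type*} [MetricSpace M] {L : LorentzianPreLengthSpace M}

lemma continuous_toReal_τ (hτ : Continuous fun z : M × M => L.τ z.1 z.2)
    (hfin : ∀ x y, L.τ x y ≠ ∞) : Continuous fun z : M × M => (L.τ z.1 z.2).toReal :=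
  ENNReal.continuousOn_toReal.comp_continuous hτ fun z => hfin z.1 z.2

/-- A curve which is not constant up to time `s` is already not constant on some final piece inside
a given neighbourhood of its endpoint. -/
lemma exists_left_of_ne {γ : ℝ → M} {r s : ℝ} (hc : ContinuousOn γ (Icc r s)) {Ω : Set M}
    (hΩ : IsOpen Ω) (hs : γ s ∈ Ω) (hne : ∃ v ∈ Icc r s, γ v ≠ γ s) :
    ∃ r' ∈ Icc r s, γ r' ≠ γ s ∧ ∀ t ∈ Icc r' s, γ t ∈ Ω := by
  obtain ⟨v, hv, hvs⟩ := hne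
  by_cases hall : ∀ t ∈ Icc v s, γ t ∈ Ω
  · exact ⟨v, hv, hvs, hall⟩
  push Not at hall
  obtain ⟨t, ht, htΩ⟩ := hall
  have hcpt : IsCompact (Icc r s ∩ γ ⁻¹' Ωᶜ) :=
    isCompact_Icc.of_isClosed_subset
      (hc.preimage_isClosed_of_isClosed isClosed_Icc hΩ.isClosed_compl) inter_subset_left
  obtain ⟨w, ⟨hw, hwΩ⟩, hmax⟩ :=
    hcpt.exists_isMaxOn ⟨t, ⟨hv.1.trans ht.1, ht.2⟩, htΩ⟩ continuousOn_id
  have hws : w < s := lt_of_le_of_ne hw.2 fun h => hwΩ (by rwa [h])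
  have hin : ∀ t, w < t → t ≤ s → γ t ∈ Ω := by
    intro t h1 h2
    by_contra h
    have := hmax (show t ∈ Icc r s ∩ γ ⁻¹' Ωᶜ from ⟨⟨hw.1.trans h1.le, h2⟩, h⟩)
    exact absurd h1 (not_lt.2 this)
  by_contra hcon
  push Not at hcon
  have hconst : ∀ t, w < t → t ≤ s → γ t = γ s := by
    intro t h1 h2
    by_contra h
    obtain ⟨t', ht', h'⟩ := hcon t ⟨hw.1.trans h1.le, h2⟩ h
    exact h' (hin t' (h1.trans_le ht'.1) ht'.2)
  have h1 : ContinuousWithinAt γ (Ioc w s) w :=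
    (hc w hw).mono (fun t ht => ⟨hw.1.trans ht.1.le, ht.2⟩)
  have h2 : Tendsto γ (𝓝[Ioc w s] w) (𝓝 (γ s)) :=
    tendsto_const_nhds.congr' (by
      filter_upwards [self_mem_nhdsWithin] with t ht using (hconst t ht.1 ht.2).symm)
  have : (𝓝[Ioc w s] w).NeBot := by
    rw [nhdsWithin_Ioc_eq_nhdsGT hws]; infer_instance
  have h3 : γ w = γ s := tendsto_nhds_unique h1 h2
  exact hwΩ (by show γ w ∈ Ω; rwa [h3])

/-- The time reversal of `exists_left_of_ne`. -/
lemma exists_right_of_ne {γ : ℝ → M} {r s : ℝ} (hc : ContinuousOn γ (Icc r s)) {Ω : Set M}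
    (hΩ : IsOpen Ω) (hr : γ r ∈ Ω) (hne : ∃ v ∈ Icc r s, γ v ≠ γ r) :
    ∃ s' ∈ Icc r s, γ s' ≠ γ r ∧ ∀ t ∈ Icc r s', γ t ∈ Ω := by
  have hc' : ContinuousOn (fun t => γ (-t)) (Icc (-s) (-r)) :=
    hc.comp continuous_neg.continuousOn fun t ht => ⟨by linarith [ht.2], by linarith [ht.1]⟩
  obtain ⟨v, hv, hvr⟩ := hne
  obtain ⟨r', hr', h1, h2⟩ := exists_left_of_ne hc' hΩ (by simpa using hr)
    ⟨-v, ⟨by linarith [hv.2], by linarith [hv.1]⟩, by simpa using hvr⟩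
  exact ⟨-r', ⟨by linarith [hr'.2], by linarith [hr'.1]⟩, by simpa using h1, fun t ht => by
    simpa using h2 (-t) ⟨by linarith [ht.2], by linarith [ht.1]⟩⟩

/-- Inside a localizing neighbourhood, a maximal curve of positive length has no nonconstant null
piece, since it would be strictly shorter than the maximal curve between its endpoints, and hence
than `τ`. -/
lemma IsAdditiveAlong.not_null_piece {Ω : Set M} (hΩ : L.IsRegularLocalizing Ω)
    (hirr : ∀ x, ¬ L.ll x x) {γ : ℝ → M} {φ : ℝ → ℝ} {a b : ℝ} (hγ : L.IsCausalCurve γ a b)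
    (hφ : L.IsAdditiveAlong γ φ a b) (hin : ∀ t ∈ Icc a b, γ t ∈ Ω) (hlt : φ a < φ b) {u w : ℝ}
    (hu : u ∈ Icc a b) (hw : w ∈ Icc a b) (huw : u ≤ w) (heq : φ u = φ w) : γ u = γ w := by
  by_contra hne
  have huw' : u < w := lt_of_le_of_ne huw fun h => hne (by rw [h])
  have ha : a ∈ Icc a b := ⟨le_rfl, hγ.1.le⟩
  have hb : b ∈ Icc a b := ⟨hγ.1.le, le_rfl⟩
  have hll : L.ll (γ a) (γ b) := by
    rw [← L.τ_pos_iff, (hφ a ha b hb hγ.1.le).2]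
    exact ENNReal.ofReal_pos.2 (sub_pos.2 hlt)
  obtain ⟨-, -, W, -, -, -, -, hmax⟩ := hΩ
  obtain ⟨η, c, d, -, -, hlen, hWτ, hstrict⟩ := hmax ⟨γ a, hin a ha⟩ ⟨γ b, hin b hb⟩
    (L.le_of_ll _ _ hll) (fun h => hirr (γ b) (by
      have : γ a = γ b := congrArg Subtype.val h
      rwa [this] at hll))
  have := (hstrict hll).2 γ a b ⟨hγ, hin, rfl, rfl⟩
    ⟨u, hu, w, hw, huw', ⟨w, ⟨huw, le_rfl⟩, fun h => hne h.symm⟩, fun h => by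
      rw [← L.τ_pos_iff, (hφ u hu w hw huw).2, heq, sub_self] at h
      simp at h⟩
  rw [hlen] at this
  exact absurd (this.trans_le hWτ) (not_lt.2 hφ.τ_le_length)

/-- A maximal causal curve of positive length contains no nonconstant null piece. -/
lemma IsAdditiveAlong.eq_of_eq (hreg : L.IsRegular) (hτ : Continuous fun z : M × M => L.τ z.1 z.2)
    (hfin : ∀ x y, L.τ x y ≠ ∞) {γ : ℝ → M} {φ : ℝ → ℝ}
    {a b : ℝ} (hγ : L.IsCausalCurve γ a b) (hφ : L.IsAdditiveAlong γ φ a b) (hlt : φ a < φ b)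
    {r s : ℝ} (hr : r ∈ Icc a b) (hs : s ∈ Icc a b) (hrs : r ≤ s) (heq : φ r = φ s) :
    γ r = γ s := by
  by_contra hne
  have ha : a ∈ Icc a b := ⟨le_rfl, hγ.1.le⟩
  have hb : b ∈ Icc a b := ⟨hγ.1.le, le_rfl⟩
  have hirr := not_ll_self hreg
  have hγc := hγ.continuousOn
  have hφc : ContinuousOn φ (Icc a b) := by
    have h1 : ContinuousOn (fun t => φ a + (L.τ (γ a) (γ t)).toReal) (Icc a b) := by
      exact continuousOn_const.add ((continuous_toReal_τ hτ hfin).comp_continuousOn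
        (continuousOn_const.prodMk hγc))
    refine h1.congr fun t ht => ?_
    have := hφ a ha t ht ht.1
    simp only
    rw [this.2, ENNReal.toReal_ofReal (sub_nonneg.2 this.1)]
    ring
  have hcpt : IsCompact (Icc a b ∩ φ ⁻¹' {φ r}) :=
    isCompact_Icc.of_isClosed_subset
      (hφc.preimage_isClosed_of_isClosed isClosed_Icc isClosed_singleton) inter_subset_left
  -- The level of the null piece is not both the lowest and the highest one.
  have hcases : φ s < φ b ∨ φ a < φ r := by
    by_contra h
    push Not at h
    exact absurd hlt (not_lt.2 (h.1.trans (heq ▸ h.2)))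
  rcases hcases with hcase | hcase
  · -- The last time `c` at which the level is attained; the curve is timelike right after it.
    obtain ⟨c, ⟨hc, hcφ⟩, hmax⟩ := hcpt.exists_isMaxOn ⟨r, hr, rfl⟩ continuousOn_id
    have hcφ : φ c = φ r := hcφ
    have hsc : s ≤ c := hmax (show s ∈ Icc a b ∩ φ ⁻¹' {φ r} from ⟨hs, heq.symm⟩)
    have hcb : c < b := lt_of_le_of_ne hc.2 fun h => by rw [← h, hcφ, heq] at hcase; exact lt_irrefl _ hcase
    obtain ⟨Ω, hΩo, hΩ, hloc⟩ := hreg (γ c)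
    obtain ⟨r', hr', hr'ne, hr'in⟩ := exists_left_of_ne (r := r)
      (hγc.mono (Icc_subset_Icc hr.1 hc.2)) hΩo hΩ (by
        by_cases h : γ r = γ c
        · exact ⟨s, ⟨hrs, hsc⟩, fun h' => hne (h.trans h'.symm)⟩
        · exact ⟨r, ⟨le_rfl, hrs.trans hsc⟩, h⟩)
    have hnh : ∀ᶠ t in 𝓝[>] c, ∀ v ∈ Icc c t, γ v ∈ Ω := by
      have h1 : ∀ᶠ t in 𝓝[Icc a b] c, γ t ∈ Ω := (hγc c hc).eventually (hΩo.mem_nhds hΩ)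
      have h2 : ∀ᶠ t in 𝓝[≥] c, γ t ∈ Ω := by
        rw [← nhdsWithin_Icc_eq_nhdsGE hcb]
        exact nhdsWithin_mono _ (Icc_subset_Icc hc.1 le_rfl) h1
      obtain ⟨u, hu, hsub⟩ := mem_nhdsGE_iff_exists_Icc_subset.1 h2
      filter_upwards [Ioo_mem_nhdsGT hu] with t ht v hv
      exact hsub ⟨hv.1, hv.2.trans ht.2.le⟩
    obtain ⟨s', hs'in, hs'⟩ := (hnh.and (Ioo_mem_nhdsGT hcb)).exists
    have hφs' : φ c < φ s' := by
      refine lt_of_le_of_ne (hφ c hc s' ⟨hc.1.trans hs'.1.le, hs'.2.le⟩ hs'.1.le).1 fun h => ?_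
      have := hmax (show s' ∈ Icc a b ∩ φ ⁻¹' {φ r} from
        ⟨⟨hc.1.trans hs'.1.le, hs'.2.le⟩, (h.symm.trans hcφ)⟩)
      exact absurd hs'.1 (not_lt.2 this)
    have hφr' : φ r' = φ c := by
      have h1 := (hφ r hr r' ⟨hr.1.trans hr'.1, hr'.2.trans hc.2⟩ hr'.1).1
      have h2 := (hφ r' ⟨hr.1.trans hr'.1, hr'.2.trans hc.2⟩ c hc hr'.2).1
      linarith
    have har' : a ≤ r' := hr.1.trans hr'.1
    exact hr'ne ((hφ.mono har' hs'.2.le).not_null_piece hloc hirr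
      (hγ.mono har' (hr'.2.trans_lt hs'.1) hs'.2.le)
      (fun t ht => (le_total t c).elim (fun h => hr'in t ⟨ht.1, h⟩) fun h => hs'in t ⟨h, ht.2⟩)
      (by rw [hφr']; exact hφs') ⟨le_rfl, hr'.2.trans hs'.1.le⟩ ⟨hr'.2, hs'.1.le⟩ hr'.2 hφr')
  · -- The first time `c` at which the level is attained; the curve is timelike right before it.
    obtain ⟨c, ⟨hc, hcφ⟩, hmin⟩ := hcpt.exists_isMinOn ⟨r, hr, rfl⟩ continuousOn_id
    have hcφ : φ c = φ r := hcφ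
    have hcr : c ≤ r := hmin (show r ∈ Icc a b ∩ φ ⁻¹' {φ r} from ⟨hr, rfl⟩)
    have hca : a < c := lt_of_le_of_ne hc.1 fun h => by rw [h, hcφ] at hcase; exact lt_irrefl _ hcase
    obtain ⟨Ω, hΩo, hΩ, hloc⟩ := hreg (γ c)
    obtain ⟨s', hs', hs'ne, hs'in⟩ := exists_right_of_ne (s := s)
      (hγc.mono (Icc_subset_Icc hc.1 hs.2)) hΩo hΩ (by
        by_cases h : γ s = γ c
        · exact ⟨r, ⟨hcr, hrs⟩, fun h' => hne (h'.trans h.symm)⟩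
        · exact ⟨s, ⟨hcr.trans hrs, le_rfl⟩, h⟩)
    have hnh : ∀ᶠ t in 𝓝[<] c, ∀ v ∈ Icc t c, γ v ∈ Ω := by
      have h1 : ∀ᶠ t in 𝓝[Icc a b] c, γ t ∈ Ω := (hγc c hc).eventually (hΩo.mem_nhds hΩ)
      have h2 : ∀ᶠ t in 𝓝[≤] c, γ t ∈ Ω := by
        rw [← nhdsWithin_Icc_eq_nhdsLE hca]
        exact nhdsWithin_mono _ (Icc_subset_Icc le_rfl hc.2) h1
      obtain ⟨u, hu, hsub⟩ := mem_nhdsLE_iff_exists_Icc_subset.1 h2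
      filter_upwards [Ioo_mem_nhdsLT hu] with t ht v hv
      exact hsub ⟨ht.1.le.trans hv.1, hv.2⟩
    obtain ⟨r', hr'in, hr'⟩ := (hnh.and (Ioo_mem_nhdsLT hca)).exists
    have hφr' : φ r' < φ c := by
      refine lt_of_le_of_ne (hφ r' ⟨hr'.1.le, hr'.2.le.trans hc.2⟩ c hc hr'.2.le).1 fun h => ?_
      have := hmin (show r' ∈ Icc a b ∩ φ ⁻¹' {φ r} from
        ⟨⟨hr'.1.le, hr'.2.le.trans hc.2⟩, (h.trans hcφ)⟩)
      exact absurd hr'.2 (not_lt.2 this)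
    have hφs' : φ c = φ s' := by
      have h1 := (hφ s' ⟨hc.1.trans hs'.1, hs'.2.trans hs.2⟩ s hs hs'.2).1
      have h2 := (hφ c hc s' ⟨hc.1.trans hs'.1, hs'.2.trans hs.2⟩ hs'.1).1
      linarith
    have hs'b : s' ≤ b := hs'.2.trans hs.2
    exact hs'ne ((hφ.mono hr'.1.le hs'b).not_null_piece hloc hirr
      (hγ.mono hr'.1.le (hr'.2.trans_le hs'.1) hs'b)
      (fun t ht => (le_total t c).elim (fun h => hr'in t ⟨ht.1, h⟩) fun h => hs'in t ⟨h, ht.2⟩)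
      (by rw [← hφs']; exact hφr') ⟨hr'.2.le, hs'.1⟩ ⟨hr'.2.le.trans hs'.1, le_rfl⟩ hs'.1
      hφs').symm

/-- The concatenation of two causal curves, with unchanged speeds. -/
lemma IsCausalCurve.concat {α β : ℝ → M} {a b c d : ℝ} (hα : L.IsCausalCurve α a b)
    (hβ : L.IsCausalCurve β c d) (h : α b = β c) :
    L.IsCausalCurve (fun t => if t ≤ b then α t else β (t - b + c)) a (b + (d - c)) := by
  have hab := hα.1
  have hcd := hβ.1
  obtain ⟨K₁, hK₁⟩ := hα.2.1.exists_lipschitzOnWith_of_compact isCompact_Icc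
  obtain ⟨K₂, hK₂⟩ := hβ.2.1.exists_lipschitzOnWith_of_compact isCompact_Icc
  refine ⟨by linarith, ?_, ?_⟩
  · have key : ∀ s ∈ Icc a (b + (d - c)), ∀ t ∈ Icc a (b + (d - c)), s ≤ t →
        dist (if s ≤ b then α s else β (s - b + c)) (if t ≤ b then α t else β (t - b + c)) ≤
          max K₁ K₂ * dist s t := by
      intro s hs t ht hst
      have l1 : (K₁ : ℝ) ≤ max K₁ K₂ := by simp
      have l2 : (K₂ : ℝ) ≤ max K₁ K₂ := by simp
      by_cases htb : t ≤ b
      · rw [if_pos htb, if_pos (hst.trans htb)]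
        exact (hK₁.dist_le_mul _ ⟨hs.1, hst.trans htb⟩ _ ⟨ht.1, htb⟩).trans
          (mul_le_mul_of_nonneg_right l1 dist_nonneg)
      · rw [if_neg htb]
        have htb := not_le.1 htb
        have ht' : t - b + c ∈ Icc c d := ⟨by linarith, by linarith [ht.2]⟩
        by_cases hsb : s ≤ b
        · rw [if_pos hsb]
          have h1 := hK₁.dist_le_mul s ⟨hs.1, hsb⟩ b ⟨hab.le, le_rfl⟩
          have h2 := hK₂.dist_le_mul c ⟨le_rfl, hcd.le⟩ _ ht'
          rw [← h] at h2
          have h3 := dist_triangle (α s) (α b) (β (t - b + c))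
          rw [Real.dist_eq, abs_of_nonpos (by linarith)] at h1 h2 ⊢
          have h4 : (K₁ : ℝ) * -(s - b) ≤ max K₁ K₂ * -(s - b) :=
            mul_le_mul_of_nonneg_right l1 (by linarith)
          have h5 : (K₂ : ℝ) * -(c - (t - b + c)) ≤ max K₁ K₂ * -(c - (t - b + c)) :=
            mul_le_mul_of_nonneg_right l2 (by linarith)
          push_cast at h4 h5 ⊢
          linarith
        · rw [if_neg hsb]
          have hsb := not_le.1 hsb
          have h2 := hK₂.dist_le_mul (s - b + c) ⟨by linarith, by linarith [hs.2]⟩ _ ht'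
          have h3 : dist (s - b + c) (t - b + c) = dist s t := by
            rw [Real.dist_eq, Real.dist_eq]; congr 1; ring
          rw [h3] at h2
          exact h2.trans (mul_le_mul_of_nonneg_right l2 dist_nonneg)
    have hlip : LipschitzOnWith (max K₁ K₂)
        (fun t => if t ≤ b then α t else β (t - b + c)) (Icc a (b + (d - c))) := by
      refine LipschitzOnWith.of_dist_le_mul fun s hs t ht => ?_
      rcases le_total s t with hst | hst
      · exact_mod_cast key s hs t ht hst
      · rw [dist_comm, dist_comm s t]
        exact_mod_cast key t ht s hs hst
    exact fun s _ => ⟨_, _, self_mem_nhdsWithin, hlip⟩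
  · intro s hs t ht hst
    simp only
    by_cases htb : t ≤ b
    · rw [if_pos htb, if_pos (hst.le.trans htb)]
      exact hα.2.2 s ⟨hs.1, hst.le.trans htb⟩ t ⟨ht.1, htb⟩ hst
    · rw [if_neg htb]
      have htb := not_le.1 htb
      have ht' : t - b + c ∈ Icc c d := ⟨by linarith, by linarith [ht.2]⟩
      by_cases hsb : s ≤ b
      · rw [if_pos hsb]
        refine L.le_trans _ (α b) _ (hα.le ⟨hs.1, hsb⟩ ⟨hab.le, le_rfl⟩ hsb) ?_
        rw [h]
        exact hβ.le ⟨le_rfl, hcd.le⟩ ht' ht'.1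
      · rw [if_neg hsb]
        have hsb := not_le.1 hsb
        exact hβ.2.2 _ ⟨by linarith, by linarith [hs.2]⟩ _ ht' (by linarith)

/-- If `x ≤ z ≪ y` and passing through `z` costs nothing although `τ x z` does not contribute, then
`x = z`: otherwise a maximal curve from `x` to `y` through `z` would begin with a null piece. -/
lemma eq_of_τ_eq (hreg : L.IsRegular) (hτ : Continuous fun z : M × M => L.τ z.1 z.2)
    (hgeo : L.IsGeodesicSpace) {x z y : M} (hxz : L.le x z) (hzy : L.ll z y)
    (h : L.τ x y = L.τ z y) : x = z := by
  by_contra hne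
  have hfin := τ_ne_top hreg hgeo
  have hnull : L.τ x z = 0 := by
    have := L.reverse_triangle x z y hxz (L.le_of_ll _ _ hzy)
    rw [h] at this
    by_contra h0
    exact absurd this (not_le.2 (by
      rw [add_comm]; exact ENNReal.lt_add_right (hfin _ _) h0))
  have hzy' : z ≠ y := fun h' => not_ll_self hreg y (by rwa [h'] at hzy)
  obtain ⟨α, a, b, hα, rfl, rfl, -⟩ := hgeo x z hxz hne
  obtain ⟨β, c, d, hβ, hβc, rfl, hlen⟩ := hgeo (α b) y (L.le_of_ll _ _ hzy) hzy'
  have hβadd := hβ.isAdditiveAlong hreg hgeo (by rw [hlen, hβc])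
  rw [hβc] at hβadd
  have hab := hα.1
  have hcd := hβ.1
  set γ : ℝ → M := fun t => if t ≤ b then α t else β (t - b + c) with hγ
  have hγc : L.IsCausalCurve γ a (b + (d - c)) := hα.concat hβ hβc.symm
  -- The primitive of `τ` along the concatenation vanishes on the first curve.
  set φ : ℝ → ℝ := fun t => if t ≤ b then 0 else (L.τ (α b) (β (t - b + c))).toReal with hφ
  have hself : L.τ (α b) (α b) = 0 := τ_self hreg _
  have hadd : L.IsAdditiveAlong γ φ a (b + (d - c)) := by
    intro s hs t ht hst
    by_cases htb : t ≤ b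
    · simp only [hγ, hφ, if_pos htb, if_pos (hst.trans htb)]
      refine ⟨le_rfl, ?_⟩
      have h1 := L.reverse_triangle _ _ _ (hα.le ⟨hs.1, hst.trans htb⟩ ⟨ht.1, htb⟩ hst)
        (hα.le ⟨ht.1, htb⟩ ⟨hab.le, le_rfl⟩ htb)
      have h2 := L.reverse_triangle _ _ _ (hα.le ⟨le_rfl, hab.le⟩ ⟨hs.1, hst.trans htb⟩ hs.1)
        (hα.le ⟨hs.1, hst.trans htb⟩ ⟨hab.le, le_rfl⟩ (hst.trans htb))
      rw [hnull] at h2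
      have h3 : L.τ (α s) (α b) = 0 := le_antisymm (le_add_self.trans h2) zero_le
      rw [h3] at h1
      simpa using le_antisymm (le_self_add.trans h1) zero_le
    · have htb' := not_le.1 htb
      have ht' : t - b + c ∈ Icc c d := ⟨by linarith, by linarith [ht.2]⟩
      by_cases hsb : s ≤ b
      · simp only [hγ, hφ, if_neg htb, if_pos hsb]
        refine ⟨ENNReal.toReal_nonneg, ?_⟩
        rw [sub_zero, ENNReal.ofReal_toReal (hfin _ _)]
        have hsI : s ∈ Icc a b := ⟨hs.1, hsb⟩
        have h1 : L.le (α b) (β (t - b + c)) := by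
          rw [← hβc]; exact hβ.le ⟨le_rfl, hcd.le⟩ ht' ht'.1
        have h2 := hα.le hsI ⟨hab.le, le_rfl⟩ hsb
        refine le_antisymm ?_ (le_add_self.trans (L.reverse_triangle _ _ _ h2 h1))
        -- For the upper bound, continue to `β d` and start from `α a`: this cannot gain anything,
        -- as `τ (α a) (β d) = τ (α b) (β d)`.
        have h3 : L.le (β (t - b + c)) (β d) := hβ.le ht' ⟨hcd.le, le_rfl⟩ ht'.2
        have h4 := L.reverse_triangle (α s) _ _ (L.le_trans _ _ _ h2 h1) h3
        have h5 := L.reverse_triangle (α a) (α s) (β d) (hα.le ⟨le_rfl, hab.le⟩ hsI hs.1)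
          (L.le_trans _ _ _ (L.le_trans _ _ _ h2 h1) h3)
        have h6 : L.τ (α b) (β (t - b + c)) + L.τ (β (t - b + c)) (β d) = L.τ (α b) (β d) := by
          have e1 := (hβadd c ⟨le_rfl, hcd.le⟩ _ ht' ht'.1)
          have e2 := (hβadd _ ht' d ⟨hcd.le, le_rfl⟩ ht'.2)
          have e3 := (hβadd c ⟨le_rfl, hcd.le⟩ d ⟨hcd.le, le_rfl⟩ hcd.le)
          rw [hβc] at e1 e3
          rw [e1.2, e2.2, e3.2, ← ENNReal.ofReal_add (sub_nonneg.2 e1.1) (sub_nonneg.2 e2.1)]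
          congr 1; ring
        have h7 : L.τ (α s) (β (t - b + c)) + L.τ (β (t - b + c)) (β d) ≤
            L.τ (α b) (β (t - b + c)) + L.τ (β (t - b + c)) (β d) := by
          rw [h6, ← h]
          exact h4.trans (le_add_self.trans h5)
        exact (ENNReal.add_le_add_iff_right (hfin _ _)).1 h7
      · have hsb' := not_le.1 hsb
        simp only [hγ, hφ, if_neg htb, if_neg hsb]
        exact hβadd _ ⟨by linarith, by linarith [hs.2]⟩ _ ht' (by linarith)
  have hend : ¬ (b + (d - c) ≤ b) := by linarith
  have := hadd.eq_of_eq hreg hτ hfin hγc (by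
      simp only [hφ, if_pos hab.le, if_neg hend]
      refine ENNReal.toReal_pos ?_ (hfin _ _)
      have e : b + (d - c) - b + c = d := by ring
      rw [e]
      exact ((L.τ_pos_iff _ _).2 hzy).ne') (r := a) (s := b) ⟨le_rfl, hγc.1.le⟩
      ⟨hab.le, by linarith⟩ hab.le (by simp [hφ, hab.le])
  simp only [hγ, if_pos hab.le, if_pos le_rfl] at this
  exact hne this

/-- Chronologically related points are joined by a timelike geodesic: a maximal causal curve,
reparametrized by `τ`. -/
lemma exists_isTGeo (hreg : L.IsRegular) (hτ : Continuous fun z : M × M => L.τ z.1 z.2)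
    (hgeo : L.IsGeodesicSpace) {x y : M} (hxy : L.ll x y) :
    ∃ η : ℝ → M, L.IsTGeo η ∧ η 0 = x ∧ η 1 = y := by
  have hfin := τ_ne_top hreg hgeo
  obtain ⟨γ, a, b, hγ, rfl, rfl, hlen⟩ := hgeo x y (L.le_of_ll _ _ hxy)
    (fun h => not_ll_self hreg y (by rwa [h] at hxy))
  have hadd := hγ.isAdditiveAlong hreg hgeo hlen
  set φ : ℝ → ℝ := fun t => (L.τ (γ a) (γ t)).toReal with hφ
  have hab := hγ.1
  have ha : a ∈ Icc a b := ⟨le_rfl, hab.le⟩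
  have hb : b ∈ Icc a b := ⟨hab.le, le_rfl⟩
  have hφa : φ a = 0 := by simp [hφ, τ_self hreg]
  set ℓ := φ b with hℓ
  have hℓ0 : 0 < ℓ := ENNReal.toReal_pos ((L.τ_pos_iff _ _).2 hxy).ne' (hfin _ _)
  have heq := fun {r s : ℝ} => hadd.eq_of_eq hreg hτ hfin hγ (by rw [hφa]; exact hℓ0) (r := r) (s := s)
  have heq' : ∀ r ∈ Icc a b, ∀ s ∈ Icc a b, φ r = φ s → γ r = γ s := by
    intro r hr s hs h
    rcases le_total r s with hrs | hrs
    · exact heq hr hs hrs h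
    · exact (heq hs hr hrs h.symm).symm
  have hφc : ContinuousOn φ (Icc a b) :=
    (continuous_toReal_τ hτ hfin).comp_continuousOn (continuousOn_const.prodMk hγ.continuousOn)
  have hivt : ∀ u ∈ Icc (0 : ℝ) 1, ∃ t ∈ Icc a b, φ t = u * ℓ := fun u hu =>
    intermediate_value_Icc hab.le hφc
      ⟨by rw [hφa]; exact mul_nonneg hu.1 hℓ0.le, mul_le_of_le_one_left hℓ0.le hu.2⟩
  -- The parameter `ψ u` at which the fraction `u` of the length is reached need not be unique, nor
  -- `ψ` continuous, but `γ (ψ u)` is determined by `u` because null pieces are constant.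
  choose! ψ hψ hψφ using hivt
  have h0 : (0 : ℝ) ∈ Icc (0 : ℝ) 1 := ⟨le_rfl, zero_le_one⟩
  have h1 : (1 : ℝ) ∈ Icc (0 : ℝ) 1 := ⟨zero_le_one, le_rfl⟩
  have e0 : γ (ψ 0) = γ a := heq' _ (hψ 0 h0) _ ha (by rw [hψφ 0 h0, hφa, zero_mul])
  have e1 : γ (ψ 1) = γ b := heq' _ (hψ 1 h1) _ hb (by rw [hψφ 1 h1, one_mul])
  refine ⟨fun u => γ (ψ u), ⟨?_, ?_⟩, e0, e1⟩
  -- The preimage of a closed set under `γ ∘ ψ` is the image of a compact set under `φ / ℓ`.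
  · rw [continuousOn_iff_isClosed]
    intro C hC
    refine ⟨(fun t => φ t / ℓ) '' (Icc a b ∩ γ ⁻¹' C), ?_, ?_⟩
    · refine (IsCompact.image_of_continuousOn ?_ ?_).isClosed
      · exact isCompact_Icc.of_isClosed_subset
          (hγ.continuousOn.preimage_isClosed_of_isClosed isClosed_Icc hC) inter_subset_left
      · exact (hφc.mono inter_subset_left).div_const _
    · ext u
      constructor
      · rintro ⟨hu, huI⟩
        refine ⟨⟨ψ u, ⟨hψ u huI, hu⟩, ?_⟩, huI⟩
        simp only [hψφ u huI]
        field_simp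
      · rintro ⟨⟨t, ⟨ht, htC⟩, rfl⟩, huI⟩
        refine ⟨?_, huI⟩
        have : γ (ψ (φ t / ℓ)) = γ t := heq' _ (hψ _ huI) _ ht (by
          rw [hψφ _ huI]; field_simp)
        show γ (ψ (φ t / ℓ)) ∈ C
        rw [this]; exact htC
  · intro s hs t ht hst
    have hle : ψ s ≤ ψ t := by
      by_contra hlt
      have := (hadd _ (hψ t ht) _ (hψ s hs) (not_le.1 hlt).le).1
      have h2 := hψφ s hs
      have h3 := hψφ t ht
      have h4 : s * ℓ < t * ℓ := mul_lt_mul_of_pos_right hst hℓ0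
      simp only [hφ] at h2 h3 this
      linarith
    have key : L.τ (γ (ψ s)) (γ (ψ t)) = ENNReal.ofReal ((t - s) * ℓ) := by
      rw [(hadd _ (hψ s hs) _ (hψ t ht) hle).2]
      rw [hψφ s hs, hψφ t ht, ← sub_mul]
    simp only [e0, e1]
    refine ⟨?_, ?_⟩
    · rw [key, ENNReal.ofReal_mul (by linarith), hℓ, hφ]
      simp only [ENNReal.ofReal_toReal (hfin _ _)]
    · rw [key]
      exact ENNReal.ofReal_pos.2 (mul_pos (by linarith) hℓ0)

/-- The properties of the causal structure on which the optimal transport part rests. -/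
structure RegularGeometry (L : LorentzianPreLengthSpace M) : Prop where
  continuous_τ : Continuous fun z : M × M => L.τ z.1 z.2
  τ_ne_top : ∀ x y, L.τ x y ≠ ∞
  not_ll_self : ∀ x, ¬ L.ll x x
  isClosed_le : IsClosed {z : M × M | L.le z.1 z.2}
  isCompact_diamond : ∀ K₀ K₁ : Set M, IsCompact K₀ → IsCompact K₁ →
    IsCompact (L.causalDiamond K₀ K₁)
  /-- A null pair `x ≤ z` cannot be put in front of a timelike geodesic from `z` to `y` without
  gaining length. -/
  eq_of_τ_eq : ∀ x z y, L.le x z → L.ll z y → L.τ x y = L.τ z y → x = z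
  exists_isTGeo : ∀ x y, L.ll x y → ∃ η : ℝ → M, L.IsTGeo η ∧ η 0 = x ∧ η 1 = y
  nonbranching : L.TimelikeNonbranching

theorem regularGeometry (hbranch : L.TimelikeNonbranching) (hclosed : L.LocallyCausallyClosed)
    (hhyp : L.KGloballyHyperbolic) (hreg : L.IsRegular) (hgeo : L.IsGeodesicSpace) :
    L.RegularGeometry where
  continuous_τ := L.continuous_τ hclosed hhyp hreg hgeo
  τ_ne_top := L.τ_ne_top hreg hgeo
  not_ll_self := L.not_ll_self hreg
  isClosed_le := L.isClosed_le hclosed hhyp hgeo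
  isCompact_diamond := hhyp.2
  eq_of_τ_eq _ _ _ := L.eq_of_τ_eq hreg (L.continuous_τ hclosed hhyp hreg hgeo) hgeo
  exists_isTGeo _ _ := L.exists_isTGeo hreg (L.continuous_τ hclosed hhyp hreg hgeo) hgeo
  nonbranching := hbranch

lemma RegularGeometry.continuous_toReal {L : LorentzianPreLengthSpace M} (hL : L.RegularGeometry) :
    Continuous fun z : M × M => (L.τ z.1 z.2).toReal :=
  continuous_toReal_τ hL.continuous_τ hL.τ_ne_top

end Geometry

end LorentzianPreLengthSpace

namespace LorentzianPreLengthSpace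

/-! ### Distortion coefficients -/

lemma sinh_sub_sinh_le {x y : ℝ} (hx : 0 ≤ x) (hxy : x ≤ y) :
    Real.sinh y - Real.sinh x ≤ Real.cosh y * (y - x) := by
  rcases hxy.eq_or_lt with rfl | h
  · simp
  obtain ⟨c, hc, he⟩ := exists_deriv_eq_slope Real.sinh h Real.continuous_sinh.continuousOn
    Real.differentiable_sinh.differentiableOn
  rw [Real.deriv_sinh] at he
  have h1 : Real.cosh c ≤ Real.cosh y := by
    rw [Real.cosh_le_cosh, abs_of_nonneg (hx.trans hc.1.le), abs_of_nonneg (hx.trans hxy)]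
    exact hc.2.le
  rw [eq_div_iff (sub_pos.2 h).ne'] at he
  rw [← he]
  exact mul_le_mul_of_nonneg_right h1 (sub_nonneg.2 hxy)

/-- For distances up to `D`, distortion coefficients at `r` are bounded below, linearly near
`r = 0` and with limit `1` at `r = 1`, with a constant depending only on `K`, `N` and `D`. -/
lemma le_distortion {K N D r : ℝ} (hN : 0 < N) (hD : 0 ≤ D) {θ : ℝ≥0∞} (hθ : θ ≤ ENNReal.ofReal D)
    (hr : r ∈ Icc (0 : ℝ) 1) :
    ENNReal.ofReal (1 - (1 - r) * Real.cosh (D * √(-K / N))) ≤ distortion K N r θ ∧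
      ENNReal.ofReal (r / Real.cosh (D * √(-K / N))) ≤ distortion K N r θ := by
  have hH := Real.one_le_cosh (D * √(-K / N))
  set H := Real.cosh (D * √(-K / N)) with hHdef
  have l1 : 1 - (1 - r) * H ≤ r := by nlinarith [hr.2]
  have l2 : r / H ≤ r := div_le_self hr.1 hH
  have hθ' : θ ≠ ∞ := (hθ.trans_lt ENNReal.ofReal_lt_top).ne
  suffices h : ∃ c : ℝ, 1 - (1 - r) * H ≤ c ∧ r / H ≤ c ∧ ENNReal.ofReal c ≤ distortion K N r θ by
    obtain ⟨c, h1, h2, h3⟩ := h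
    exact ⟨(ENNReal.ofReal_le_ofReal h1).trans h3, (ENNReal.ofReal_le_ofReal h2).trans h3⟩
  rw [distortion, if_neg hθ']
  set x := θ.toReal with hx
  have hx0 : 0 ≤ x := ENNReal.toReal_nonneg
  have hxD : x ≤ D := ENNReal.toReal_le_of_le_ofReal hD hθ
  split_ifs with h1 h2 h3
  · exact ⟨r, l1, l2, le_rfl⟩
  -- Negative `K`: bounds for `sinh` by the mean value theorem.
  · have hK : K < 0 := by
      by_contra hK
      exact absurd h2 (not_lt.2 (mul_nonneg (not_lt.1 hK) (sq_nonneg _)))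
    have hx1 : 0 < x := lt_of_le_of_ne hx0 fun h => h1 (by rw [← h]; ring)
    have hs : 0 < √(-K / N) := Real.sqrt_pos.2 (div_pos (by linarith) hN)
    set α := x * √(-K / N) with hα
    have hα0 : 0 < α := mul_pos hx1 hs
    have hαH : Real.cosh α ≤ H := by
      rw [hHdef, Real.cosh_le_cosh, abs_of_pos hα0, abs_of_nonneg (mul_nonneg hD hs.le)]
      exact mul_le_mul_of_nonneg_right hxD hs.le
    have hsinh : 0 < Real.sinh α := Real.sinh_pos_iff.2 hα0
    have hself : α ≤ Real.sinh α := Real.self_le_sinh_iff.2 hα0.le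
    have hrα : r * α ≤ α := mul_le_of_le_one_left hα0.le hr.2
    have hrα0 : 0 ≤ r * α := mul_nonneg hr.1 hα0.le
    have hc := Real.one_le_cosh α
    refine ⟨_, ?_, ?_, ENNReal.ofReal_le_ofReal (le_of_eq (by rw [mul_assoc]))⟩
    · rw [le_div_iff₀ hsinh]
      have := sinh_sub_sinh_le hrα0 hrα
      have h5 : Real.cosh α * (α - r * α) ≤ H * ((1 - r) * Real.sinh α) := by
        have : α - r * α = (1 - r) * α := by ring
        rw [this]
        exact mul_le_mul hαH (mul_le_mul_of_nonneg_left hself (by linarith [hr.2]))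
          (mul_nonneg (by linarith [hr.2]) hα0.le) (by linarith)
      linarith
    · rw [le_div_iff₀ hsinh, div_mul_eq_mul_div, div_le_iff₀ (by linarith)]
      have h5 := sinh_sub_sinh_le le_rfl hα0.le
      simp only [Real.sinh_zero, sub_zero] at h5
      have h6 : r * α ≤ Real.sinh (r * α) := Real.self_le_sinh_iff.2 hrα0
      calc r * Real.sinh α ≤ r * (Real.cosh α * α) := mul_le_mul_of_nonneg_left h5 hr.1
        _ = (r * α) * Real.cosh α := by ring
        _ ≤ Real.sinh (r * α) * H :=
          mul_le_mul h6 hαH (by linarith) (hrα0.trans h6)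
  -- Positive `K`: the coefficient is at least `r`, by concavity of the sine.
  · have hK : 0 < K := by
      by_contra hK
      exact h2 (lt_of_le_of_ne (mul_nonpos_of_nonpos_of_nonneg (not_lt.1 hK) (sq_nonneg _)) h1)
    have hx1 : 0 < x := lt_of_le_of_ne hx0 fun h => h1 (by rw [← h]; ring)
    have hs : 0 < √(K / N) := Real.sqrt_pos.2 (div_pos hK hN)
    set α := x * √(K / N) with hα
    have hα0 : 0 < α := mul_pos hx1 hs
    have hαπ : α < Real.pi := by
      refine lt_of_pow_lt_pow_left₀ 2 Real.pi_pos.le ?_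
      rw [hα, mul_pow, Real.sq_sqrt (div_pos hK hN).le]
      rw [← mul_lt_mul_iff_right₀ hN]
      calc N * (x ^ 2 * (K / N)) = K * x ^ 2 := by field_simp
        _ < _ := h3
    refine ⟨r, l1, l2, ENNReal.ofReal_le_ofReal ?_⟩
    rw [le_div_iff₀ (Real.sin_pos_of_pos_of_lt_pi hα0 hαπ)]
    have := strictConcaveOn_sin_Icc.concaveOn.2 (x := α) ⟨hα0.le, hαπ.le⟩ (y := 0)
      ⟨le_rfl, Real.pi_pos.le⟩ hr.1 (sub_nonneg.2 hr.2) (by ring)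
    simpa [mul_assoc] using this
  · exact ⟨r, l1, l2, le_top⟩

/-! ### Estimates for the entropy -/

/-- The convex function `x log x` lies above its tangent at `k`. -/
lemma le_mul_log {x k : ℝ} (hx : 0 ≤ x) (hk : 0 < k) : x * Real.log k + x - k ≤ x * Real.log x := by
  rcases hx.eq_or_lt with rfl | hx
  · simpa using hk.le
  have h := Real.log_le_sub_one_of_pos (div_pos hk hx)
  rw [Real.log_div hk.ne' hx.ne'] at h
  have h2 := mul_le_mul_of_nonneg_left h hx.le
  have h3 : x * (k / x - 1) = k - x := by field_simp
  rw [h3] at h2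
  linarith

section Entropy

variable {M : Type*} [MetricSpace M] [MeasurableSpace M] {m : Measure M} [SigmaFinite m]
  {μ : ProbabilityMeasure M}

/-- The integrand `ρ log ρ` of the entropy. -/
noncomputable def entropyIntegrand (m : Measure M) (μ : ProbabilityMeasure M) (x : M) : ℝ :=
  ((μ : Measure M).rnDeriv m x).toReal * Real.log ((μ : Measure M).rnDeriv m x).toReal

lemma measurable_entropyIntegrand : Measurable (entropyIntegrand m μ) := by
  unfold entropyIntegrand
  have := ((μ : Measure M).measurable_rnDeriv m).ennreal_toReal
  exact this.mul (Real.measurable_log.comp this)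

lemma entropyIntegrand_eq_zero_ae {S : Set M} (hS : MeasurableSet S)
    (hμS : (μ : Measure M) Sᶜ = 0) : ∀ᵐ x ∂m, x ∉ S → entropyIntegrand m μ x = 0 := by
  have h1 : ∫⁻ x in Sᶜ, (μ : Measure M).rnDeriv m x ∂m = 0 :=
    le_antisymm ((Measure.setLIntegral_rnDeriv_le _).trans hμS.le) zero_le
  have h2 := (setLIntegral_eq_zero_iff hS.compl ((μ : Measure M).measurable_rnDeriv m)).1 h1
  filter_upwards [h2] with x hx hxS
  simp [entropyIntegrand, hx hxS]

lemma lintegral_neg_entropyIntegrand_ne_top {S : Set M} (hS : MeasurableSet S)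
    (hμS : (μ : Measure M) Sᶜ = 0) (hmS : m S ≠ ∞) :
    ∫⁻ x, ENNReal.ofReal (-entropyIntegrand m μ x) ∂m ≠ ∞ := by
  have : ∫⁻ x, ENNReal.ofReal (-entropyIntegrand m μ x) ∂m ≤ ∫⁻ _ in S, 1 ∂m := by
    rw [← lintegral_indicator hS]
    refine lintegral_mono_ae ?_
    filter_upwards [entropyIntegrand_eq_zero_ae hS hμS] with x hx
    by_cases hxS : x ∈ S
    · rw [indicator_of_mem hxS, ← ENNReal.ofReal_one]
      refine ENNReal.ofReal_le_ofReal ?_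
      have := le_mul_log (x := ((μ : Measure M).rnDeriv m x).toReal) ENNReal.toReal_nonneg
        zero_lt_one
      have h0 : 0 ≤ ((μ : Measure M).rnDeriv m x).toReal := ENNReal.toReal_nonneg
      simp only [Real.log_one, mul_zero, zero_add] at this
      unfold entropyIntegrand
      linarith
    · simp [hx hxS]
  refine (this.trans_lt ?_).ne
  simpa using hmS.lt_top

lemma integrable_entropyIntegrand
    (h₁ : ∫⁻ x, ENNReal.ofReal (entropyIntegrand m μ x) ∂m ≠ ∞)
    (h₂ : ∫⁻ x, ENNReal.ofReal (-entropyIntegrand m μ x) ∂m ≠ ∞) :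
    Integrable (entropyIntegrand m μ) m := by
  refine ⟨measurable_entropyIntegrand.aestronglyMeasurable, ?_⟩
  rw [HasFiniteIntegral]
  have : ∀ x, ‖entropyIntegrand m μ x‖ₑ = ENNReal.ofReal (entropyIntegrand m μ x) +
      ENNReal.ofReal (-entropyIntegrand m μ x) := by
    intro x
    rw [Real.enorm_eq_ofReal_abs]
    rcases le_total 0 (entropyIntegrand m μ x) with h | h
    · rw [abs_of_nonneg h, ENNReal.ofReal_of_nonpos (neg_nonpos.2 h), add_zero]
    · rw [abs_of_nonpos h, ENNReal.ofReal_of_nonpos h, zero_add]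
  simp_rw [this]
  rw [lintegral_add_left measurable_entropyIntegrand.ennreal_ofReal]
  exact ENNReal.add_lt_top.2 ⟨h₁.lt_top, h₂.lt_top⟩

lemma entropy_eq_integral (hμ : (μ : Measure M) ≪ m)
    (h₁ : ∫⁻ x, ENNReal.ofReal (entropyIntegrand m μ x) ∂m ≠ ∞)
    (h₂ : ∫⁻ x, ENNReal.ofReal (-entropyIntegrand m μ x) ∂m ≠ ∞) :
    entropy m μ = ((∫ x, entropyIntegrand m μ x ∂m : ℝ) : EReal) := by
  have hi := integrable_entropyIntegrand h₁ h₂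
  rw [integral_eq_lintegral_pos_part_sub_lintegral_neg_part hi]
  rw [EReal.coe_sub, EReal.coe_ennreal_toReal h₁, EReal.coe_ennreal_toReal h₂]
  exact if_pos ⟨hμ, h₁⟩

/-- Where it is not `∞`, the entropy of a measure carried by a set of finite volume is the Bochner
integral of `ρ log ρ`. -/
lemma entropy_eq_of_ne_top {S : Set M} (hS : MeasurableSet S)
    (hμS : (μ : Measure M) Sᶜ = 0) (hmS : m S ≠ ∞) (h : entropy m μ ≠ ⊤) :
    (μ : Measure M) ≪ m ∧ Integrable (entropyIntegrand m μ) m ∧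
      entropy m μ = ((∫ x, entropyIntegrand m μ x ∂m : ℝ) : EReal) := by
  have h₂ := lintegral_neg_entropyIntegrand_ne_top hS hμS hmS
  by_cases hc : (μ : Measure M) ≪ m ∧ ∫⁻ x, ENNReal.ofReal (entropyIntegrand m μ x) ∂m ≠ ∞
  · exact ⟨hc.1, integrable_entropyIntegrand hc.2 h₂, entropy_eq_integral hc.1 hc.2 h₂⟩
  · exfalso
    apply h
    exact if_neg hc

lemma absolutelyContinuous_of_entropy_ne_top (h : entropy m μ ≠ ⊤) : (μ : Measure M) ≪ m := by
  by_contra hc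
  apply h
  exact if_neg fun h => hc h.1

lemma finiteEntropy_of_ne_top {S : Set M} (hS : MeasurableSet S)
    (hμS : (μ : Measure M) Sᶜ = 0) (hmS : m S ≠ ∞) (h : entropy m μ ≠ ⊤) : FiniteEntropy m μ := by
  obtain ⟨-, -, h'⟩ := entropy_eq_of_ne_top hS hμS hmS h
  rw [FiniteEntropy, h']
  exact ⟨EReal.coe_ne_top _, EReal.coe_ne_bot _⟩

/-- Jensen-type lower bound for the entropy of a measure carried by `A ∪ B`, obtained from the
tangents of `x log x` at `k` on `A` and at `l` on `B`. -/
lemma le_entropy {A B : Set M} (hA : MeasurableSet A) (hB : MeasurableSet B) (hAB : Disjoint A B)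
    (hμ : (μ : Measure M) (A ∪ B)ᶜ = 0) (hmA : m A ≠ ∞) (hmB : m B ≠ ∞) {k l : ℝ} (hk : 0 < k)
    (hl : 0 < l) :
    (((μ : Measure M).real A * Real.log k + (μ : Measure M).real B * Real.log l + 1 -
      k * m.real A - l * m.real B : ℝ) : EReal) ≤ entropy m μ := by
  by_cases htop : entropy m μ = ⊤
  · rw [htop]; exact le_top
  obtain ⟨hac, hint, heq⟩ := entropy_eq_of_ne_top (hA.union hB) hμ
    ((measure_union_lt_top hmA.lt_top hmB.lt_top).ne) htop
  rw [heq, EReal.coe_le_coe_iff]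
  have hρ : Integrable (fun x => ((μ : Measure M).rnDeriv m x).toReal) m :=
    Measure.integrable_toReal_rnDeriv
  have piece : ∀ {S : Set M}, MeasurableSet S → m S ≠ ∞ → ∀ {k : ℝ}, 0 < k →
      (μ : Measure M).real S * Real.log k + (μ : Measure M).real S - k * m.real S ≤
        ∫ x in S, entropyIntegrand m μ x ∂m := by
    intro S hS hmS k hk
    have h1 : ∫ x in S, (((μ : Measure M).rnDeriv m x).toReal * Real.log k +
        ((μ : Measure M).rnDeriv m x).toReal - k) ∂m =
        (μ : Measure M).real S * Real.log k + (μ : Measure M).real S - k * m.real S := by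
      have hk' : IntegrableOn (fun _ => k) S m := integrableOn_const hmS
      rw [integral_sub (f := fun x => ((μ : Measure M).rnDeriv m x).toReal * Real.log k +
          ((μ : Measure M).rnDeriv m x).toReal)
          ((hρ.integrableOn.mul_const _).add hρ.integrableOn) hk',
        integral_add (hρ.integrableOn.mul_const _) hρ.integrableOn, integral_mul_const,
        Measure.setIntegral_toReal_rnDeriv hac S, setIntegral_const, smul_eq_mul, mul_comm k]
    rw [← h1]
    refine integral_mono (((hρ.integrableOn.mul_const _).add hρ.integrableOn).sub
      (integrableOn_const hmS)) hint.integrableOn fun x => le_mul_log ENNReal.toReal_nonneg hk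
  have hsplit : ∫ x, entropyIntegrand m μ x ∂m =
      ∫ x in A, entropyIntegrand m μ x ∂m + ∫ x in B, entropyIntegrand m μ x ∂m := by
    rw [← setIntegral_union hAB hB hint.integrableOn hint.integrableOn,
      setIntegral_eq_integral_of_ae_compl_eq_zero]
    exact entropyIntegrand_eq_zero_ae (hA.union hB) hμ
  have hone : (μ : Measure M).real A + (μ : Measure M).real B = 1 := by
    rw [← measureReal_union hAB hB]
    have := (prob_compl_eq_zero_iff (μ := (μ : Measure M)) (hA.union hB)).1 hμ
    simp [Measure.real, this]
  have e1 := piece hA hmA hk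
  have e2 := piece hB hmB hl
  rw [hsplit]
  linarith

lemma rnDeriv_le_of_le_smul {C : ℝ} (hle : (μ : Measure M) ≤ ENNReal.ofReal C • m) :
    (μ : Measure M).rnDeriv m ≤ᵐ[m] fun _ => ENNReal.ofReal C := by
  refine ae_le_of_forall_setLIntegral_le_of_sigmaFinite
    ((μ : Measure M).measurable_rnDeriv m) fun s _ _ => ?_
  refine (Measure.setLIntegral_rnDeriv_le s).trans ((hle s).trans ?_)
  simp

/-- A measure carried by a set of finite volume and with density at most `C` has finite entropy, at
most `log C`. -/
lemma entropy_le_of_le_smul {S : Set M} (hS : MeasurableSet S)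
    (hμS : (μ : Measure M) Sᶜ = 0) (hmS : m S ≠ ∞) {C : ℝ} (hC : 0 < C)
    (hle : (μ : Measure M) ≤ ENNReal.ofReal C • m) :
    FiniteEntropy m μ ∧ entropy m μ ≤ (Real.log C : EReal) := by
  have hac : (μ : Measure M) ≪ m :=
    (Measure.absolutelyContinuous_of_le hle).trans Measure.smul_absolutelyContinuous
  have hρC : ∀ᵐ x ∂m, ((μ : Measure M).rnDeriv m x).toReal ≤ C := by
    filter_upwards [rnDeriv_le_of_le_smul hle] with x hx
    exact ENNReal.toReal_le_of_le_ofReal hC.le hx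
  have hρ : Integrable (fun x => ((μ : Measure M).rnDeriv m x).toReal) m :=
    Measure.integrable_toReal_rnDeriv
  have hub : ∀ᵐ x ∂m, entropyIntegrand m μ x ≤
      ((μ : Measure M).rnDeriv m x).toReal * Real.log C := by
    filter_upwards [hρC] with x hx
    rcases (ENNReal.toReal_nonneg (a := (μ : Measure M).rnDeriv m x)).eq_or_lt with h | h
    · simp [entropyIntegrand, ← h]
    · exact mul_le_mul_of_nonneg_left (Real.log_le_log h hx) h.le
  have h₁ : ∫⁻ x, ENNReal.ofReal (entropyIntegrand m μ x) ∂m ≠ ∞ := by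
    refine ((lintegral_mono_ae (hub.mono fun x hx => ENNReal.ofReal_le_ofReal hx)).trans_lt ?_).ne
    exact (hρ.mul_const _).lintegral_lt_top
  have h₂ := lintegral_neg_entropyIntegrand_ne_top hS hμS hmS
  have heq := entropy_eq_integral hac h₁ h₂
  refine ⟨⟨by rw [heq]; exact EReal.coe_ne_top _, by rw [heq]; exact EReal.coe_ne_bot _⟩, ?_⟩
  rw [heq, EReal.coe_le_coe_iff]
  refine (integral_mono_ae (integrable_entropyIntegrand h₁ h₂) (hρ.mul_const _) hub).trans ?_
  rw [integral_mul_const, Measure.integral_toReal_rnDeriv hac]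
  simp

lemma expEntropy_of_entropy_eq {N e : ℝ} (h : entropy m μ = (e : EReal)) :
    expEntropy m N μ = ENNReal.ofReal (Real.exp (-e / N)) := by
  rw [expEntropy, h, ← EReal.coe_neg, ← EReal.coe_div, EReal.exp_coe]

lemma expEntropy_of_entropy_eq_top {N : ℝ} (hN : 0 < N) (h : entropy m μ = ⊤) :
    expEntropy m N μ = 0 := by
  rw [expEntropy, h, EReal.neg_top, EReal.bot_div_of_pos_ne_top (by exact_mod_cast hN)
    (EReal.coe_ne_top _), EReal.exp_bot]

lemma expEntropy_of_entropy_eq_bot {N : ℝ} (hN : 0 < N) (h : entropy m μ = ⊥) :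
    expEntropy m N μ = ∞ := by
  rw [expEntropy, h, EReal.neg_bot, EReal.top_div_of_pos_ne_top (by exact_mod_cast hN)
    (EReal.coe_ne_top _), EReal.exp_top]

lemma le_expEntropy_of_le {N c : ℝ} (hN : 0 < N) (h : entropy m μ ≤ (c : EReal)) :
    ENNReal.ofReal (Real.exp (-c / N)) ≤ expEntropy m N μ := by
  induction he : entropy m μ with
  | bot => rw [expEntropy_of_entropy_eq_bot hN he]; exact le_top
  | top => rw [he] at h; simp at h
  | coe e =>
    rw [expEntropy_of_entropy_eq he]
    rw [he, EReal.coe_le_coe_iff] at h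
    exact ENNReal.ofReal_le_ofReal (Real.exp_le_exp.2
      (div_le_div_of_nonneg_right (neg_le_neg h) hN.le))

lemma entropy_le_of_le_expEntropy {N u : ℝ} (hN : 0 < N) (hu : 0 < u)
    (h : ENNReal.ofReal u ≤ expEntropy m N μ) : entropy m μ ≤ ((-N * Real.log u : ℝ) : EReal) := by
  induction he : entropy m μ with
  | bot => exact bot_le
  | top =>
    rw [expEntropy_of_entropy_eq_top hN he] at h
    exact absurd h (not_le.2 (ENNReal.ofReal_pos.2 hu))
  | coe e =>
    rw [expEntropy_of_entropy_eq he] at h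
    have h1 := (ENNReal.ofReal_le_ofReal_iff (Real.exp_pos _).le).1 h
    have h2 := Real.log_le_log hu h1
    rw [Real.log_exp, le_div_iff₀ hN] at h2
    rw [EReal.coe_le_coe_iff]
    linarith

end Entropy

end LorentzianPreLengthSpace

/-! ### Gluing and weak limits of measures -/

section MeasureTools

open ProbabilityTheory

/-- Gluing of two measures along a common marginal. -/
lemma exists_gluing {X Y Z : Type*} [MeasurableSpace X] [MeasurableSpace Y] [MeasurableSpace Z]
    [StandardBorelSpace Z] [Nonempty Z] (α : Measure (X × Y)) (β : Measure (Y × Z))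
    [IsFiniteMeasure α] [IsFiniteMeasure β] (h : α.snd = β.fst) :
    ∃ κ : Measure (X × Y × Z), κ.map (fun w => (w.1, w.2.1)) = α ∧ κ.map Prod.snd = β := by
  set k : Kernel (X × Y) Z := β.condKernel.comap Prod.snd measurable_snd with hk
  have hassoc : Measurable fun w : (X × Y) × Z => (w.1.1, w.1.2, w.2) := by fun_prop
  refine ⟨(α ⊗ₘ k).map fun w => (w.1.1, w.1.2, w.2), ?_, ?_⟩
  · rw [Measure.map_map (by fun_prop) hassoc]
    exact Measure.fst_compProd α k
  · rw [Measure.map_map (by fun_prop) hassoc]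
    ext s hs
    rw [Measure.map_apply (by fun_prop) hs]
    change (α ⊗ₘ k) ((fun w : (X × Y) × Z => (w.1.2, w.2)) ⁻¹' s) = β s
    rw [Measure.compProd_apply
      ((by fun_prop : Measurable fun w : (X × Y) × Z => (w.1.2, w.2)) hs)]
    conv_rhs => rw [← β.disintegrate β.condKernel, Measure.compProd_apply hs, ← h, Measure.snd,
      lintegral_map (Kernel.measurable_kernel_prodMk_left hs) measurable_snd]
    rfl

variable {X : Type*} [MetricSpace X] [CompleteSpace X] [SecondCountableTopology X]
  [MeasurableSpace X] [BorelSpace X]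

lemma measure_compl_eq_zero_of_tendsto {P : ProbabilityMeasure X} {Q : ℕ → ProbabilityMeasure X}
    (h : Tendsto Q atTop (𝓝 P)) {F : Set X} (hF : IsClosed F)
    (hQ : ∀ n, (Q n : Measure X) Fᶜ = 0) : (P : Measure X) Fᶜ = 0 := by
  have := ProbabilityMeasure.le_liminf_measure_open_of_tendsto h hF.isOpen_compl
  simp only [hQ] at this
  simpa using this

lemma isCompact_setOf_measure_compl_eq_zero {K : Set X} (hK : IsCompact K) :
    IsCompact {P : ProbabilityMeasure X | (P : Measure X) Kᶜ = 0} := by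
  have hclosed : IsClosed {P : ProbabilityMeasure X | (P : Measure X) Kᶜ = 0} := by
    refine IsSeqClosed.isClosed fun Q P hQ hP => ?_
    exact measure_compl_eq_zero_of_tendsto hP hK.isClosed hQ
  rw [← hclosed.closure_eq]
  refine isCompact_closure_of_isTightMeasureSet ?_
  rw [isTightMeasureSet_iff_exists_isCompact_measure_compl_le]
  intro ε _
  refine ⟨K, hK, ?_⟩
  rintro _ ⟨P, hP, rfl⟩
  rw [show (P : Measure X) Kᶜ = 0 from hP]
  exact zero_le

lemma exists_subseq_tendsto {K : Set X} (hK : IsCompact K) (Q : ℕ → ProbabilityMeasure X)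
    (hQ : ∀ n, (Q n : Measure X) Kᶜ = 0) :
    ∃ P : ProbabilityMeasure X, (P : Measure X) Kᶜ = 0 ∧ ∃ φ : ℕ → ℕ, StrictMono φ ∧
      Tendsto (Q ∘ φ) atTop (𝓝 P) :=
  (isCompact_setOf_measure_compl_eq_zero hK).tendsto_subseq hQ

lemma map_tendsto_unique {Y : Type*} [MetricSpace Y] [CompleteSpace Y] [SecondCountableTopology Y]
    [MeasurableSpace Y] [BorelSpace Y] {P : ProbabilityMeasure X} {Q : ℕ → ProbabilityMeasure X}
    (h : Tendsto Q atTop (𝓝 P)) {f : X → Y} (hf : Continuous f) {ν : ProbabilityMeasure Y}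
    {νn : ℕ → ProbabilityMeasure Y} (hν : Tendsto νn atTop (𝓝 ν))
    (hQ : ∀ n, (Q n : Measure X).map f = νn n) : (P : Measure X).map f = ν := by
  have h1 := ProbabilityMeasure.tendsto_map_of_tendsto_of_continuous Q P h hf
  have h2 : (fun n => (Q n).map hf.aemeasurable) = νn := by
    funext n
    exact Subtype.ext (hQ n)
  rw [h2] at h1
  have := tendsto_nhds_unique h1 hν
  rw [← this]
  rfl

end MeasureTools

namespace LorentzianPreLengthSpace

section Transport

variable {M : Type*} [MetricSpace M] [ProperSpace M] [MeasurableSpace M] [BorelSpace M]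
  {L : LorentzianPreLengthSpace M} {p : ℝ}

/-! ### Maximal couplings -/

/-- The total cost `∫ τ^p dπ` of a measure on pairs. -/
noncomputable def totalCost (L : LorentzianPreLengthSpace M) (p : ℝ) (π : Measure (M × M)) : ℝ≥0∞ :=
  ∫⁻ z, L.τ z.1 z.2 ^ p ∂π

/-- A measure on causally related pairs which maximizes the total cost among all such measures with
the same marginals. No normalization is required, so that the notion passes to restrictions. -/
def IsMaximal (L : LorentzianPreLengthSpace M) (p : ℝ) (π : Measure (M × M)) : Prop :=
  (∀ᵐ z ∂π, L.le z.1 z.2) ∧ ∀ σ : Measure (M × M), σ.fst = π.fst → σ.snd = π.snd →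
    (∀ᵐ z ∂σ, L.le z.1 z.2) → L.totalCost p σ ≤ L.totalCost p π

/-- The real-valued cost `τ^p`. -/
noncomputable def realCost (L : LorentzianPreLengthSpace M) (p : ℝ) (x y : M) : ℝ :=
  (L.τ x y).toReal ^ p

lemma realCost_nonneg (x y : M) : 0 ≤ L.realCost p x y :=
  Real.rpow_nonneg ENNReal.toReal_nonneg _

namespace RegularGeometry

lemma continuous_realCost (hL : L.RegularGeometry) (hp : 0 < p) :
    Continuous fun z : M × M => L.realCost p z.1 z.2 :=
  hL.continuous_toReal.rpow_const fun _ => Or.inr hp.le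

lemma measurable_τ (hL : L.RegularGeometry) : Measurable fun z : M × M => L.τ z.1 z.2 :=
  hL.continuous_τ.measurable

lemma ofReal_realCost (hL : L.RegularGeometry) (hp : 0 < p) (x y : M) :
    ENNReal.ofReal (L.realCost p x y) = L.τ x y ^ p := by
  rw [realCost, ← ENNReal.ofReal_rpow_of_nonneg ENNReal.toReal_nonneg hp.le,
    ENNReal.ofReal_toReal (hL.τ_ne_top x y)]

lemma realCost_eq_zero (hp : 0 < p) {x y : M} (h : ¬ L.ll x y) : L.realCost p x y = 0 := by
  rw [realCost, τ_eq_zero_of_not_ll h, ENNReal.toReal_zero, Real.zero_rpow hp.ne']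

lemma exists_τ_bound (hL : L.RegularGeometry) {A B : Set M} (hA : IsCompact A) (hB : IsCompact B) :
    ∃ D : ℝ, 0 < D ∧ ∀ x ∈ A, ∀ y ∈ B, (L.τ x y).toReal ≤ D := by
  obtain ⟨D, hD⟩ := (hA.prod hB).bddAbove_image hL.continuous_toReal.continuousOn
  exact ⟨max D 1, by positivity, fun x hx y hy =>
    (hD ⟨(x, y), ⟨hx, hy⟩, rfl⟩).trans (le_max_left _ _)⟩

lemma exists_cost_bound (hL : L.RegularGeometry) (hp : 0 < p) {A B : Set M} (hA : IsCompact A)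
    (hB : IsCompact B) : ∃ D : ℝ, 0 < D ∧ ∀ x ∈ A, ∀ y ∈ B, L.realCost p x y ≤ D := by
  obtain ⟨D, hD0, hD⟩ := hL.exists_τ_bound hA hB
  exact ⟨D ^ p, Real.rpow_pos_of_pos hD0 _, fun x hx y hy =>
    Real.rpow_le_rpow ENNReal.toReal_nonneg (hD x hx y hy) hp.le⟩

end RegularGeometry

lemma ae_fst_mem_iff {X Y : Type*} [MeasurableSpace X] [MeasurableSpace Y] {π : Measure (X × Y)}
    {S : Set X} (hS : MeasurableSet S) : (∀ᵐ x ∂π.fst, x ∈ S) ↔ ∀ᵐ z ∂π, z.1 ∈ S :=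
  ae_map_iff (p := fun x => x ∈ S) measurable_fst.aemeasurable hS

lemma ae_snd_mem_iff {X Y : Type*} [MeasurableSpace X] [MeasurableSpace Y] {π : Measure (X × Y)}
    {S : Set Y} (hS : MeasurableSet S) : (∀ᵐ x ∂π.snd, x ∈ S) ↔ ∀ᵐ z ∂π, z.2 ∈ S :=
  ae_map_iff (p := fun x => x ∈ S) measurable_snd.aemeasurable hS

lemma ae_mem_prod_of_marginals {π : Measure (M × M)} {A B : Set M} (hA : MeasurableSet A)
    (hB : MeasurableSet B) (h1 : π.fst Aᶜ = 0) (h2 : π.snd Bᶜ = 0) : ∀ᵐ z ∂π, z.1 ∈ A ∧ z.2 ∈ B := by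
  exact ((ae_fst_mem_iff hA).1 (mem_ae_iff.2 h1)).and ((ae_snd_mem_iff hB).1 (mem_ae_iff.2 h2))

lemma RegularGeometry.totalCost_ne_top (hL : L.RegularGeometry) (hp : 0 < p)
    {π : Measure (M × M)} [IsFiniteMeasure π] {A B : Set M} (hA : IsCompact A) (hB : IsCompact B)
    (h : ∀ᵐ z ∂π, z.1 ∈ A ∧ z.2 ∈ B) : L.totalCost p π ≠ ∞ := by
  obtain ⟨D, -, hD⟩ := hL.exists_cost_bound hp hA hB
  have : L.totalCost p π ≤ ∫⁻ _, ENNReal.ofReal D ∂π := by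
    refine lintegral_mono_ae ?_
    filter_upwards [h] with z hz
    rw [← hL.ofReal_realCost hp]
    exact ENNReal.ofReal_le_ofReal (hD _ hz.1 _ hz.2)
  refine (this.trans_lt ?_).ne
  rw [lintegral_const]
  exact ENNReal.mul_lt_top ENNReal.ofReal_lt_top (measure_lt_top _ _)

lemma totalCost_add (π σ : Measure (M × M)) :
    L.totalCost p (π + σ) = L.totalCost p π + L.totalCost p σ := lintegral_add_measure _ _ _

lemma totalCost_smul (c : ℝ≥0∞) (π : Measure (M × M)) :
    L.totalCost p (c • π) = c * L.totalCost p π := lintegral_smul_measure _ _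

lemma fst_add' (π σ : Measure (M × M)) : (π + σ).fst = π.fst + σ.fst :=
  Measure.map_add _ _ measurable_fst

lemma snd_add' (π σ : Measure (M × M)) : (π + σ).snd = π.snd + σ.snd :=
  Measure.map_add _ _ measurable_snd

lemma fst_smul' (c : ℝ≥0∞) (π : Measure (M × M)) : (c • π).fst = c • π.fst :=
  Measure.map_smul _ _ _

lemma snd_smul' (c : ℝ≥0∞) (π : Measure (M × M)) : (c • π).snd = c • π.snd :=
  Measure.map_smul _ _ _

lemma fst_finsetSum {ι : Type*} (s : Finset ι) (π : ι → Measure (M × M)) :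
    (∑ i ∈ s, π i).fst = ∑ i ∈ s, (π i).fst := by
  classical
  induction s using Finset.induction_on with
  | empty => simp
  | insert a s ha ih => rw [Finset.sum_insert ha, Finset.sum_insert ha, fst_add', ih]

lemma snd_finsetSum {ι : Type*} (s : Finset ι) (π : ι → Measure (M × M)) :
    (∑ i ∈ s, π i).snd = ∑ i ∈ s, (π i).snd := by
  classical
  induction s using Finset.induction_on with
  | empty => simp
  | insert a s ha ih => rw [Finset.sum_insert ha, Finset.sum_insert ha, snd_add', ih]

lemma totalCost_finsetSum {ι : Type*} (s : Finset ι) (π : ι → Measure (M × M)) :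
    L.totalCost p (∑ i ∈ s, π i) = ∑ i ∈ s, L.totalCost p (π i) := by
  classical
  induction s using Finset.induction_on with
  | empty => simp [totalCost]
  | insert a s ha ih => rw [Finset.sum_insert ha, Finset.sum_insert ha, totalCost_add, ih]

/-- A summand of a maximal measure is maximal, as an improvement of the part would improve the
whole. -/
lemma IsMaximal.of_add {π σ : Measure (M × M)} (h : L.IsMaximal p (π + σ))
    (hfin : L.totalCost p σ ≠ ∞) : L.IsMaximal p π := by
  have hle := ae_add_measure_iff.1 h.1
  refine ⟨hle.1, fun π' h1 h2 h3 => ?_⟩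
  have := h.2 (π' + σ) (by rw [fst_add', fst_add', h1]) (by rw [snd_add', snd_add', h2])
    (ae_add_measure_iff.2 ⟨h3, hle.2⟩)
  rw [totalCost_add, totalCost_add] at this
  exact (ENNReal.add_le_add_iff_right hfin).1 this

lemma IsMaximal.smul {π : Measure (M × M)} (h : L.IsMaximal p π) {c : ℝ≥0∞} (hc : c ≠ 0)
    (hc' : c ≠ ∞) : L.IsMaximal p (c • π) := by
  have key : ∀ σ : Measure (M × M), c • (c⁻¹ • σ) = σ := fun σ => by
    rw [smul_smul, ENNReal.mul_inv_cancel hc hc', one_smul]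
  refine ⟨Measure.ae_smul_measure h.1 c, fun σ h1 h2 h3 => ?_⟩
  have := h.2 (c⁻¹ • σ) (by rw [fst_smul', h1, fst_smul', smul_smul,
    ENNReal.inv_mul_cancel hc hc', one_smul]) (by rw [snd_smul', h2, snd_smul', smul_smul,
    ENNReal.inv_mul_cancel hc hc', one_smul]) (Measure.ae_smul_measure h3 _)
  conv_lhs => rw [← key σ]
  rw [totalCost_smul, totalCost_smul c π]
  exact mul_le_mul_right this _

lemma IsMaximal.of_le {π σ : Measure (M × M)} [IsFiniteMeasure π] (h : L.IsMaximal p π)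
    (hfin : L.totalCost p π ≠ ∞) (hσ : σ ≤ π) : L.IsMaximal p σ := by
  have : IsFiniteMeasure σ := isFiniteMeasure_of_le π hσ
  have he : σ + (π - σ) = π := by rw [add_comm]; exact Measure.sub_add_cancel_of_le hσ
  refine IsMaximal.of_add (σ := π - σ) (by rwa [he]) ?_
  rw [← he, totalCost_add] at hfin
  exact (ENNReal.add_ne_top.1 hfin).2

/-- The optimal couplings are the maximal measures with the given marginals. -/
lemma isOptimalCoupling_iff (hp : 0 < p) {μ ν : ProbabilityMeasure M} {π : Measure (M × M)} :
    L.IsOptimalCoupling p μ ν π ↔ IsCoupling μ ν π ∧ L.IsMaximal p π := by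
  have hp' : 0 < 1 / p := by positivity
  constructor
  · rintro ⟨⟨hc, hle⟩, hW⟩
    refine ⟨hc, hle, fun σ h1 h2 h3 => ?_⟩
    have h4 : (L.τNorm p σ : EReal) ≤ L.τNorm p π := by
      rw [← hW]
      exact le_iSup₂_of_le (f := fun (π : Measure (M × M)) (_ : L.IsCausalCoupling μ ν π) =>
        (L.τNorm p π : EReal)) σ ⟨⟨h1.trans hc.1, h2.trans hc.2⟩, h3⟩ le_rfl
    exact (ENNReal.rpow_le_rpow_iff hp').1 (EReal.coe_ennreal_le_coe_ennreal_iff.1 h4)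
  · rintro ⟨hc, hle, hmax⟩
    refine ⟨⟨hc, hle⟩, le_antisymm (iSup₂_le fun σ hσ => ?_) ?_⟩
    · rw [EReal.coe_ennreal_le_coe_ennreal_iff]
      exact (ENNReal.rpow_le_rpow_iff hp').2
        (hmax σ (hσ.1.1.trans hc.1.symm) (hσ.1.2.trans hc.2.symm) hσ.2)
    · exact le_iSup₂_of_le (f := fun (π : Measure (M × M)) (_ : L.IsCausalCoupling μ ν π) =>
        (L.τNorm p π : EReal)) π ⟨hc, hle⟩ le_rfl

lemma isProbabilityMeasure_of_fst {X Y : Type*} [MeasurableSpace X] [MeasurableSpace Y]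
    {π : Measure (X × Y)} {μ : Measure X}
    [IsProbabilityMeasure μ] (h : π.fst = μ) : IsProbabilityMeasure π :=
  ⟨by rw [← Measure.fst_univ, h]; exact measure_univ⟩

/-- Existence of maximal couplings between compactly supported measures, by Prokhorov's theorem. -/
lemma RegularGeometry.exists_isMaximal (hL : L.RegularGeometry) (hp : 0 < p) {μ ν : Measure M}
    [IsProbabilityMeasure μ] [IsProbabilityMeasure ν] {A B : Set M} (hA : IsCompact A)
    (hB : IsCompact B) (hμ : μ Aᶜ = 0) (hν : ν Bᶜ = 0) {σ : Measure (M × M)} (h1 : σ.fst = μ)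
    (h2 : σ.snd = ν) (h3 : ∀ᵐ z ∂σ, L.le z.1 z.2) :
    ∃ π : Measure (M × M), π.fst = μ ∧ π.snd = ν ∧ L.IsMaximal p π := by
  obtain ⟨D, hD0, hD⟩ := hL.exists_cost_bound hp hA hB
  have hae : ∀ π : Measure (M × M), π.fst = μ → π.snd = ν → ∀ᵐ z ∂π, z.1 ∈ A ∧ z.2 ∈ B :=
    fun π e1 e2 => ae_mem_prod_of_marginals hA.measurableSet hB.measurableSet (e1 ▸ hμ) (e2 ▸ hν)
  set S : Set (ProbabilityMeasure (M × M)) := {P | (P : Measure (M × M)).fst = μ ∧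
    (P : Measure (M × M)).snd = ν ∧ (P : Measure (M × M)) {z | L.le z.1 z.2}ᶜ = 0} with hS
  have hScl : IsClosed S := by
    refine IsSeqClosed.isClosed fun Q P hQ hP => ⟨?_, ?_, ?_⟩
    · exact map_tendsto_unique hP continuous_fst (ν := ⟨μ, inferInstance⟩)
        (νn := fun _ => ⟨μ, inferInstance⟩) tendsto_const_nhds fun n => (hQ n).1
    · exact map_tendsto_unique hP continuous_snd (ν := ⟨ν, inferInstance⟩)
        (νn := fun _ => ⟨ν, inferInstance⟩) tendsto_const_nhds fun n => (hQ n).2.1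
    · exact measure_compl_eq_zero_of_tendsto hP hL.isClosed_le fun n => (hQ n).2.2
  have hSc : IsCompact S := by
    refine (isCompact_setOf_measure_compl_eq_zero (hA.prod hB)).of_isClosed_subset hScl ?_
    exact fun P hP => hae P hP.1 hP.2.1
  have hσ : IsProbabilityMeasure σ := isProbabilityMeasure_of_fst h1
  -- Truncation makes the cost a bounded continuous function without changing it on `A × B`.
  set c : BoundedContinuousFunction (M × M) ℝ :=
    BoundedContinuousFunction.ofNormedAddCommGroup (fun z => min (L.realCost p z.1 z.2) D)
      ((hL.continuous_realCost hp).min continuous_const) D (fun z => by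
        rw [Real.norm_eq_abs, abs_of_nonneg (le_min (realCost_nonneg _ _) hD0.le)]
        exact min_le_right _ _) with hc
  have hcost : ∀ π : Measure (M × M), IsProbabilityMeasure π → π.fst = μ → π.snd = ν →
      L.totalCost p π = ENNReal.ofReal (∫ z, c z ∂π) := by
    intro π _ e1 e2
    rw [ofReal_integral_eq_lintegral_ofReal (c.integrable _)
      (.of_forall fun z => le_min (realCost_nonneg _ _) hD0.le)]
    refine lintegral_congr_ae ?_
    filter_upwards [hae π e1 e2] with z hz
    rw [← hL.ofReal_realCost hp]
    congr 1
    exact (min_eq_left (hD _ hz.1 _ hz.2)).symm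
  obtain ⟨P, hP, hmax⟩ := hSc.exists_isMaxOn ⟨⟨σ, hσ⟩, h1, h2, h3⟩
    (ProbabilityMeasure.continuous_integral_boundedContinuousFunction c).continuousOn
  refine ⟨P, hP.1, hP.2.1, hP.2.2, fun π e1 e2 e3 => ?_⟩
  have hπ : IsProbabilityMeasure π := isProbabilityMeasure_of_fst (e1.trans hP.1)
  rw [hcost π hπ (e1.trans hP.1) (e2.trans hP.2.1), hcost P inferInstance hP.1 hP.2.1]
  exact ENNReal.ofReal_le_ofReal
    (hmax (show (⟨π, hπ⟩ : ProbabilityMeasure (M × M)) ∈ S from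
      ⟨e1.trans hP.1, e2.trans hP.2.1, e3⟩))

/-! ### Cyclical monotonicity -/

/-- Cyclical monotonicity, required only for rearrangements all of whose new pairs are
chronologically related. These rearrangements survive small perturbations of the points, which is
why the support of every maximal coupling has this property. -/
def TimelikeMonotone (L : LorentzianPreLengthSpace M) (p : ℝ) (S : Set (M × M)) : Prop :=
  ∀ (ι : Type) [Fintype ι] (z : ι → M × M) (σ : Equiv.Perm ι), (∀ i, z i ∈ S) →
    (∀ i, L.ll (z (σ i)).1 (z i).2) →
      ∑ i, L.realCost p (z (σ i)).1 (z i).2 ≤ ∑ i, L.realCost p (z i).1 (z i).2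

lemma TimelikeMonotone.mono {S T : Set (M × M)} (h : L.TimelikeMonotone p S) (hT : T ⊆ S) :
    L.TimelikeMonotone p T := fun ι _ z σ hz hσ => h ι z σ (fun i => hT (hz i)) hσ

/-- The support of a maximal measure is monotone: a rearrangement of points `z i` of the support
which increases the cost would lead to a better measure, by exchanging small masses of equal size
near these points. -/
lemma IsMaximal.timelikeMonotone_support (hL : L.RegularGeometry) (hp : 0 < p)
    {π : Measure (M × M)} [IsFiniteMeasure π] (hπ : L.IsMaximal p π)
    (hfin : L.totalCost p π ≠ ∞) : L.TimelikeMonotone p π.support := by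
  intro ι _ z σ hz hσ
  by_contra hcon
  have hcon := not_le.1 hcon
  have hne : Nonempty ι := by
    by_contra h
    rw [not_nonempty_iff] at h
    simp at hcon
  set gap := ∑ i, L.realCost p (z (σ i)).1 (z i).2 - ∑ i, L.realCost p (z i).1 (z i).2 with hgap
  have hgap0 : 0 < gap := sub_pos.2 hcon
  set n : ℝ := ((Fintype.card ι : ℕ) : ℝ) with hn
  have hn0 : 0 < n := by rw [hn]; exact_mod_cast Fintype.card_pos
  set η := gap / (4 * n) with hη
  have hη0 : 0 < η := by positivity
  have hcc := hL.continuous_realCost hp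
  -- A common radius for which all rearranged pairs stay timelike and costs vary by at most `η`.
  have hr : ∀ i, ∀ᶠ r in 𝓝[>] (0 : ℝ),
      (∀ u ∈ Metric.ball (z (σ i)).1 r, ∀ v ∈ Metric.ball (z i).2 r, L.ll u v ∧
        L.realCost p (z (σ i)).1 (z i).2 - η < L.realCost p u v) ∧
      ∀ u ∈ Metric.ball (z i).1 r, ∀ v ∈ Metric.ball (z i).2 r,
        L.realCost p u v < L.realCost p (z i).1 (z i).2 + η := by
    intro i
    have small : ∀ {w : M × M} {T : Set (M × M)}, T ∈ 𝓝 w → ∀ᶠ r in 𝓝[>] (0 : ℝ),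
        ∀ u ∈ Metric.ball w.1 r, ∀ v ∈ Metric.ball w.2 r, (u, v) ∈ T := by
      intro w T hT
      obtain ⟨ε, hε, hsub⟩ := Metric.mem_nhds_iff.1 hT
      filter_upwards [Ioo_mem_nhdsGT hε] with r hr u hu v hv
      refine hsub ?_
      rw [Metric.mem_ball, Prod.dist_eq]
      exact max_lt ((Metric.mem_ball.1 hu).trans hr.2) ((Metric.mem_ball.1 hv).trans hr.2)
    have h1 := small (w := ((z (σ i)).1, (z i).2)) ((isOpen_ll L).mem_nhds (hσ i))
    have h2 := small (w := ((z (σ i)).1, (z i).2)) ((isOpen_lt continuous_const hcc).mem_nhds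
      (show L.realCost p (z (σ i)).1 (z i).2 - η < L.realCost p (z (σ i)).1 (z i).2 by linarith))
    have h3 := small (w := z i) ((isOpen_lt hcc continuous_const).mem_nhds
      (show L.realCost p (z i).1 (z i).2 < L.realCost p (z i).1 (z i).2 + η by linarith))
    filter_upwards [h1, h2, h3] with r a1 a2 a3
    exact ⟨fun u hu v hv => ⟨a1 u hu v hv, a2 u hu v hv⟩, a3⟩
  obtain ⟨r, hr, hr0⟩ := ((eventually_all.2 hr).and self_mem_nhdsWithin).exists
  have hr0 : 0 < r := hr0
  set W : ι → Set (M × M) := fun i => Metric.ball (z i).1 r ×ˢ Metric.ball (z i).2 r with hW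
  have hWm : ∀ i, MeasurableSet (W i) := fun i => measurableSet_ball.prod measurableSet_ball
  set a : ι → ℝ≥0∞ := fun i => π (W i) with ha
  have ha0 : ∀ i, a i ≠ 0 := by
    intro i
    refine (Measure.mem_support_iff_forall (z i) |>.1 (hz i) (W i) ?_).ne'
    exact (Metric.isOpen_ball.prod Metric.isOpen_ball).mem_nhds
      ⟨Metric.mem_ball_self hr0, Metric.mem_ball_self hr0⟩
  have hat : ∀ i, a i ≠ ∞ := fun i => measure_ne_top _ _
  -- Unit masses near the points `z i`, and a rearrangement with the same marginals.
  set ρ : Measure (M × M) := ∑ i, (a i)⁻¹ • π.restrict (W i) with hρ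
  set ρ' : Measure (M × M) :=
    ∑ i, ((a (σ i))⁻¹ * (a i)⁻¹) • ((π.restrict (W (σ i))).fst.prod (π.restrict (W i)).snd) with hρ'
  -- A small multiple of `ρ` is part of `π`, so `ρ` is maximal as well.
  have hρmax : L.IsMaximal p ρ := by
    set k := ∑ i, (a i)⁻¹ with hk
    have hk0 : k ≠ 0 := by
      intro h
      have := Finset.sum_eq_zero_iff.1 h hne.some (Finset.mem_univ _)
      exact hat _ (ENNReal.inv_eq_zero.1 this)
    have hkt : k ≠ ∞ := ENNReal.sum_ne_top.2 fun i _ => ENNReal.inv_ne_top.2 (ha0 i)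
    have hle : ρ ≤ k • π := by
      rw [hρ, hk, Finset.sum_smul]
      refine Finset.sum_le_sum fun i _ => ?_
      refine Measure.le_iff.2 fun s _ => ?_
      rw [Measure.smul_apply, Measure.smul_apply, smul_eq_mul, smul_eq_mul]
      exact mul_le_mul_right (Measure.restrict_le_self s) _
    have : IsFiniteMeasure (k • π) := Measure.smul_finite π hkt
    exact (hπ.smul hk0 hkt).of_le (by rw [totalCost_smul]; exact ENNReal.mul_ne_top hkt hfin) hle
  have hmass1 : ∀ i, (π.restrict (W i)).fst univ = a i := fun i => by
    rw [Measure.fst_univ, Measure.restrict_apply_univ]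
  have hmass2 : ∀ i, (π.restrict (W i)).snd univ = a i := fun i => by
    rw [Measure.snd_univ, Measure.restrict_apply_univ]
  have hfst : ρ'.fst = ρ.fst := by
    rw [hρ, hρ', fst_finsetSum, fst_finsetSum, ← Equiv.sum_comp σ (fun i =>
      ((a i)⁻¹ • π.restrict (W i)).fst)]
    refine Finset.sum_congr rfl fun i _ => ?_
    rw [fst_smul', fst_smul', Measure.fst, Measure.map_fst_prod, hmass2, smul_smul, mul_assoc,
      ENNReal.inv_mul_cancel (ha0 i) (hat i), mul_one]
  have hsnd : ρ'.snd = ρ.snd := by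
    rw [hρ, hρ', snd_finsetSum, snd_finsetSum]
    refine Finset.sum_congr rfl fun i _ => ?_
    rw [snd_smul', snd_smul', Measure.snd, Measure.map_snd_prod, hmass1, smul_smul, mul_right_comm,
      ENNReal.inv_mul_cancel (ha0 _) (hat _), one_mul]
  have haeball : ∀ i, (∀ᵐ x ∂(π.restrict (W i)).fst, x ∈ Metric.ball (z i).1 r) ∧
      ∀ᵐ x ∂(π.restrict (W i)).snd, x ∈ Metric.ball (z i).2 r := by
    intro i
    have := ae_restrict_mem (μ := π) (hWm i)
    constructor
    · exact (ae_fst_mem_iff measurableSet_ball).2 (this.mono fun w hw => hw.1)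
    · exact (ae_snd_mem_iff measurableSet_ball).2 (this.mono fun w hw => hw.2)
  have haeprod : ∀ i, ∀ᵐ w ∂((π.restrict (W (σ i))).fst.prod (π.restrict (W i)).snd),
      w.1 ∈ Metric.ball (z (σ i)).1 r ∧ w.2 ∈ Metric.ball (z i).2 r := by
    intro i
    exact (Measure.quasiMeasurePreserving_fst.ae (haeball (σ i)).1).and
      (Measure.quasiMeasurePreserving_snd.ae (haeball i).2)
  have hle := hρmax.2 ρ' hfst hsnd (by
    rw [hρ', ← Measure.sum_fintype, Measure.ae_sum_iff]
    intro i
    refine Measure.ae_smul_measure ?_ _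
    filter_upwards [haeprod i] with w hw
    exact L.le_of_ll _ _ ((hr i).1 _ hw.1 _ hw.2).1)
  rw [hρ, hρ', totalCost_finsetSum, totalCost_finsetSum] at hle
  have hub : ∑ i, L.totalCost p ((a i)⁻¹ • π.restrict (W i)) ≤
      ENNReal.ofReal (∑ i, (L.realCost p (z i).1 (z i).2 + η)) := by
    rw [ENNReal.ofReal_sum_of_nonneg fun i _ => add_nonneg (realCost_nonneg _ _) hη0.le]
    refine Finset.sum_le_sum fun i _ => ?_
    rw [totalCost_smul]
    have : L.totalCost p (π.restrict (W i)) ≤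
        ∫⁻ _, ENNReal.ofReal (L.realCost p (z i).1 (z i).2 + η) ∂(π.restrict (W i)) := by
      refine lintegral_mono_ae ?_
      filter_upwards [ae_restrict_mem (hWm i)] with w hw
      rw [← hL.ofReal_realCost hp]
      exact ENNReal.ofReal_le_ofReal ((hr i).2 _ hw.1 _ hw.2).le
    rw [lintegral_const, Measure.restrict_apply_univ] at this
    refine (mul_le_mul_right this _).trans (le_of_eq ?_)
    rw [mul_comm, mul_assoc]
    show _ * (a i * (a i)⁻¹) = _
    rw [ENNReal.mul_inv_cancel (ha0 i) (hat i), mul_one]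
  have hlb : ENNReal.ofReal (∑ i, (L.realCost p (z (σ i)).1 (z i).2 - η)) ≤
      ∑ i, L.totalCost p (((a (σ i))⁻¹ * (a i)⁻¹) •
        ((π.restrict (W (σ i))).fst.prod (π.restrict (W i)).snd)) := by
    have hsub : ENNReal.ofReal (∑ i, (L.realCost p (z (σ i)).1 (z i).2 - η)) ≤
        ∑ i, ENNReal.ofReal (L.realCost p (z (σ i)).1 (z i).2 - η) :=
      Finset.le_sum_of_subadditive _ ENNReal.ofReal_zero.le (fun _ _ => ENNReal.ofReal_add_le) _ _
    refine hsub.trans (Finset.sum_le_sum fun i _ => ?_)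
    rw [totalCost_smul]
    have : ∫⁻ _, ENNReal.ofReal (L.realCost p (z (σ i)).1 (z i).2 - η)
        ∂((π.restrict (W (σ i))).fst.prod (π.restrict (W i)).snd) ≤
        L.totalCost p ((π.restrict (W (σ i))).fst.prod (π.restrict (W i)).snd) := by
      refine lintegral_mono_ae ?_
      filter_upwards [haeprod i] with w hw
      rw [← hL.ofReal_realCost hp]
      exact ENNReal.ofReal_le_ofReal ((hr i).1 _ hw.1 _ hw.2).2.le
    rw [lintegral_const, ← univ_prod_univ, Measure.prod_prod, hmass1, hmass2] at this
    refine _root_.le_trans (le_of_eq ?_) (mul_le_mul_right this _)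
    rw [mul_comm, mul_assoc]
    have e : a (σ i) * a i * ((a (σ i))⁻¹ * (a i)⁻¹) = 1 := by
      rw [mul_mul_mul_comm, ENNReal.mul_inv_cancel (ha0 _) (hat _),
        ENNReal.mul_inv_cancel (ha0 _) (hat _), one_mul]
    rw [e, mul_one]
  have hfinal := (ENNReal.ofReal_le_ofReal_iff (Finset.sum_nonneg fun i _ =>
    add_nonneg (realCost_nonneg _ _) hη0.le)).1 (hlb.trans (hle.trans hub))
  rw [Finset.sum_sub_distrib, Finset.sum_add_distrib] at hfinal
  simp only [Finset.sum_const, Finset.card_univ, nsmul_eq_mul] at hfinal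
  have : n * η = gap / 4 := by rw [hη]; field_simp
  rw [← hn, this] at hfinal
  linarith

end Transport

end LorentzianPreLengthSpace

namespace LorentzianPreLengthSpace

section Transport

variable {M : Type*} [MetricSpace M] [ProperSpace M] [MeasurableSpace M] [BorelSpace M]
  {L : LorentzianPreLengthSpace M} {p : ℝ}

/-- Monotonicity for a cyclic shift, with the closing pair of the cycle split off. -/
lemma TimelikeMonotone.chain {S : Set (M × M)} (h : L.TimelikeMonotone p S) (n : ℕ)
    (w : ℕ → M × M) (hw : ∀ i ≤ n, w i ∈ S) (hll : ∀ i < n, L.ll (w (i + 1)).1 (w i).2)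
    (hlast : L.ll (w 0).1 (w n).2) :
    ∑ i ∈ Finset.range n, L.realCost p (w (i + 1)).1 (w i).2 + L.realCost p (w 0).1 (w n).2 ≤
      ∑ i ∈ Finset.range n, L.realCost p (w i).1 (w i).2 + L.realCost p (w n).1 (w n).2 := by
  have hrot : ∀ i : Fin n, finRotate (n + 1) i.castSucc = i.succ := fun i => by
    rw [finRotate_apply]; simp
  have := h (Fin (n + 1)) (fun i => w i) (finRotate (n + 1)) (fun i => hw i (by omega)) (by
    intro i
    refine Fin.lastCases ?_ (fun i => ?_) i
    · rw [finRotate_last]; simpa using hlast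
    · rw [hrot]; simpa using hll i i.2)
  rw [Fin.sum_univ_castSucc, Fin.sum_univ_castSucc, finRotate_last] at this
  simp only [hrot, Fin.val_succ, Fin.val_castSucc, Fin.val_last, Fin.val_zero] at this
  rw [Fin.sum_univ_eq_sum_range (fun i => L.realCost p (w (i + 1)).1 (w i).2),
    Fin.sum_univ_eq_sum_range (fun i => L.realCost p (w i).1 (w i).2)] at this
  exact this

/-! ### Kantorovich potentials on chronologically related compact sets -/

/-- Kantorovich potentials for a monotone set contained in a compact product `A × C` of
chronologically related points, by Rüschendorf's construction. -/
lemma TimelikeMonotone.exists_potentials (hL : L.RegularGeometry) (hp : 0 < p) {A C : Set M}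
    (hA : IsCompact A) (hC : IsCompact C) (hAC : ∀ x ∈ A, ∀ y ∈ C, L.ll x y) {Γ : Set (M × M)}
    (hΓ : Γ ⊆ A ×ˢ C) (hmono : L.TimelikeMonotone p Γ) (hne : Γ.Nonempty) :
    ∃ f g : M → ℝ, Measurable f ∧ Measurable g ∧ (∃ B, ∀ x, |f x| ≤ B) ∧ (∃ B, ∀ y, |g y| ≤ B) ∧
      (∀ x ∈ A, ∀ y ∈ C, L.realCost p x y ≤ f x + g y) ∧
      ∀ z ∈ Γ, f z.1 + g z.2 = L.realCost p z.1 z.2 := by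
  obtain ⟨D, hD0, hD⟩ := hL.exists_cost_bound hp hA hC
  obtain ⟨z₀, hz₀⟩ := hne
  -- The cost, truncated so that it is bounded everywhere, and unchanged on `A × C`.
  set c : M → M → ℝ := fun x y => min (L.realCost p x y) D with hc
  have hc0 : ∀ x y, 0 ≤ c x y := fun x y => le_min (realCost_nonneg _ _) hD0.le
  have hcD : ∀ x y, c x y ≤ D := fun x y => min_le_right _ _
  have hceq : ∀ x ∈ A, ∀ y ∈ C, c x y = L.realCost p x y := fun x hx y hy => min_eq_left (hD x hx y hy)
  have hcc : Continuous fun z : M × M => c z.1 z.2 :=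
    (hL.continuous_realCost hp).min continuous_const
  -- Chains in `Γ` starting from `z₀`, with the gain `V` of a chain which is continued to `x`.
  set I := {nw : ℕ × (ℕ → M × M) // (∀ i, nw.2 i ∈ Γ) ∧ nw.2 0 = z₀} with hI
  set S : I → ℝ := fun k => ∑ i ∈ Finset.range k.1.1,
    (L.realCost p (k.1.2 (i + 1)).1 (k.1.2 i).2 - L.realCost p (k.1.2 i).1 (k.1.2 i).2) with hS
  set V : I → M → ℝ := fun k x => c x (k.1.2 k.1.1).2 -
    L.realCost p (k.1.2 k.1.1).1 (k.1.2 k.1.1).2 + S k with hV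
  have hIΓ : ∀ (k : I) i, (k.1.2 i).1 ∈ A ∧ (k.1.2 i).2 ∈ C := fun k i => hΓ (k.2.1 i)
  have hz₀' := hΓ hz₀
  have hVz₀ : ∀ k, V k z₀.1 ≤ 0 := by
    intro k
    have := hmono.chain k.1.1 k.1.2 (fun i _ => k.2.1 i)
      (fun i _ => hAC _ (hIΓ k _).1 _ (hIΓ k _).2) (hAC _ (hIΓ k _).1 _ (hIΓ k _).2)
    simp only [hV, hS]
    rw [Finset.sum_sub_distrib, hceq _ hz₀'.1 _ (hIΓ k _).2]
    rw [k.2.2] at this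
    linarith
  have hVle : ∀ k x, V k x ≤ D := by
    intro k x
    have h1 := hVz₀ k
    simp only [hV] at h1 ⊢
    linarith [hcD x (k.1.2 k.1.1).2, hc0 z₀.1 (k.1.2 k.1.1).2]
  have hbdd : ∀ x, BddAbove (range fun k => V k x) := fun x => ⟨D, by rintro _ ⟨k, rfl⟩; exact hVle k x⟩
  set k₀ : I := ⟨(0, fun _ => z₀), fun _ => hz₀, rfl⟩ with hk₀
  have : Nonempty I := ⟨k₀⟩
  set f : M → ℝ := fun x => ⨆ k, V k x with hf
  have hfle : ∀ x, f x ≤ D := fun x => ciSup_le fun k => hVle k x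
  have hfge : ∀ x, -D ≤ f x := by
    intro x
    refine (?_ : -D ≤ V k₀ x).trans (le_ciSup (hbdd x) k₀)
    have : S k₀ = 0 := by simp [hS, hk₀]
    simp only [hV, hk₀]
    linarith [hc0 x z₀.2, hD z₀.1 hz₀'.1 z₀.2 hz₀'.2]
  -- Appending a point `w` of `Γ` to a chain.
  have hext : ∀ w ∈ Γ, ∀ x, f w.1 - L.realCost p w.1 w.2 + c x w.2 ≤ f x := by
    intro w hw x
    have hw' := hΓ hw
    suffices h : ∀ k, V k w.1 ≤ f x + L.realCost p w.1 w.2 - c x w.2 by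
      have := ciSup_le h
      simp only [hf] at this ⊢
      linarith
    intro k
    set k' : I := ⟨(k.1.1 + 1, fun i => if i ≤ k.1.1 then k.1.2 i else w), fun i => by
      by_cases h : i ≤ k.1.1 <;> simp [h, hw, k.2.1 i], by simp [k.2.2]⟩ with hk'
    have hSk : S k' = S k + (L.realCost p w.1 (k.1.2 k.1.1).2 -
        L.realCost p (k.1.2 k.1.1).1 (k.1.2 k.1.1).2) := by
      simp only [hS, hk']
      rw [Finset.sum_range_succ]
      congr 1
      · refine Finset.sum_congr rfl fun i hi => ?_
        have := Finset.mem_range.1 hi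
        rw [if_pos (by omega), if_pos (by omega)]
      · simp
    have h1 : V k' x = c x w.2 - L.realCost p w.1 w.2 + S k' := by
      simp [hV, hk']
    have h2 : V k w.1 = L.realCost p w.1 (k.1.2 k.1.1).2 -
        L.realCost p (k.1.2 k.1.1).1 (k.1.2 k.1.1).2 + S k := by
      simp only [hV]; rw [hceq _ hw'.1 _ (hIΓ k _).2]
    have h3 : V k' x ≤ f x := le_ciSup (hbdd x) k'
    linarith
  -- The second potential is the conjugate of the first one, with respect to the cost on `A`.
  have hflsc : LowerSemicontinuous f := by
    refine lowerSemicontinuous_ciSup hbdd fun k => Continuous.lowerSemicontinuous ?_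
    exact ((hcc.comp (continuous_id.prodMk continuous_const)).sub continuous_const).add
      continuous_const
  have : Nonempty A := ⟨⟨z₀.1, hz₀'.1⟩⟩
  have hbdd' : ∀ y, BddAbove (range fun x : A => c x y - f x) := fun y =>
    ⟨D + D, by rintro _ ⟨x, rfl⟩; simp only; linarith [hcD x y, hfge x]⟩
  set g : M → ℝ := fun y => ⨆ x : A, (c x y - f x) with hg
  have hglsc : LowerSemicontinuous g := by
    refine lowerSemicontinuous_ciSup hbdd' fun x => Continuous.lowerSemicontinuous ?_
    exact (hcc.comp (continuous_const.prodMk continuous_id)).sub continuous_const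
  refine ⟨f, g, hflsc.measurable, hglsc.measurable, ⟨D, fun x => abs_le.2 ⟨hfge x, hfle x⟩⟩,
    ⟨D + D, fun y => abs_le.2 ⟨?_, ?_⟩⟩, ?_, ?_⟩
  · refine (?_ : -(D + D) ≤ c z₀.1 y - f z₀.1).trans (le_ciSup (hbdd' y) ⟨z₀.1, hz₀'.1⟩)
    linarith [hc0 z₀.1 y, hfle z₀.1]
  · exact ciSup_le fun x => by linarith [hcD x y, hfge x]
  · intro x hx y hy
    have : c x y - f x ≤ g y := le_ciSup (hbdd' y) ⟨x, hx⟩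
    rw [hceq x hx y hy] at this
    linarith
  · intro z hz
    have hz' := hΓ hz
    refine le_antisymm ?_ ?_
    · have : g z.2 ≤ L.realCost p z.1 z.2 - f z.1 := ciSup_le fun x => by linarith [hext z hz x]
      linarith
    · have : c z.1 z.2 - f z.1 ≤ g z.2 := le_ciSup (hbdd' z.2) ⟨z.1, hz'.1⟩
      rw [hceq _ hz'.1 _ hz'.2] at this
      linarith

lemma RegularGeometry.integrable_realCost (hL : L.RegularGeometry) (hp : 0 < p)
    {π : Measure (M × M)} [IsFiniteMeasure π] {A C : Set M} (hA : IsCompact A) (hC : IsCompact C)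
    (h : ∀ᵐ z ∂π, z.1 ∈ A ∧ z.2 ∈ C) : Integrable (fun z => L.realCost p z.1 z.2) π := by
  obtain ⟨D, -, hD⟩ := hL.exists_cost_bound hp hA hC
  refine Integrable.of_bound (hL.continuous_realCost hp).aestronglyMeasurable D ?_
  filter_upwards [h] with z hz
  rw [Real.norm_eq_abs, abs_of_nonneg (realCost_nonneg _ _)]
  exact hD _ hz.1 _ hz.2

lemma RegularGeometry.totalCost_eq (hL : L.RegularGeometry) (hp : 0 < p)
    {π : Measure (M × M)} [IsFiniteMeasure π] {A C : Set M} (hA : IsCompact A) (hC : IsCompact C)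
    (h : ∀ᵐ z ∂π, z.1 ∈ A ∧ z.2 ∈ C) :
    L.totalCost p π = ENNReal.ofReal (∫ z, L.realCost p z.1 z.2 ∂π) := by
  rw [ofReal_integral_eq_lintegral_ofReal (hL.integrable_realCost hp hA hC h)
    (.of_forall fun z => realCost_nonneg _ _)]
  exact lintegral_congr fun z => (hL.ofReal_realCost hp _ _).symm

lemma integrable_of_abs_le {X : Type*} [MeasurableSpace X] {μ : Measure X} [IsFiniteMeasure μ]
    {f : X → ℝ} (hf : Measurable f) (hB : ∃ B, ∀ x, |f x| ≤ B) : Integrable f μ := by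
  obtain ⟨B, hB⟩ := hB
  exact Integrable.of_bound hf.aestronglyMeasurable B (.of_forall hB)

lemma integral_add_marginals {π : Measure (M × M)} [IsFiniteMeasure π] {f g : M → ℝ}
    (hf : Measurable f) (hg : Measurable g) (hfB : ∃ B, ∀ x, |f x| ≤ B)
    (hgB : ∃ B, ∀ x, |g x| ≤ B) :
    Integrable (fun z : M × M => f z.1 + g z.2) π ∧
      ∫ z, (f z.1 + g z.2) ∂π = ∫ x, f x ∂π.fst + ∫ y, g y ∂π.snd := by
  have h1 : Integrable (fun z : M × M => f z.1) π :=
    integrable_of_abs_le (hf.comp measurable_fst) (hfB.imp fun B hB z => hB z.1)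
  have h2 : Integrable (fun z : M × M => g z.2) π :=
    integrable_of_abs_le (hg.comp measurable_snd) (hgB.imp fun B hB z => hB z.2)
  refine ⟨h1.add h2, ?_⟩
  rw [integral_add h1 h2, Measure.fst, Measure.snd,
    integral_map measurable_fst.aemeasurable hf.aestronglyMeasurable,
    integral_map measurable_snd.aemeasurable hg.aestronglyMeasurable]

/-- A measure carried by a monotone subset of a compact product of chronologically related points
is maximal. -/
lemma TimelikeMonotone.isMaximal (hL : L.RegularGeometry) (hp : 0 < p) {A C : Set M}
    (hA : IsCompact A) (hC : IsCompact C) (hAC : ∀ x ∈ A, ∀ y ∈ C, L.ll x y) {Γ : Set (M × M)}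
    (hΓ : Γ ⊆ A ×ˢ C) (hmono : L.TimelikeMonotone p Γ) {π : Measure (M × M)} [IsFiniteMeasure π]
    (hπ : ∀ᵐ z ∂π, z ∈ Γ) : L.IsMaximal p π := by
  have hπAC : ∀ᵐ z ∂π, z.1 ∈ A ∧ z.2 ∈ C := hπ.mono fun z hz => hΓ hz
  refine ⟨hπAC.mono fun z hz => L.le_of_ll _ _ (hAC _ hz.1 _ hz.2), fun σ h1 h2 _ => ?_⟩
  have hσf : IsFiniteMeasure σ := ⟨by
    rw [← Measure.fst_univ, h1, Measure.fst_univ]; exact measure_lt_top _ _⟩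
  have hσAC : ∀ᵐ z ∂σ, z.1 ∈ A ∧ z.2 ∈ C := by
    have e1 : ∀ᵐ z ∂σ, z.1 ∈ A := (ae_fst_mem_iff hA.measurableSet).1 (by
      rw [h1]; exact (ae_fst_mem_iff hA.measurableSet).2 (hπAC.mono fun z hz => hz.1))
    have e2 : ∀ᵐ z ∂σ, z.2 ∈ C := (ae_snd_mem_iff hC.measurableSet).1 (by
      rw [h2]; exact (ae_snd_mem_iff hC.measurableSet).2 (hπAC.mono fun z hz => hz.2))
    exact e1.and e2
  by_cases hne : Γ.Nonempty
  · obtain ⟨f, g, hf, hg, hfB, hgB, hge, heq⟩ := hmono.exists_potentials hL hp hA hC hAC hΓ hne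
    rw [hL.totalCost_eq hp hA hC hσAC, hL.totalCost_eq hp hA hC hπAC]
    refine ENNReal.ofReal_le_ofReal ?_
    have i1 := integral_add_marginals (π := σ) hf hg hfB hgB
    have i2 := integral_add_marginals (π := π) hf hg hfB hgB
    calc ∫ z, L.realCost p z.1 z.2 ∂σ ≤ ∫ z, (f z.1 + g z.2) ∂σ := by
          refine integral_mono_ae (hL.integrable_realCost hp hA hC hσAC) i1.1 ?_
          filter_upwards [hσAC] with z hz using hge _ hz.1 _ hz.2
      _ = ∫ z, (f z.1 + g z.2) ∂π := by rw [i1.2, i2.2, h1, h2]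
      _ = ∫ z, L.realCost p z.1 z.2 ∂π := by
          refine integral_congr_ae ?_
          filter_upwards [hπ] with z hz using heq z hz
  · have hσ0 : σ = 0 := by
      rw [← Measure.measure_univ_eq_zero, ← Measure.fst_univ, h1, Measure.fst_univ]
      rw [not_nonempty_iff_eq_empty.1 hne] at hπ
      simpa [ae_iff] using hπ
    rw [hσ0]
    simp [totalCost]

lemma ae_mem_support {X : Type*} [MetricSpace X] [SecondCountableTopology X] [MeasurableSpace X]
    (π : Measure X) : ∀ᵐ z ∂π, z ∈ π.support := Measure.support_mem_ae

lemma support_subset_of_ae {X : Type*} [MetricSpace X] [MeasurableSpace X] {π : Measure X}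
    {F : Set X} (hF : IsClosed F) (h : ∀ᵐ z ∂π, z ∈ F) : π.support ⊆ F :=
  Measure.support_subset_of_isClosed hF h

lemma support_subset_prod {π : Measure (M × M)} {A C : Set M} (hA : IsClosed A) (hC : IsClosed C)
    (h : ∀ᵐ z ∂π, z.1 ∈ A ∧ z.2 ∈ C) : π.support ⊆ A ×ˢ C :=
  support_subset_of_ae (hA.prod hC) h

/-- Chronological maximal couplings of compactly supported measures satisfy the dualizability
condition, with constant potentials, because the cost is bounded on the supports. -/
lemma isTimelikeDualizable_bounded (hL : L.RegularGeometry) (hp : 0 < p)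
    {μ ν : ProbabilityMeasure M} (hμ : IsCompact (μ : Measure M).support)
    (hν : IsCompact (ν : Measure M).support) {π : Measure (M × M)}
    (hc : L.IsChronologicalCoupling μ ν π) (hmax : L.IsMaximal p π) :
    L.IsTimelikeDualizableBy p μ ν π := by
  obtain ⟨D, -, hD⟩ := hL.exists_cost_bound hp hμ hν
  refine ⟨hc, (isOptimalCoupling_iff hp).2 ⟨hc.1, hmax⟩, fun _ => D, fun _ => 0, measurable_const,
    measurable_const, integrable_const _, fun x hx y hy => ?_⟩
  rw [cost]
  split_ifs with h
  · rw [← hL.ofReal_realCost hp, EReal.coe_ennreal_ofReal,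
      max_eq_left (realCost_nonneg _ _), EReal.coe_le_coe_iff, add_zero]
    exact hD x hx y hy
  · exact bot_le

lemma cost_eq_realCost (hL : L.RegularGeometry) (hp : 0 < p) {x y : M} (h : L.le x y) :
    L.cost p x y = (L.realCost p x y : EReal) := by
  rw [cost, if_pos h, ← hL.ofReal_realCost hp, EReal.coe_ennreal_ofReal,
    max_eq_left (realCost_nonneg _ _)]

lemma ereal_coe_sum {ι : Type*} (s : Finset ι) (f : ι → ℝ) :
    ((∑ i ∈ s, f i : ℝ) : EReal) = ∑ i ∈ s, (f i : EReal) := by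
  classical
  induction s using Finset.induction_on with
  | empty => simp
  | insert a s ha ih => rw [Finset.sum_insert ha, Finset.sum_insert ha, EReal.coe_add, ih]

lemma ereal_sum_eq_bot {ι : Type*} (s : Finset ι) (f : ι → EReal) {i : ι} (hi : i ∈ s)
    (h : f i = ⊥) : ∑ i ∈ s, f i = ⊥ := by
  classical
  rw [← Finset.add_sum_erase s f hi, h, EReal.bot_add]

lemma prob_eq_one_iff_ae {X : Type*} [MeasurableSpace X] {π : Measure X} [IsProbabilityMeasure π]
    {S : Set X} (hS : MeasurableSet S) : π S = 1 ↔ ∀ᵐ z ∂π, z ∈ S :=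
  (prob_compl_eq_zero_iff hS).symm

/-- Compactly supported measures whose supports are chronologically related are strongly timelike
dualizable: the set `Γ` is the contact set of a pair of Kantorovich potentials. -/
lemma isStronglyTimelikeDualizable_of_prod (hL : L.RegularGeometry) (hp : 0 < p)
    {μ ν : ProbabilityMeasure M} (hμ : IsCompact (μ : Measure M).support)
    (hν : IsCompact (ν : Measure M).support)
    (hll : ∀ x ∈ (μ : Measure M).support, ∀ y ∈ (ν : Measure M).support, L.ll x y) :
    L.IsStronglyTimelikeDualizable p μ ν := by
  set A := (μ : Measure M).support with hA
  set C := (ν : Measure M).support with hC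
  have hμA : (μ : Measure M) Aᶜ = 0 := Measure.measure_compl_support
  have hνC : (ν : Measure M) Cᶜ = 0 := Measure.measure_compl_support
  have haeAC : ∀ σ : Measure (M × M), IsCoupling μ ν σ → ∀ᵐ z ∂σ, z.1 ∈ A ∧ z.2 ∈ C :=
    fun σ h => ae_mem_prod_of_marginals hμ.measurableSet hν.measurableSet (h.1 ▸ hμA) (h.2 ▸ hνC)
  obtain ⟨π, h1, h2, hmax⟩ := hL.exists_isMaximal (p := p) hp hμ hν hμA hνC
    (σ := (μ : Measure M).prod ν) Measure.fst_prod Measure.snd_prod (by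
      filter_upwards [haeAC ((μ : Measure M).prod ν) ⟨Measure.fst_prod, Measure.snd_prod⟩] with z hz
      exact L.le_of_ll _ _ (hll _ hz.1 _ hz.2))
  have hπp : IsProbabilityMeasure π := isProbabilityMeasure_of_fst h1
  have hπAC := haeAC π ⟨h1, h2⟩
  have hmono := hmax.timelikeMonotone_support hL hp (hL.totalCost_ne_top hp hμ hν hπAC)
  have hsub : π.support ⊆ A ×ˢ C := support_subset_prod hμ.isClosed hν.isClosed hπAC
  have hne : π.support.Nonempty := Measure.nonempty_support (IsProbabilityMeasure.ne_zero π)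
  obtain ⟨f, g, hf, hg, hfB, hgB, hge, heq⟩ :=
    hmono.exists_potentials hL hp hμ hν hll hsub hne
  have hπeq : ∫ z, L.realCost p z.1 z.2 ∂π = ∫ x, f x ∂(μ : Measure M) + ∫ y, g y ∂(ν : Measure M) := by
    rw [← h1, ← h2, ← (integral_add_marginals hf hg hfB hgB).2]
    refine integral_congr_ae ?_
    filter_upwards [ae_mem_support π] with z hz using (heq z hz).symm
  set Γ : Set (M × M) := {z | z.1 ∈ A ∧ z.2 ∈ C ∧ f z.1 + g z.2 = L.realCost p z.1 z.2} with hΓ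
  have hΓm : MeasurableSet Γ := by
    refine (measurable_fst hμ.measurableSet).inter ((measurable_snd hν.measurableSet).inter ?_)
    exact measurableSet_eq_fun ((hf.comp measurable_fst).add (hg.comp measurable_snd))
      (hL.continuous_realCost hp).measurable
  refine ⟨⟨π, isTimelikeDualizable_bounded hL hp hμ hν ⟨⟨h1, h2⟩, ?_⟩ hmax⟩, Γ, hΓm, ?_, ?_, ?_⟩
  · filter_upwards [hπAC] with z hz using hll _ hz.1 _ hz.2
  · intro n z hz
    have e1 : ∀ i, L.cost p (z (i + 1)).1 (z i).2 = (L.realCost p (z (i + 1)).1 (z i).2 : EReal) :=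
      fun i => cost_eq_realCost hL hp (L.le_of_ll _ _ (hll _ (hz (i + 1)).1 _ (hz i).2.1))
    have e2 : ∀ i, L.cost p (z i).1 (z i).2 = (L.realCost p (z i).1 (z i).2 : EReal) :=
      fun i => cost_eq_realCost hL hp (L.le_of_ll _ _ (hll _ (hz i).1 _ (hz i).2.1))
    simp only [e1, e2]
    rw [← ereal_coe_sum, ← ereal_coe_sum, EReal.coe_le_coe_iff]
    calc ∑ i, L.realCost p (z (i + 1)).1 (z i).2 ≤ ∑ i, (f (z (i + 1)).1 + g (z i).2) :=
          Finset.sum_le_sum fun i _ => hge _ (hz (i + 1)).1 _ (hz i).2.1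
      _ = ∑ i, (f (z i).1 + g (z i).2) := by
          have := Equiv.sum_comp (Equiv.addRight (1 : Fin (n + 1))) (fun i => f (z i).1)
          simp only [Equiv.coe_addRight] at this
          rw [Finset.sum_add_distrib, Finset.sum_add_distrib, this]
      _ = ∑ i, L.realCost p (z i).1 (z i).2 := Finset.sum_congr rfl fun i _ => (hz i).2.2
  · exact fun z hz => ⟨hll _ hz.1 _ hz.2.1, hz.1, hz.2.1⟩
  · intro σ hσ
    have hσp : IsProbabilityMeasure σ := isProbabilityMeasure_of_fst hσ.1.1
    have hσAC := haeAC σ hσ.1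
    have hσi := hL.integrable_realCost hp hμ hν hσAC
    obtain ⟨i1, i2⟩ := integral_add_marginals (π := σ) hf hg hfB hgB
    rw [hσ.1.1, hσ.1.2, ← hπeq] at i2
    rw [isOptimalCoupling_iff hp, prob_eq_one_iff_ae hΓm]
    have hnn : ∀ᵐ z ∂σ, 0 ≤ f z.1 + g z.2 - L.realCost p z.1 z.2 := by
      filter_upwards [hσAC] with z hz using sub_nonneg.2 (hge _ hz.1 _ hz.2)
    have hint0 : ∫ z, (f z.1 + g z.2 - L.realCost p z.1 z.2) ∂σ =
        ∫ z, L.realCost p z.1 z.2 ∂π - ∫ z, L.realCost p z.1 z.2 ∂σ := by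
      rw [integral_sub i1 hσi, i2]
    have hnnπ : 0 ≤ ∫ z, L.realCost p z.1 z.2 ∂σ := integral_nonneg fun z => realCost_nonneg _ _
    constructor
    · rintro ⟨-, hσmax⟩
      have hle := hσmax.2 π (h1.trans hσ.1.1.symm) (h2.trans hσ.1.2.symm) hmax.1
      rw [hL.totalCost_eq hp hμ hν hσAC, hL.totalCost_eq hp hμ hν hπAC] at hle
      have hle' := (ENNReal.ofReal_le_ofReal_iff hnnπ).1 hle
      have h0 : ∫ z, (f z.1 + g z.2 - L.realCost p z.1 z.2) ∂σ = 0 :=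
        le_antisymm (by linarith) (integral_nonneg_of_ae hnn)
      have := (integral_eq_zero_iff_of_nonneg_ae hnn (i1.sub hσi)).1 h0
      filter_upwards [this, hσAC] with z hz hz'
      exact ⟨hz'.1, hz'.2, sub_eq_zero.1 hz⟩
    · intro hσΓ
      refine ⟨hσ.1, hσ.2, fun σ' e1 e2 e3 => (hmax.2 σ' (e1.trans (hσ.1.1.trans h1.symm))
        (e2.trans (hσ.1.2.trans h2.symm)) e3).trans ?_⟩
      rw [hL.totalCost_eq hp hμ hν hσAC, hL.totalCost_eq hp hμ hν hπAC]
      refine ENNReal.ofReal_le_ofReal ?_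
      have h0 : ∫ z, (f z.1 + g z.2 - L.realCost p z.1 z.2) ∂σ = 0 := by
        rw [integral_eq_zero_iff_of_nonneg_ae hnn (i1.sub hσi)]
        filter_upwards [hσΓ] with z hz using sub_eq_zero.2 hz.2.2
      linarith

end Transport

end LorentzianPreLengthSpace

namespace LorentzianPreLengthSpace

section Geometry

variable {M : Type*} [MetricSpace M] [ProperSpace M] {L : LorentzianPreLengthSpace M}

/-! ### Intermediate points -/

/-- `z` lies between `x` and `y`, and divides the time separation in the ratio `s : 1 - s`. -/
def IsIntermediate (L : LorentzianPreLengthSpace M) (s : ℝ) (x z y : M) : Prop :=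
  L.le x z ∧ L.le z y ∧ (L.τ x z).toReal = s * (L.τ x y).toReal ∧
    (L.τ z y).toReal = (1 - s) * (L.τ x y).toReal

lemma IsIntermediate.ll_left (hL : L.RegularGeometry) {s : ℝ} (hs : 0 < s) {x z y : M}
    (h : L.IsIntermediate s x z y) (hxy : L.ll x y) : L.ll x z := by
  rw [← L.τ_pos_iff] at hxy ⊢
  have := ENNReal.toReal_pos hxy.ne' (hL.τ_ne_top _ _)
  exact (ENNReal.toReal_pos_iff.1 (by rw [h.2.2.1]; positivity)).1

lemma IsIntermediate.ll_right (hL : L.RegularGeometry) {s : ℝ} (hs : s < 1) {x z y : M}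
    (h : L.IsIntermediate s x z y) (hxy : L.ll x y) : L.ll z y := by
  rw [← L.τ_pos_iff] at hxy ⊢
  have := ENNReal.toReal_pos hxy.ne' (hL.τ_ne_top _ _)
  exact (ENNReal.toReal_pos_iff.1 (by rw [h.2.2.2]; exact mul_pos (sub_pos.2 hs) this)).1

lemma RegularGeometry.isClosed_isIntermediate (hL : L.RegularGeometry) :
    IsClosed {w : ℝ × M × M × M | L.IsIntermediate w.1 w.2.1 w.2.2.1 w.2.2.2} := by
  have hτ : ∀ {f g : ℝ × M × M × M → M}, Continuous f → Continuous g →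
      Continuous fun w => (L.τ (f w) (g w)).toReal := fun hf hg =>
    hL.continuous_toReal.comp (hf.prodMk hg)
  have hle : ∀ {f g : ℝ × M × M × M → M}, Continuous f → Continuous g →
      IsClosed {w | L.le (f w) (g w)} := fun hf hg => hL.isClosed_le.preimage (hf.prodMk hg)
  exact (hle (by fun_prop) (by fun_prop)).inter ((hle (by fun_prop) (by fun_prop)).inter
    ((isClosed_eq (hτ (by fun_prop) (by fun_prop))
      (continuous_fst.mul (hτ (by fun_prop) (by fun_prop)))).inter
    (isClosed_eq (hτ (by fun_prop) (by fun_prop))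
      ((continuous_const.sub continuous_fst).mul (hτ (by fun_prop) (by fun_prop))))))

lemma RegularGeometry.isClosed_isIntermediate_right (hL : L.RegularGeometry) (s : ℝ) :
    IsClosed {w : M × M × M | L.IsIntermediate s w.1 w.2.1 w.2.2} :=
  hL.isClosed_isIntermediate.preimage (continuous_const.prodMk continuous_id)

lemma RegularGeometry.toReal_add_le (hL : L.RegularGeometry) {x z y : M} (h₁ : L.le x z)
    (h₂ : L.le z y) : (L.τ x z).toReal + (L.τ z y).toReal ≤ (L.τ x y).toReal := by
  rw [← ENNReal.toReal_add (hL.τ_ne_top _ _) (hL.τ_ne_top _ _)]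
  exact ENNReal.toReal_mono (hL.τ_ne_top _ _) (L.reverse_triangle x z y h₁ h₂)

end Geometry

section Transport

variable {M : Type*} [MetricSpace M] [ProperSpace M] [MeasurableSpace M] [BorelSpace M]
  {L : LorentzianPreLengthSpace M} {p : ℝ}

/-! ### Concatenation of couplings -/

lemma rpow_concave (hp₀ : 0 < p) (hp₁ : p < 1) {s X Y : ℝ} (hs : s ∈ Ioo (0 : ℝ) 1) (hX : 0 ≤ X)
    (hY : 0 ≤ Y) : s * X ^ p + (1 - s) * Y ^ p ≤ (s * X + (1 - s) * Y) ^ p :=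
  (Real.strictConcaveOn_rpow hp₀ hp₁).concaveOn.2 hX hY hs.1.le (sub_nonneg.2 hs.2.le) (by ring)

lemma eq_of_rpow_concave_eq (hp₀ : 0 < p) (hp₁ : p < 1) {s X Y : ℝ} (hs : s ∈ Ioo (0 : ℝ) 1)
    (hX : 0 ≤ X) (hY : 0 ≤ Y) (h : (s * X + (1 - s) * Y) ^ p ≤ s * X ^ p + (1 - s) * Y ^ p) :
    X = Y := by
  by_contra hne
  exact absurd ((Real.strictConcaveOn_rpow hp₀ hp₁).2 hX hY hne hs.1 (sub_pos.2 hs.2) (by ring))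
    (not_lt.2 h)

/-- The reverse triangle inequality for `τ^p`. Equality characterizes intermediate points, since
`r ↦ r ^ p` is strictly concave. -/
lemma RegularGeometry.realCost_triangle (hL : L.RegularGeometry) (hp₀ : 0 < p) (hp₁ : p < 1)
    {s : ℝ} (hs : s ∈ Ioo (0 : ℝ) 1) {x z y : M} (h₁ : L.le x z) (h₂ : L.le z y) :
    s ^ (1 - p) * L.realCost p x z + (1 - s) ^ (1 - p) * L.realCost p z y ≤ L.realCost p x y ∧
      (L.realCost p x y ≤ s ^ (1 - p) * L.realCost p x z + (1 - s) ^ (1 - p) * L.realCost p z y →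
        L.IsIntermediate s x z y) := by
  have hs' : 0 < 1 - s := sub_pos.2 hs.2
  set X := (L.τ x z).toReal with hX
  set Y := (L.τ z y).toReal with hY
  set Z := (L.τ x y).toReal with hZ
  have hX0 : 0 ≤ X := ENNReal.toReal_nonneg
  have hY0 : 0 ≤ Y := ENNReal.toReal_nonneg
  have hXYZ : X + Y ≤ Z := hL.toReal_add_le h₁ h₂
  have key : ∀ {r W : ℝ}, 0 < r → 0 ≤ W → r ^ (1 - p) * W ^ p = r * (W / r) ^ p := by
    intro r W hr hW
    rw [Real.div_rpow hW hr.le, Real.rpow_sub hr, Real.rpow_one]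
    ring
  have e1 : s * (X / s) + (1 - s) * (Y / (1 - s)) = X + Y := by
    rw [mul_div_cancel₀ _ hs.1.ne', mul_div_cancel₀ _ hs'.ne']
  have h3 := rpow_concave hp₀ hp₁ hs (div_nonneg hX0 hs.1.le) (div_nonneg hY0 hs'.le)
  have h4 : (X + Y) ^ p ≤ Z ^ p := Real.rpow_le_rpow (by positivity) hXYZ hp₀.le
  simp only [realCost, ← hX, ← hY, ← hZ]
  rw [key hs.1 hX0, key hs' hY0]
  rw [e1] at h3
  refine ⟨h3.trans h4, fun h => ?_⟩
  have h5 : X + Y = Z := by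
    refine le_antisymm hXYZ ((Real.rpow_le_rpow_iff (hXYZ.trans' (by positivity))
      (by positivity) hp₀).1 (h.trans h3))
  have h6 := eq_of_rpow_concave_eq hp₀ hp₁ hs (div_nonneg hX0 hs.1.le) (div_nonneg hY0 hs'.le)
    (by rw [e1]; exact h4.trans h)
  rw [div_eq_div_iff hs.1.ne' hs'.ne'] at h6
  refine ⟨h₁, h₂, ?_, ?_⟩
  · rw [← hX, ← hZ]; linear_combination h6 + s * h5
  · rw [← hY, ← hZ]; linear_combination -h6 + (1 - s) * h5

lemma measurable_e01 : Measurable fun w : M × M × M => (w.1, w.2.1) := by fun_prop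
lemma measurable_e02 : Measurable fun w : M × M × M => (w.1, w.2.2) := by fun_prop

/-- Concatenation of couplings: a causal measure on triples satisfies the reverse triangle
inequality, and if its outer pair has no larger cost than prescribed by the inner pairs, then it is
carried by triples with an intermediate point. -/
lemma RegularGeometry.totalCost_triangle (hL : L.RegularGeometry) (hp₀ : 0 < p) (hp₁ : p < 1)
    {s : ℝ} (hs : s ∈ Ioo (0 : ℝ) 1) {κ : Measure (M × M × M)}
    (hκ : ∀ᵐ w ∂κ, L.le w.1 w.2.1 ∧ L.le w.2.1 w.2.2) :
    ENNReal.ofReal (s ^ (1 - p)) * L.totalCost p (κ.map fun w => (w.1, w.2.1)) +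
        ENNReal.ofReal ((1 - s) ^ (1 - p)) * L.totalCost p (κ.map Prod.snd) ≤
      L.totalCost p (κ.map fun w => (w.1, w.2.2)) ∧
    (L.totalCost p (κ.map fun w => (w.1, w.2.2)) ≤
      ENNReal.ofReal (s ^ (1 - p)) * L.totalCost p (κ.map fun w => (w.1, w.2.1)) +
        ENNReal.ofReal ((1 - s) ^ (1 - p)) * L.totalCost p (κ.map Prod.snd) →
      L.totalCost p (κ.map fun w => (w.1, w.2.2)) ≠ ∞ →
      ∀ᵐ w ∂κ, L.IsIntermediate s w.1 w.2.1 w.2.2) := by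
  have hs' : 0 ≤ 1 - s := (sub_pos.2 hs.2).le
  have hc : Measurable fun z : M × M => L.τ z.1 z.2 ^ p := hL.measurable_τ.pow_const p
  have h01 : Measurable fun w : M × M × M => L.τ w.1 w.2.1 ^ p :=
    hc.comp (g := fun z : M × M => L.τ z.1 z.2 ^ p) measurable_e01
  have h12 : Measurable fun w : M × M × M => L.τ w.2.1 w.2.2 ^ p :=
    hc.comp (g := fun z : M × M => L.τ z.1 z.2 ^ p) measurable_snd
  have h02 : Measurable fun w : M × M × M => L.τ w.1 w.2.2 ^ p :=
    hc.comp (g := fun z : M × M => L.τ z.1 z.2 ^ p) measurable_e02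
  simp only [totalCost]
  rw [lintegral_map hc measurable_e01, lintegral_map hc measurable_e02,
    lintegral_map hc measurable_snd, ← lintegral_const_mul _ h01, ← lintegral_const_mul _ h12,
    ← lintegral_add_left (h01.const_mul _)]
  have hE : ∀ x z y : M, ENNReal.ofReal (s ^ (1 - p)) * L.τ x z ^ p +
      ENNReal.ofReal ((1 - s) ^ (1 - p)) * L.τ z y ^ p =
      ENNReal.ofReal (s ^ (1 - p) * L.realCost p x z + (1 - s) ^ (1 - p) * L.realCost p z y) := by
    intro x z y
    have a1 : 0 ≤ s ^ (1 - p) := Real.rpow_nonneg hs.1.le _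
    have a2 : 0 ≤ (1 - s) ^ (1 - p) := Real.rpow_nonneg hs' _
    rw [ENNReal.ofReal_add (mul_nonneg a1 (realCost_nonneg _ _))
      (mul_nonneg a2 (realCost_nonneg _ _)), ENNReal.ofReal_mul a1, ENNReal.ofReal_mul a2,
      hL.ofReal_realCost hp₀, hL.ofReal_realCost hp₀]
  have hle : ∀ᵐ w ∂κ, ENNReal.ofReal (s ^ (1 - p)) * L.τ w.1 w.2.1 ^ p +
      ENNReal.ofReal ((1 - s) ^ (1 - p)) * L.τ w.2.1 w.2.2 ^ p ≤ L.τ w.1 w.2.2 ^ p := by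
    filter_upwards [hκ] with w hw
    rw [hE, ← hL.ofReal_realCost hp₀]
    exact ENNReal.ofReal_le_ofReal (hL.realCost_triangle hp₀ hp₁ hs hw.1 hw.2).1
  refine ⟨lintegral_mono_ae hle, fun h hfin => ?_⟩
  have heq := ae_eq_of_ae_le_of_lintegral_le hle
    (ne_top_of_le_ne_top hfin (lintegral_mono_ae hle)) h02.aemeasurable h
  filter_upwards [heq, hκ] with w hw hw'
  refine (hL.realCost_triangle hp₀ hp₁ hs hw'.1 hw'.2).2 ?_
  rw [hE, ← hL.ofReal_realCost hp₀] at hw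
  refine (ENNReal.ofReal_le_ofReal_iff ?_).1 hw.ge
  exact add_nonneg (mul_nonneg (Real.rpow_nonneg hs.1.le _) (realCost_nonneg _ _))
    (mul_nonneg (Real.rpow_nonneg hs' _) (realCost_nonneg _ _))

/-- For triples with an intermediate point, equality holds in the reverse triangle inequality of
`RegularGeometry.totalCost_triangle`. -/
lemma RegularGeometry.totalCost_of_isIntermediate (hL : L.RegularGeometry) (hp₀ : 0 < p)
    {s : ℝ} (hs : s ∈ Ioo (0 : ℝ) 1) {κ : Measure (M × M × M)}
    (hκ : ∀ᵐ w ∂κ, L.IsIntermediate s w.1 w.2.1 w.2.2) :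
    ENNReal.ofReal (s ^ (1 - p)) * L.totalCost p (κ.map fun w => (w.1, w.2.1)) +
        ENNReal.ofReal ((1 - s) ^ (1 - p)) * L.totalCost p (κ.map Prod.snd) =
      L.totalCost p (κ.map fun w => (w.1, w.2.2)) := by
  have hs' : 0 < 1 - s := sub_pos.2 hs.2
  have hc : Measurable fun z : M × M => L.τ z.1 z.2 ^ p := hL.measurable_τ.pow_const p
  have h02 : Measurable fun w : M × M × M => L.τ w.1 w.2.2 ^ p :=
    hc.comp (g := fun z : M × M => L.τ z.1 z.2 ^ p) measurable_e02
  have key : ∀ {r : ℝ} {x z y y' : M}, 0 < r → (L.τ x z).toReal = r * (L.τ y y').toReal →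
      L.τ x z ^ p = ENNReal.ofReal (r ^ p) * L.τ y y' ^ p := by
    intro r x z y y' hr h
    rw [← hL.ofReal_realCost hp₀, ← hL.ofReal_realCost hp₀, ← ENNReal.ofReal_mul (by positivity),
      realCost, h, Real.mul_rpow hr.le ENNReal.toReal_nonneg]
    rfl
  have c01 : L.totalCost p (κ.map fun w => (w.1, w.2.1)) =
      ENNReal.ofReal (s ^ p) * L.totalCost p (κ.map fun w => (w.1, w.2.2)) := by
    simp only [totalCost]
    rw [lintegral_map hc measurable_e01, lintegral_map hc measurable_e02,
      ← lintegral_const_mul _ h02]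
    refine lintegral_congr_ae ?_
    filter_upwards [hκ] with w hw using key hs.1 hw.2.2.1
  have c12 : L.totalCost p (κ.map Prod.snd) =
      ENNReal.ofReal ((1 - s) ^ p) * L.totalCost p (κ.map fun w => (w.1, w.2.2)) := by
    simp only [totalCost]
    rw [lintegral_map hc measurable_snd, lintegral_map hc measurable_e02,
      ← lintegral_const_mul _ h02]
    refine lintegral_congr_ae ?_
    filter_upwards [hκ] with w hw using key hs' hw.2.2.2
  have e : ∀ {r : ℝ}, 0 < r → ENNReal.ofReal (r ^ (1 - p)) * ENNReal.ofReal (r ^ p) =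
      ENNReal.ofReal r := by
    intro r hr
    rw [← ENNReal.ofReal_mul (by positivity), ← Real.rpow_add hr]
    norm_num
  rw [c01, c12, ← mul_assoc, ← mul_assoc, e hs.1, e hs', ← add_mul,
    ← ENNReal.ofReal_add hs.1.le hs'.le]
  norm_num

/-- Gluing two causal couplings along their common marginal. -/
lemma exists_gluing_causal (hL : L.RegularGeometry) {α β : Measure (M × M)} [IsFiniteMeasure α]
    [IsFiniteMeasure β] [Nonempty M] (h : α.snd = β.fst) (hα : ∀ᵐ z ∂α, L.le z.1 z.2)
    (hβ : ∀ᵐ z ∂β, L.le z.1 z.2) :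
    ∃ κ : Measure (M × M × M), κ.map (fun w => (w.1, w.2.1)) = α ∧ κ.map Prod.snd = β ∧
      (∀ᵐ w ∂κ, L.le w.1 w.2.1 ∧ L.le w.2.1 w.2.2) := by
  obtain ⟨κ, h1, h2⟩ := exists_gluing α β h
  refine ⟨κ, h1, h2, ?_⟩
  have hm : MeasurableSet {z : M × M | L.le z.1 z.2} := hL.isClosed_le.measurableSet
  have a1 : ∀ᵐ w ∂κ, L.le w.1 w.2.1 :=
    (ae_map_iff (p := fun z : M × M => L.le z.1 z.2) measurable_e01.aemeasurable hm).1
      (by rw [h1]; exact hα)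
  have a2 : ∀ᵐ w ∂κ, L.le w.2.1 w.2.2 :=
    (ae_map_iff (p := fun z : M × M => L.le z.1 z.2) measurable_snd.aemeasurable hm).1
      (by rw [h2]; exact hβ)
  exact a1.and a2

lemma map_e01_fst (κ : Measure (M × M × M)) :
    (κ.map fun w => (w.1, w.2.1)).fst = κ.map Prod.fst := by
  rw [Measure.fst, Measure.map_map measurable_fst measurable_e01]; rfl

lemma map_e01_snd (κ : Measure (M × M × M)) :
    (κ.map fun w => (w.1, w.2.1)).snd = κ.map fun w => w.2.1 := by
  rw [Measure.snd, Measure.map_map measurable_snd measurable_e01]; rfl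

lemma map_e02_fst (κ : Measure (M × M × M)) :
    (κ.map fun w => (w.1, w.2.2)).fst = κ.map Prod.fst := by
  rw [Measure.fst, Measure.map_map measurable_fst measurable_e02]; rfl

lemma map_e02_snd (κ : Measure (M × M × M)) :
    (κ.map fun w => (w.1, w.2.2)).snd = κ.map fun w => w.2.2 := by
  rw [Measure.snd, Measure.map_map measurable_snd measurable_e02]; rfl

lemma map_snd_fst (κ : Measure (M × M × M)) :
    (κ.map Prod.snd).fst = κ.map fun w => w.2.1 := by
  rw [Measure.fst, Measure.map_map measurable_fst measurable_snd]; rfl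

lemma map_snd_snd (κ : Measure (M × M × M)) :
    (κ.map Prod.snd).snd = κ.map fun w => w.2.2 := by
  rw [Measure.snd, Measure.map_map measurable_snd measurable_snd]; rfl

/-! ### Geodesics of measures -/

lemma lorentzWasserstein_eq (hp : 0 < p) {μ ν : ProbabilityMeasure M} {π : Measure (M × M)}
    (h1 : π.fst = μ) (h2 : π.snd = ν) (hπ : L.IsMaximal p π) :
    L.lorentzWasserstein p μ ν = ((L.totalCost p π ^ (1 / p) : ℝ≥0∞) : EReal) :=
  ((isOptimalCoupling_iff hp).2 ⟨⟨h1, h2⟩, hπ⟩).2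

lemma exists_causal_of_lorentzWasserstein_ne_bot {μ ν : ProbabilityMeasure M}
    (h : L.lorentzWasserstein p μ ν ≠ ⊥) :
    ∃ π : Measure (M × M), π.fst = μ ∧ π.snd = ν ∧ ∀ᵐ z ∂π, L.le z.1 z.2 := by
  by_contra hc
  refine h (le_bot_iff.1 (iSup₂_le fun π hπ => ?_))
  exact absurd ⟨π, hπ.1.1, hπ.1.2, hπ.2⟩ hc

lemma IsGeodesicFromTo.exists_causal {μ₀ μ₁ : ProbabilityMeasure M}
    {μ : unitInterval → ProbabilityMeasure M} (h : L.IsGeodesicFromTo p μ₀ μ₁ μ)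
    {s t : unitInterval} (hst : s < t) :
    ∃ π : Measure (M × M), π.fst = μ s ∧ π.snd = μ t ∧ ∀ᵐ z ∂π, L.le z.1 z.2 := by
  obtain ⟨-, -, hpos, -, hW⟩ := h
  refine exists_causal_of_lorentzWasserstein_ne_bot (p := p) ?_
  rw [hW s t hst]
  have : (0 : EReal) ≤ (((t : ℝ) - (s : ℝ) : ℝ) : EReal) := by
    exact_mod_cast sub_nonneg.2 (show (s : ℝ) ≤ t from hst.le)
  exact (lt_of_lt_of_le EReal.bot_lt_zero (mul_nonneg this hpos.le)).ne'

/-- A geodesic between measures on `A` and `C` stays in the causal diamond of `A` and `C`. -/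
lemma IsGeodesicFromTo.measure_compl_diamond (hL : L.RegularGeometry) {μ₀ μ₁ : ProbabilityMeasure M}
    {μ : unitInterval → ProbabilityMeasure M} (h : L.IsGeodesicFromTo p μ₀ μ₁ μ) {A C : Set M}
    (hA : IsCompact A) (hC : IsCompact C) (hμ₀ : (μ₀ : Measure M) Aᶜ = 0)
    (hμ₁ : (μ₁ : Measure M) Cᶜ = 0) (s : unitInterval) :
    (μ s : Measure M) (L.causalDiamond A C)ᶜ = 0 := by
  have hJ := (hL.isCompact_diamond A C hA hC).measurableSet
  obtain ⟨π, h1, h2, h3⟩ := h.exists_causal (s := 0) (t := 1) zero_lt_one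
  rw [h.1] at h1
  rw [h.2.1] at h2
  have hAC : ∀ᵐ z ∂π, z.1 ∈ A ∧ z.2 ∈ C :=
    ae_mem_prod_of_marginals hA.measurableSet hC.measurableSet (h1 ▸ hμ₀) (h2 ▸ hμ₁)
  rcases eq_or_ne s 0 with rfl | hs0
  · rw [h.1, ← h1, ← mem_ae_iff]
    refine (ae_fst_mem_iff hJ).2 ?_
    filter_upwards [h3, hAC] with z hz hz'
    exact ⟨⟨z.1, hz'.1, L.le_refl _⟩, z.2, hz'.2, hz⟩
  rcases eq_or_ne s 1 with rfl | hs1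
  · rw [h.2.1, ← h2, ← mem_ae_iff]
    refine (ae_snd_mem_iff hJ).2 ?_
    filter_upwards [h3, hAC] with z hz hz'
    exact ⟨⟨z.1, hz'.1, hz⟩, z.2, hz'.2, L.le_refl _⟩
  obtain ⟨α, a1, a2, a3⟩ := h.exists_causal (unitInterval.pos_iff_ne_zero.2 hs0)
  obtain ⟨β, b1, b2, b3⟩ := h.exists_causal (unitInterval.lt_one_iff_ne_one.2 hs1)
  have : IsProbabilityMeasure α := isProbabilityMeasure_of_fst a1
  have : IsProbabilityMeasure β := isProbabilityMeasure_of_fst b1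
  have : Nonempty M := nonempty_of_isProbabilityMeasure (μ₀ : Measure M)
  obtain ⟨κ, k1, k2, k3⟩ := exists_gluing_causal hL (a2.trans b1.symm) a3 b3
  rw [h.1] at a1
  rw [h.2.1] at b2
  rw [← a2, ← k1, map_e01_snd, ← mem_ae_iff]
  refine (ae_map_iff (p := fun z => z ∈ L.causalDiamond A C) (by fun_prop) hJ).2 ?_
  have c1 : ∀ᵐ w ∂κ, w.1 ∈ A := by
    refine (ae_map_iff (p := fun x => x ∈ A) (f := Prod.fst) (by fun_prop) hA.measurableSet).1 ?_
    rw [← map_e01_fst, k1, a1]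
    exact mem_ae_iff.2 hμ₀
  have c2 : ∀ᵐ w ∂κ, w.2.2 ∈ C := by
    refine (ae_map_iff (p := fun x => x ∈ C) (f := fun w : M × M × M => w.2.2) (by fun_prop)
      hC.measurableSet).1 ?_
    rw [← map_snd_snd, k2, b2]
    exact mem_ae_iff.2 hμ₁
  filter_upwards [k3, c1, c2] with w hw h1 h2
  exact ⟨⟨w.1, h1, hw.1⟩, w.2.2, h2, hw.2⟩

/-- Along a geodesic of compactly supported measures there are maximal couplings between the measures
at any two times, whose cost is that between the end measures, scaled by a power of the elapsed
time. -/
lemma IsGeodesicFromTo.exists_totalCost (hL : L.RegularGeometry) (hp : 0 < p)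
    {μ₀ μ₁ : ProbabilityMeasure M}
    {μ : unitInterval → ProbabilityMeasure M} (h : L.IsGeodesicFromTo p μ₀ μ₁ μ) {A C : Set M}
    (hA : IsCompact A) (hC : IsCompact C) (hμ₀ : (μ₀ : Measure M) Aᶜ = 0)
    (hμ₁ : (μ₁ : Measure M) Cᶜ = 0) :
    ∃ T : ℝ≥0∞, T ≠ ∞ ∧ ∀ s t : unitInterval, s < t → ∃ π : Measure (M × M),
      π.fst = μ s ∧ π.snd = μ t ∧ L.IsMaximal p π ∧
        L.totalCost p π = ENNReal.ofReal ((t - s : ℝ) ^ p) * T := by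
  have hJ := hL.isCompact_diamond A C hA hC
  have hopt : ∀ s t : unitInterval, s < t → ∃ π : Measure (M × M),
      π.fst = μ s ∧ π.snd = μ t ∧ L.IsMaximal p π := by
    intro s t hst
    obtain ⟨σ, h1, h2, h3⟩ := h.exists_causal hst
    exact hL.exists_isMaximal hp hJ hJ (h.measure_compl_diamond hL hA hC hμ₀ hμ₁ s)
      (h.measure_compl_diamond hL hA hC hμ₀ hμ₁ t) h1 h2 h3
  obtain ⟨π, h1, h2, hπ⟩ := hopt 0 1 zero_lt_one
  have hW := lorentzWasserstein_eq hp h1 h2 hπ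
  have hp' : 0 < 1 / p := by positivity
  refine ⟨L.totalCost p π, fun htop => ?_, fun s t hst => ?_⟩
  · have := h.2.2.2.1
    rw [hW, htop, ENNReal.top_rpow_of_pos hp'] at this
    simp at this
  · obtain ⟨σ, s1, s2, hσ⟩ := hopt s t hst
    refine ⟨σ, s1, s2, hσ, ?_⟩
    have e := h.2.2.2.2 s t hst
    have hts : 0 ≤ (t : ℝ) - s := sub_nonneg.2 (show (s : ℝ) ≤ t from hst.le)
    rw [hW, lorentzWasserstein_eq hp s1 s2 hσ, ← max_eq_left hts, ← EReal.coe_ennreal_ofReal,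
      ← EReal.coe_ennreal_mul, EReal.coe_ennreal_eq_coe_ennreal_iff] at e
    have e' := congrArg (fun r : ℝ≥0∞ => r ^ p) e
    rw [ENNReal.mul_rpow_of_nonneg _ _ hp.le, ← ENNReal.rpow_mul, ← ENNReal.rpow_mul,
      one_div_mul_cancel hp.ne', ENNReal.rpow_one, ENNReal.rpow_one] at e'
    rw [e', ENNReal.ofReal_rpow_of_nonneg hts hp.le]

/-- Along a geodesic of compactly supported measures, measures at three times are the marginals of a
measure carried by triples with an intermediate point, whose outer pair is maximal. -/
lemma IsGeodesicFromTo.exists_intermediate (hL : L.RegularGeometry) (hp₀ : 0 < p) (hp₁ : p < 1)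
    {μ₀ μ₁ : ProbabilityMeasure M}
    {μ : unitInterval → ProbabilityMeasure M} (h : L.IsGeodesicFromTo p μ₀ μ₁ μ) {A C : Set M}
    (hA : IsCompact A) (hC : IsCompact C) (hμ₀ : (μ₀ : Measure M) Aᶜ = 0)
    (hμ₁ : (μ₁ : Measure M) Cᶜ = 0) {r s t : unitInterval} (hrs : r < s) (hst : s < t) :
    ∃ κ : Measure (M × M × M), κ.map Prod.fst = μ r ∧ κ.map (fun w => w.2.1) = μ s ∧
      κ.map (fun w => w.2.2) = μ t ∧ L.IsMaximal p (κ.map fun w => (w.1, w.2.2)) ∧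
      ∀ᵐ w ∂κ, L.IsIntermediate ((s - r : ℝ) / (t - r)) w.1 w.2.1 w.2.2 := by
  obtain ⟨T, hT, hW⟩ := h.exists_totalCost hL hp₀ hA hC hμ₀ hμ₁
  obtain ⟨α, a1, a2, a3, a4⟩ := hW r s hrs
  obtain ⟨β, b1, b2, b3, b4⟩ := hW s t hst
  obtain ⟨π, p1, p2, p3, p4⟩ := hW r t (hrs.trans hst)
  have : IsProbabilityMeasure α := isProbabilityMeasure_of_fst a1
  have : IsProbabilityMeasure β := isProbabilityMeasure_of_fst b1
  have : Nonempty M := nonempty_of_isProbabilityMeasure (μ₀ : Measure M)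
  obtain ⟨κ, k1, k2, k3⟩ := exists_gluing_causal hL (a2.trans b1.symm) a3.1 b3.1
  have m0 : κ.map Prod.fst = μ r := by rw [← map_e01_fst, k1, a1]
  have m2 : κ.map (fun w => w.2.2) = μ t := by rw [← map_snd_snd, k2, b2]
  have hc02 : ∀ᵐ z ∂(κ.map fun w => (w.1, w.2.2)), L.le z.1 z.2 := by
    refine (ae_map_iff (p := fun z : M × M => L.le z.1 z.2) measurable_e02.aemeasurable
      hL.isClosed_le.measurableSet).2 ?_
    filter_upwards [k3] with w hw using L.le_trans _ _ _ hw.1 hw.2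
  have f1 : (κ.map fun w => (w.1, w.2.2)).fst = π.fst := by rw [map_e02_fst, m0, p1]
  have f2 : (κ.map fun w => (w.1, w.2.2)).snd = π.snd := by rw [map_e02_snd, m2, p2]
  have hle := p3.2 _ f1 f2 hc02
  have hrs' : (0 : ℝ) < s - r := sub_pos.2 (show (r : ℝ) < s from hrs)
  have hst' : (0 : ℝ) < t - s := sub_pos.2 (show (s : ℝ) < t from hst)
  have hrt' : (0 : ℝ) < t - r := by linarith
  set a : ℝ := (s - r : ℝ) / (t - r) with ha
  have ha' : 1 - a = (t - s : ℝ) / (t - r) := by rw [ha]; field_simp; ring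
  have haI : a ∈ Ioo (0 : ℝ) 1 := ⟨by positivity, by rw [ha, div_lt_one hrt']; linarith⟩
  have key : ∀ {u : ℝ}, 0 < u → ENNReal.ofReal ((u / (t - r : ℝ)) ^ (1 - p)) *
      (ENNReal.ofReal (u ^ p) * T) = ENNReal.ofReal (u / (t - r : ℝ)) * L.totalCost p π := by
    intro u hu
    rw [p4, ← mul_assoc, ← mul_assoc, ← ENNReal.ofReal_mul (by positivity),
      ← ENNReal.ofReal_mul (by positivity)]
    congr 2
    have : u ^ p = (u / (t - r : ℝ)) ^ p * (t - r : ℝ) ^ p := by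
      rw [← Real.mul_rpow (by positivity) hrt'.le, div_mul_cancel₀ _ hrt'.ne']
    rw [this, ← mul_assoc, ← Real.rpow_add (by positivity)]
    norm_num
  have hsum : ENNReal.ofReal (a ^ (1 - p)) * L.totalCost p (κ.map fun w => (w.1, w.2.1)) +
      ENNReal.ofReal ((1 - a) ^ (1 - p)) * L.totalCost p (κ.map Prod.snd) = L.totalCost p π := by
    rw [k1, k2, a4, b4, ha', ha, key hrs', key hst', ← add_mul, ← ENNReal.ofReal_add
      (by positivity) (by positivity), ← add_div]
    rw [show (s - r : ℝ) + (t - s) = t - r by ring, div_self hrt'.ne']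
    simp
  have htri := hL.totalCost_triangle hp₀ hp₁ haI k3
  rw [hsum] at htri
  have heq := le_antisymm hle htri.1
  refine ⟨κ, m0, by rw [← map_e01_snd, k1, a2], m2, ⟨hc02, fun σ e1 e2 e3 => ?_⟩, htri.2 hle ?_⟩
  · rw [heq]
    exact p3.2 σ (e1.trans f1) (e2.trans f2) e3
  · rw [heq, p4]
    exact ENNReal.mul_ne_top ENNReal.ofReal_ne_top hT

/-- Intermediate points of `A × C` at small times are close to their initial points. -/
lemma RegularGeometry.dist_lt_of_isIntermediate (hL : L.RegularGeometry) {A C : Set M}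
    (hA : IsCompact A) (hC : IsCompact C) (hAC : ∀ x ∈ A, ∀ y ∈ C, L.ll x y) {ε : ℝ} (hε : 0 < ε) :
    ∃ s₀ ∈ Ioo (0 : ℝ) 1, ∀ s ∈ Ioo 0 s₀, ∀ x ∈ A, ∀ y ∈ C, ∀ z, L.IsIntermediate s x z y →
      dist x z < ε := by
  set J := L.causalDiamond A C with hJdef
  have hJ : IsCompact J := hL.isCompact_diamond A C hA hC
  -- The times at which some intermediate point is far away form a compact set without `0`.
  set F : Set (ℝ × M × M × M) := {w | L.IsIntermediate w.1 w.2.1 w.2.2.1 w.2.2.2 ∧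
    ε ≤ dist w.2.1 w.2.2.1} ∩ Icc 0 1 ×ˢ A ×ˢ J ×ˢ C with hF
  have hFc : IsCompact F := by
    refine (isCompact_Icc.prod (hA.prod (hJ.prod hC))).inter_left ?_
    exact hL.isClosed_isIntermediate.inter (_root_.isClosed_le continuous_const
      (continuous_snd.fst.dist continuous_snd.snd.fst))
  have h0 : (0 : ℝ) ∉ Prod.fst '' F := by
    rintro ⟨⟨s, x, z, y⟩, ⟨⟨hi, hd⟩, -, hx, hz, hy⟩, rfl⟩
    obtain ⟨h1, h2, h3, h4⟩ := hi
    simp only [zero_mul, sub_zero, one_mul] at h1 h2 h3 h4 hx hy hz hd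
    have hxy := hAC x hx y hy
    have e : L.τ x y = L.τ z y :=
      ((ENNReal.toReal_eq_toReal_iff' (hL.τ_ne_top _ _) (hL.τ_ne_top _ _)).1 h4).symm
    have hzy : L.ll z y := by rw [← L.τ_pos_iff, ← e, L.τ_pos_iff]; exact hxy
    have := hL.eq_of_τ_eq x z y h1 hzy e
    rw [this, dist_self] at hd
    linarith
  have hcl : IsClosed (Prod.fst '' F) := (hFc.image continuous_fst).isClosed
  obtain ⟨δ, hδ, hsub⟩ := Metric.isOpen_iff.1 hcl.isOpen_compl 0 h0
  refine ⟨min δ (1 / 2), ⟨by positivity, (min_le_right _ _).trans_lt (by norm_num)⟩, ?_⟩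
  intro s hs x hx y hy z hi
  by_contra hd
  have hsδ : s < δ := hs.2.trans_le (min_le_left _ _)
  have hs1 : s ≤ 1 := (hs.2.trans_le (min_le_right _ _)).le.trans (by norm_num)
  have hball : s ∈ Metric.ball (0 : ℝ) δ := by
    rwa [Metric.mem_ball, dist_zero_right, Real.norm_eq_abs, abs_of_pos hs.1]
  exact hsub hball ⟨(s, x, z, y), ⟨⟨hi, not_lt.1 hd⟩, ⟨hs.1.le, hs1⟩, hx,
    ⟨⟨x, hx, hi.1⟩, y, hy, hi.2.1⟩, hy⟩, rfl⟩

end Transport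

end LorentzianPreLengthSpace

namespace LorentzianPreLengthSpace

section Transport

variable {M : Type*} [MetricSpace M] [ProperSpace M] [MeasurableSpace M] [BorelSpace M]
  {L : LorentzianPreLengthSpace M} {p : ℝ}

/-! ### Approximation by measures of bounded density -/

section Smearing

open ProbabilityTheory

/-- Replacing each point of a measure by a normalized ball near it: a probability measure on a
compact set is coupled to one of bounded density, with an arbitrarily small displacement. -/
lemma exists_smearing (m : Measure M) [m.Regular] [m.IsOpenPosMeasure] {C : Set M}
    (hC : IsCompact C) {ν : Measure M} [IsProbabilityMeasure ν] (hν : ν Cᶜ = 0) {r : ℝ}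
    (hr : 0 < r) :
    ∃ γ : Measure (M × M), γ.fst = ν ∧ (∃ c : ℝ, 0 < c ∧ γ.snd ≤ ENNReal.ofReal c • m) ∧
      ∀ᵐ z ∂γ, dist z.1 z.2 ≤ r := by
  classical
  have : Nonempty M := nonempty_of_isProbabilityMeasure ν
  have hr2 : 0 < r / 2 := by positivity
  set e : ℕ → M := TopologicalSpace.denseSeq M with he
  set B : ℕ → Set M := fun i => Metric.closedBall (e i) (r / 2) with hB
  have hB0 : ∀ i, m (B i) ≠ 0 := fun i => (Metric.measure_closedBall_pos m (e i) hr2).ne'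
  have hBt : ∀ i, m (B i) ≠ ∞ := fun i => (isCompact_closedBall (e i) (r / 2)).measure_ne_top
  have hfind : ∀ x : M, ∃ i, dist x (e i) < r / 2 := fun x =>
    (TopologicalSpace.denseRange_denseSeq M).exists_dist_lt x hr2
  set f : M → ℕ := fun x => Nat.find (hfind x) with hf
  have hfm : Measurable f := measurable_find hfind fun k =>
    (isOpen_lt (continuous_id.dist continuous_const) continuous_const).measurableSet
  have hfx : ∀ x, dist x (e (f x)) < r / 2 := fun x => Nat.find_spec (hfind x)
  set k : Kernel M M := (Kernel.ofFunOfCountable fun i => m[|B i]).comap f hfm with hk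
  have hkx : ∀ x, k x = m[|B (f x)] := fun x => rfl
  have : IsMarkovKernel k := ⟨fun x =>
    cond_isProbabilityMeasure_of_finite (hB0 (f x)) (hBt (f x))⟩
  -- Only finitely many balls are used on `C`.
  obtain ⟨n, hn⟩ : ∃ n, ∀ x ∈ C, f x ≤ n := by
    obtain ⟨t, ht⟩ := hC.elim_finite_subcover (fun i => Metric.ball (e i) (r / 2))
      (fun i => Metric.isOpen_ball) fun x _ => mem_iUnion.2 ⟨f x, hfx x⟩
    refine ⟨t.sup id, fun x hx => ?_⟩
    obtain ⟨i, hi, hxi⟩ := mem_iUnion₂.1 (ht hx)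
    exact (Nat.find_min' (hfind x) hxi).trans (Finset.le_sup (f := id) hi)
  set c : ℝ := ∑ i ∈ Finset.range (n + 1), (m.real (B i))⁻¹ with hc
  have hpos : ∀ i, 0 < (m.real (B i))⁻¹ := fun i =>
    inv_pos.2 (ENNReal.toReal_pos (hB0 i) (hBt i))
  have hc0 : 0 < c := Finset.sum_pos (fun i _ => hpos i) ⟨0, by simp⟩
  refine ⟨ν ⊗ₘ k, Measure.fst_compProd ν k, ⟨c, hc0, ?_⟩, ?_⟩
  · refine Measure.le_iff.2 fun s hs => ?_
    rw [Measure.snd_compProd, Measure.bind_apply hs k.aemeasurable]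
    have hbd : ∀ᵐ x ∂ν, k x s ≤ ENNReal.ofReal c * m s := by
      filter_upwards [mem_ae_iff.2 hν] with x hx
      rw [hkx, cond_apply Metric.isClosed_closedBall.measurableSet]
      refine mul_le_mul' ?_ (measure_mono inter_subset_right)
      rw [← ENNReal.ofReal_toReal (ENNReal.inv_ne_top.2 (hB0 (f x))), ENNReal.toReal_inv]
      refine ENNReal.ofReal_le_ofReal ?_
      exact Finset.single_le_sum (f := fun i => (m.real (B i))⁻¹) (fun i _ => (hpos i).le)
        (Finset.mem_range.2 (Nat.lt_succ_of_le (hn x hx)))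
    calc ∫⁻ x, k x s ∂ν ≤ ∫⁻ _, ENNReal.ofReal c * m s ∂ν := lintegral_mono_ae hbd
      _ = (ENNReal.ofReal c • m) s := by simp
  · have hcl : MeasurableSet {z : M × M | dist z.1 z.2 ≤ r} :=
      (_root_.isClosed_le (continuous_fst.dist continuous_snd) continuous_const).measurableSet
    rw [Measure.ae_compProd_iff hcl]
    refine .of_forall fun x => ?_
    rw [hkx]
    filter_upwards [ae_cond_mem Metric.isClosed_closedBall.measurableSet] with y hy
    have h1 := (hfx x).le
    have h2 : dist y (e (f x)) ≤ r / 2 := hy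
    have := dist_triangle_right x y (e (f x))
    linarith

/-- A probability measure on a compact set is a weak limit of measures of bounded density, carried
by an arbitrarily small compact neighbourhood. -/
lemma exists_tendsto_of_bounded_density (m : Measure M) [m.Regular] [m.IsOpenPosMeasure] {C : Set M}
    (hC : IsCompact C) {ν : ProbabilityMeasure M} (hν : (ν : Measure M) Cᶜ = 0) {r : ℝ}
    (hr : 0 < r) :
    ∃ ν' : ℕ → ProbabilityMeasure M, Tendsto ν' atTop (𝓝 ν) ∧
      ∀ n, (ν' n : Measure M) (Metric.cthickening r C)ᶜ = 0 ∧
        ∃ c : ℝ, 0 < c ∧ (ν' n : Measure M) ≤ ENNReal.ofReal c • m := by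
  have hrn : ∀ n : ℕ, 0 < r / (n + 1) := fun n => by positivity
  choose γ hγ1 hγ2 hγ3 using fun n => exists_smearing m hC hν (hrn n)
  have hγp : ∀ n, IsProbabilityMeasure (γ n) := fun n => isProbabilityMeasure_of_fst (hγ1 n)
  have hγC : ∀ n, ∀ᵐ z ∂(γ n), z.1 ∈ C := fun n =>
    (ae_fst_mem_iff hC.measurableSet).1 (by rw [hγ1 n]; exact mem_ae_iff.2 hν)
  have hγC' : ∀ n, ∀ᵐ z ∂(γ n), z ∈ C ×ˢ Metric.cthickening r C := fun n => by
    filter_upwards [hγC n, hγ3 n] with z h1 h2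
    refine ⟨h1, Metric.mem_cthickening_of_dist_le z.2 z.1 r C h1 ?_⟩
    rw [dist_comm]
    exact h2.trans (div_le_self hr.le (by linarith [(Nat.cast_nonneg n : (0 : ℝ) ≤ n)]))
  have hK : IsCompact (C ×ˢ Metric.cthickening r C) := hC.prod hC.cthickening
  obtain ⟨P, -, φ, hφ, hlim⟩ := exists_subseq_tendsto hK
    (fun n => (⟨γ n, hγp n⟩ : ProbabilityMeasure (M × M))) fun n => mem_ae_iff.1 (hγC' n)
  -- The limit coupling is concentrated on the diagonal, so its two marginals agree.
  have hdiag : ∀ᵐ z ∂(P : Measure (M × M)), z.1 = z.2 := by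
    have : ∀ j : ℕ, ∀ᵐ z ∂(P : Measure (M × M)), dist z.1 z.2 ≤ r / (j + 1) := by
      intro j
      refine mem_ae_iff.2 (measure_compl_eq_zero_of_tendsto
        (hlim.comp (tendsto_add_atTop_nat j))
        (_root_.isClosed_le (continuous_fst.dist continuous_snd) continuous_const) fun n => ?_)
      refine mem_ae_iff.1 ?_
      filter_upwards [hγ3 (φ (n + j))] with z hz
      refine hz.trans (div_le_div_of_nonneg_left hr.le (by positivity) ?_)
      have : j ≤ φ (n + j) := (Nat.le_add_left j n).trans (hφ.id_le _)
      exact_mod_cast Nat.succ_le_succ this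
    filter_upwards [ae_all_iff.2 this] with z hz
    refine dist_le_zero.1 (ge_of_tendsto' (x := atTop) ?_ hz)
    exact (tendsto_const_div_atTop_nhds_zero_nat r).comp (tendsto_add_atTop_nat 1) |>.congr
      fun n => by simp
  have hP1 : (P : Measure (M × M)).map Prod.fst = ν :=
    map_tendsto_unique hlim continuous_fst (ν := ν) (νn := fun _ => ν) tendsto_const_nhds
      fun n => hγ1 (φ n)
  have hP2 : (P : Measure (M × M)).map Prod.snd = ν := by
    rw [← hP1]
    exact (Measure.map_congr hdiag).symm
  have h2 := ProbabilityMeasure.tendsto_map_of_tendsto_of_continuous _ P hlim continuous_snd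
  have hPν : P.map continuous_snd.aemeasurable = ν := Subtype.ext hP2
  rw [hPν] at h2
  refine ⟨_, h2, fun n => ⟨?_, hγ2 (φ n)⟩⟩
  refine mem_ae_iff.1 ((ae_snd_mem_iff (π := γ (φ n)) Metric.isClosed_cthickening.measurableSet).2 ?_)
  filter_upwards [hγC' (φ n)] with z hz using hz.2

end Smearing

/-- Monotonicity of supports passes to weak limits. -/
lemma timelikeMonotone_support_of_tendsto (hL : L.RegularGeometry) (hp : 0 < p)
    {P : ProbabilityMeasure (M × M)} {Q : ℕ → ProbabilityMeasure (M × M)}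
    (h : Tendsto Q atTop (𝓝 P)) (hQ : ∀ n, L.TimelikeMonotone p (Q n : Measure (M × M)).support) :
    L.TimelikeMonotone p (P : Measure (M × M)).support := by
  intro ι _ z σ hz hσ
  -- Every point of the support of the limit is a limit of points of the supports.
  have key : ∀ i, ∀ j : ℕ, ∀ᶠ n in atTop, ∃ w ∈ (Q n : Measure (M × M)).support,
      dist w (z i) < 1 / (j + 1 : ℝ) := by
    intro i j
    have hpos : 0 < (P : Measure (M × M)) (Metric.ball (z i) (1 / (j + 1 : ℝ))) :=
      (Measure.mem_support_iff_forall (z i)).1 (hz i) _ (Metric.ball_mem_nhds _ (by positivity))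
    have := lt_of_lt_of_le hpos
      (ProbabilityMeasure.le_liminf_measure_open_of_tendsto h Metric.isOpen_ball)
    filter_upwards [eventually_lt_of_lt_liminf this] with n hn
    by_contra hc
    push Not at hc
    refine hn.ne' (measure_mono_null (fun w hw => ?_)
      (Measure.measure_compl_support (μ := (Q n : Measure (M × M)))))
    exact fun hw' => absurd (Metric.mem_ball.1 hw) (not_lt.2 (hc w hw'))
  have key' : ∀ j : ℕ, ∃ n, ∀ i, ∃ w ∈ (Q n : Measure (M × M)).support,
      dist w (z i) < 1 / (j + 1 : ℝ) := fun j => (eventually_all.2 fun i => key i j).exists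
  choose n hn using key'
  choose w hw hd using hn
  have hlim : ∀ i, Tendsto (fun j => w j i) atTop (𝓝 (z i)) := fun i =>
    tendsto_iff_dist_tendsto_zero.2 (squeeze_zero (fun _ => dist_nonneg) (fun j => (hd j i).le)
      tendsto_one_div_add_atTop_nhds_zero_nat)
  have hpair : ∀ i k, Tendsto (fun j => ((w j k).1, (w j i).2)) atTop (𝓝 ((z k).1, (z i).2)) :=
    fun i k => ((continuous_fst.tendsto _).comp (hlim k)).prodMk_nhds
      ((continuous_snd.tendsto _).comp (hlim i))
  have hcost : ∀ i k, Tendsto (fun j => L.realCost p (w j k).1 (w j i).2) atTop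
      (𝓝 (L.realCost p (z k).1 (z i).2)) := by
    intro i k
    have hc := ((hL.continuous_realCost hp).tendsto ((z k).1, (z i).2)).comp (hpair i k)
    simpa only [Function.comp_def] using hc
  have hsum₁ := tendsto_finsetSum Finset.univ fun i (_ : i ∈ Finset.univ) => hcost i (σ i)
  have hsum₂ := tendsto_finsetSum Finset.univ fun i (_ : i ∈ Finset.univ) => hcost i i
  refine le_of_tendsto_of_tendsto hsum₁ hsum₂ ?_
  have hll : ∀ᶠ j in atTop, ∀ i, L.ll (w j (σ i)).1 (w j i).2 :=
    eventually_all.2 fun i => (hpair i (σ i)).eventually ((isOpen_ll L).mem_nhds (hσ i))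
  filter_upwards [hll] with j hj
  exact hQ (n j) ι (w j) σ (fun i => hw j i) hj

/-! ### Transport from normalized restrictions of the reference measure -/

/-- The normalized restriction of `m` to a set of positive finite measure. -/
noncomputable def uniformOn (m : Measure M) (A : Set M) (h0 : m A ≠ 0) (ht : m A ≠ ∞) :
    ProbabilityMeasure M :=
  ⟨ProbabilityTheory.cond m A, ProbabilityTheory.cond_isProbabilityMeasure_of_finite h0 ht⟩

lemma coe_uniformOn {m : Measure M} {A : Set M} (h0 : m A ≠ 0) (ht : m A ≠ ∞) :
    (uniformOn m A h0 ht : Measure M) = (m A)⁻¹ • m.restrict A := rfl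

lemma uniformOn_compl {m : Measure M} {A : Set M} (hA : MeasurableSet A) (h0 : m A ≠ 0)
    (ht : m A ≠ ∞) : (uniformOn m A h0 ht : Measure M) Aᶜ = 0 := by
  rw [coe_uniformOn, Measure.smul_apply, Measure.restrict_apply hA.compl]; simp

lemma uniformOn_le {m : Measure M} {A : Set M} (h0 : m A ≠ 0) (ht : m A ≠ ∞) :
    (uniformOn m A h0 ht : Measure M) ≤ ENNReal.ofReal (m.real A)⁻¹ • m := by
  rw [coe_uniformOn, Measure.real, ← ENNReal.toReal_inv,
    ENNReal.ofReal_toReal (ENNReal.inv_ne_top.2 h0)]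
  refine Measure.le_iff.2 fun s _ => ?_
  rw [Measure.smul_apply, Measure.smul_apply, smul_eq_mul, smul_eq_mul]
  exact mul_le_mul_right (Measure.restrict_le_self s) _

lemma support_subset_of_compl {μ : Measure M} {A : Set M} (hA : IsClosed A) (h : μ Aᶜ = 0) :
    μ.support ⊆ A := support_subset_of_ae hA (mem_ae_iff.2 h)

lemma isCompact_support_of_compl {μ : Measure M} {A : Set M} (hA : IsCompact A) (h : μ Aᶜ = 0) :
    IsCompact μ.support :=
  hA.of_isClosed_subset Measure.isClosed_support (support_subset_of_compl hA.isClosed h)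

lemma RegularGeometry.τNorm_le (hL : L.RegularGeometry) {π : Measure (M × M)}
    [IsProbabilityMeasure π] {D : ℝ} (hD : ∀ᵐ z ∂π, (L.τ z.1 z.2).toReal ≤ D) :
    L.τNorm 2 π ≤ ENNReal.ofReal D := by
  have h2 : (0 : ℝ) < 2 := two_pos
  have : ∫⁻ z, L.τ z.1 z.2 ^ (2 : ℝ) ∂π ≤ ENNReal.ofReal D ^ (2 : ℝ) := by
    calc ∫⁻ z, L.τ z.1 z.2 ^ (2 : ℝ) ∂π ≤ ∫⁻ _, ENNReal.ofReal D ^ (2 : ℝ) ∂π := by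
          refine lintegral_mono_ae ?_
          filter_upwards [hD] with z hz
          refine ENNReal.rpow_le_rpow ?_ h2.le
          rw [← ENNReal.ofReal_toReal (hL.τ_ne_top z.1 z.2)]
          exact ENNReal.ofReal_le_ofReal hz
      _ = ENNReal.ofReal D ^ (2 : ℝ) := by simp
  calc L.τNorm 2 π ≤ (ENNReal.ofReal D ^ (2 : ℝ)) ^ (1 / (2 : ℝ)) :=
        ENNReal.rpow_le_rpow this (by norm_num)
    _ = ENNReal.ofReal D := by rw [← ENNReal.rpow_mul]; norm_num

variable {m : Measure M} [m.Regular] [m.IsOpenPosMeasure] {K N : ℝ}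

/-- On chronologically related compact sets `A` and `C` the curvature condition provides geodesics
from the normalized restriction of `m` to `A`, whose entropy at small times hardly exceeds the
initial one. The rate depends only on `A` and `C`. -/
lemma WTCD.exists_geodesic (hTCD : L.WTCD m p K N) (hL : L.RegularGeometry) (hp : 0 < p)
    (hN : 0 < N) {A C : Set M} (hA : IsCompact A) (hC : IsCompact C)
    (hAC : ∀ x ∈ A, ∀ y ∈ C, L.ll x y) (h0 : m A ≠ 0) :
    ∃ H : ℝ, 1 ≤ H ∧ ∀ ν : ProbabilityMeasure M, (ν : Measure M) Cᶜ = 0 →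
      (∃ c : ℝ, 0 < c ∧ (ν : Measure M) ≤ ENNReal.ofReal c • m) →
      ∃ μ : unitInterval → ProbabilityMeasure M,
        L.IsGeodesicFromTo p (uniformOn m A h0 hA.measure_ne_top) ν μ ∧
        ∀ s : unitInterval, s * H < 1 →
          entropy m (μ s) ≤ ((-N * Real.log (1 - s * H) - Real.log (m.real A) : ℝ) : EReal) := by
  obtain ⟨D, hD0, hD⟩ := hL.exists_τ_bound hA hC
  have ht := hA.measure_ne_top (μ := m)
  have hmA : 0 < m.real A := ENNReal.toReal_pos h0 ht
  refine ⟨Real.cosh (D * √(-K / N)), Real.one_le_cosh _, fun ν hν ⟨c, hc, hνc⟩ => ?_⟩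
  set μ₀ := uniformOn m A h0 ht with hμ₀
  have hμ₀A : (μ₀ : Measure M) Aᶜ = 0 := uniformOn_compl hA.measurableSet h0 ht
  have hsupA := support_subset_of_compl hA.isClosed hμ₀A
  have hsupC := support_subset_of_compl hC.isClosed hν
  have hcA := isCompact_support_of_compl hA hμ₀A
  have hcC := isCompact_support_of_compl hC hν
  obtain ⟨hf0, he0⟩ := entropy_le_of_le_smul hA.measurableSet hμ₀A ht (inv_pos.2 hmA)
    (uniformOn_le h0 ht)
  obtain ⟨hf1, -⟩ := entropy_le_of_le_smul hC.measurableSet hν (hC.measure_ne_top (μ := m)) hc hνc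
  have hstrong := isStronglyTimelikeDualizable_of_prod (μ := μ₀) (ν := ν) hL hp hcA hcC
    fun x hx y hy => hAC x (hsupA hx) y (hsupC hy)
  obtain ⟨π', hπ'⟩ := hstrong.1
  have hae : ∀ π : Measure (M × M), IsCoupling μ₀ ν π → ∀ᵐ z ∂π, z.1 ∈ A ∧ z.2 ∈ C := fun π h =>
    ae_mem_prod_of_marginals hA.measurableSet hC.measurableSet (h.1 ▸ hμ₀A) (h.2 ▸ hν)
  have hWtop : L.lorentzWasserstein p μ₀ ν < ⊤ := by
    have hprob : IsProbabilityMeasure π' := isProbabilityMeasure_of_fst hπ'.2.1.1.1.1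
    rw [hπ'.2.1.2]
    refine lt_of_le_of_ne le_top fun h => ?_
    rw [EReal.coe_ennreal_eq_top_iff, τNorm, ENNReal.rpow_eq_top_iff_of_pos (by positivity)] at h
    exact hL.totalCost_ne_top hp hA hC (hae π' hπ'.1.1) h
  obtain ⟨π, μ, hπ1, -, hμ, hconv⟩ := hTCD μ₀ ν hstrong hcA hcC hf0 hf1 hWtop
  have hπp : IsProbabilityMeasure π := isProbabilityMeasure_of_fst hπ1.1.1
  have hθ := hL.τNorm_le (π := π) (D := D) (by
    filter_upwards [hae π hπ1.1] with z hz using hD _ hz.1 _ hz.2)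
  refine ⟨μ, hμ, fun s hs => ?_⟩
  have hdist := (le_distortion (K := K) (r := 1 - (s : ℝ)) hN hD0.le hθ
    ⟨sub_nonneg.2 s.2.2, sub_le_self _ s.2.1⟩).1
  rw [sub_sub_cancel] at hdist
  have hu0 := le_expEntropy_of_le hN he0
  have hs' : 0 < 1 - (s : ℝ) * Real.cosh (D * √(-K / N)) := sub_pos.2 hs
  have hu : ENNReal.ofReal ((1 - (s : ℝ) * Real.cosh (D * √(-K / N))) *
      Real.exp (-Real.log (m.real A)⁻¹ / N)) ≤ expEntropy m N (μ s) := by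
    rw [ENNReal.ofReal_mul hs'.le]
    refine (mul_le_mul' hdist hu0).trans (le_trans' (hconv s) ?_)
    rw [hμ.1]
    exact le_self_add
  have := entropy_le_of_le_expEntropy hN (mul_pos hs' (Real.exp_pos _)) hu
  rwa [Real.log_mul hs'.ne' (Real.exp_pos _).ne', Real.log_exp, Real.log_inv, neg_neg,
    show -N * (Real.log (1 - s * Real.cosh (D * √(-K / N))) + Real.log (m.real A) / N) =
      -N * Real.log (1 - s * Real.cosh (D * √(-K / N))) - Real.log (m.real A) by
      field_simp; ring] at this

/-- A weak limit of measures of bounded entropy cannot be carried by a compact set of too small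
measure. -/
lemma exp_neg_le_measure_of_tendsto {P : ProbabilityMeasure M} {Q : ℕ → ProbabilityMeasure M}
    (h : Tendsto Q atTop (𝓝 P)) {J Z : Set M} (hJ : IsCompact J) (hZ : IsCompact Z)
    (hQ : ∀ n, (Q n : Measure M) Jᶜ = 0) {E : ℝ} (hE : ∀ n, entropy m (Q n) ≤ (E : EReal))
    (hP : (P : Measure M) Zᶜ = 0) : Real.exp (-E) ≤ m.real Z := by
  have hJm := hJ.measurableSet
  -- Jensen's inequality with weight `exp E` on a neighbourhood of `Z` and `η` on the rest of `J`.
  -- In the limit, the neighbourhood carries all of the mass.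
  have step : ∀ ε > 0, ∀ η > 0,
      1 ≤ Real.exp E * m.real (Metric.cthickening ε Z) + η * m.real J := by
    intro ε hε η hη
    set A := Metric.cthickening ε Z with hA
    have hAc : IsCompact A := hZ.cthickening
    set B := J \ A with hB
    have hBm : MeasurableSet B := hJm.diff hAc.measurableSet
    have hJfin := hJ.measure_ne_top (μ := m)
    have hBfin : m B ≠ ∞ := measure_ne_top_of_subset sdiff_subset hJfin
    have hbound : ∀ n, (Q n : Measure M).real A * E + (1 - (Q n : Measure M).real A) * Real.log η +
        1 - Real.exp E * m.real A - η * m.real B ≤ E := by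
      intro n
      have h1 := le_entropy (m := m) (μ := Q n) hAc.measurableSet hBm disjoint_sdiff_right
        (measure_mono_null (compl_subset_compl.2 (by rw [union_sdiff_self]; exact subset_union_right))
          (hQ n)) hAc.measure_ne_top hBfin (Real.exp_pos E) hη
      have h2 := EReal.coe_le_coe_iff.1 (h1.trans (hE n))
      have h3 : (Q n : Measure M).real B = 1 - (Q n : Measure M).real A := by
        rw [← probReal_compl_eq_one_sub hAc.measurableSet]
        refine measureReal_congr ?_
        have : ∀ᵐ x ∂(Q n : Measure M), x ∈ J := mem_ae_iff.2 (hQ n)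
        filter_upwards [this] with x hx
        exact propext ⟨fun hx' => hx'.2, fun hx' => ⟨hx, hx'⟩⟩
      rw [Real.log_exp, h3] at h2
      exact h2
    have hlim : Tendsto (fun n => (Q n : Measure M).real A) atTop (𝓝 1) := by
      have h1 := ProbabilityMeasure.le_liminf_measure_open_of_tendsto h
        (Metric.isOpen_thickening (δ := ε) (E := Z))
      have h2 : (P : Measure M) (Metric.thickening ε Z) = 1 := by
        rw [prob_eq_one_iff_ae Metric.isOpen_thickening.measurableSet]
        filter_upwards [mem_ae_iff.2 hP] with x hx using Metric.self_subset_thickening hε Z hx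
      rw [h2] at h1
      have h3 : Tendsto (fun n => (Q n : Measure M) A) atTop (𝓝 1) := by
        refine tendsto_of_le_liminf_of_limsup_le (h1.trans (liminf_le_liminf (.of_forall fun n =>
          measure_mono (Metric.thickening_subset_cthickening ε Z)))) ?_
        exact limsup_le_of_le (h := .of_forall fun n => prob_le_one)
      exact (ENNReal.tendsto_toReal ENNReal.one_ne_top).comp h3
    have hlim2 := le_of_tendsto' ((((hlim.mul_const E).add ((hlim.const_sub 1).mul_const
      (Real.log η))).add_const 1).sub_const (Real.exp E * m.real A) |>.sub_const (η * m.real B)) hbound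
    have hBJ : η * m.real B ≤ η * m.real J :=
      mul_le_mul_of_nonneg_left (measureReal_mono sdiff_subset hJfin) hη.le
    linarith
  have step2 : ∀ ε > 0, 1 ≤ Real.exp E * m.real (Metric.cthickening ε Z) := by
    intro ε hε
    have hlim : Tendsto (fun η => Real.exp E * m.real (Metric.cthickening ε Z) + η * m.real J)
        (𝓝[>] (0 : ℝ)) (𝓝 (Real.exp E * m.real (Metric.cthickening ε Z) + 0 * m.real J)) :=
      tendsto_nhdsWithin_of_tendsto_nhds (Continuous.tendsto (by fun_prop) 0)
    rw [zero_mul, add_zero] at hlim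
    exact ge_of_tendsto hlim (by filter_upwards [self_mem_nhdsWithin] with η hη using step ε hε η hη)
  have hlim : Tendsto (fun ε => Real.exp E * m.real (Metric.cthickening ε Z)) (𝓝[>] (0 : ℝ))
      (𝓝 (Real.exp E * m.real Z)) :=
    (tendsto_nhdsWithin_of_tendsto_nhds ((ENNReal.tendsto_toReal hZ.measure_ne_top).comp
      (tendsto_measure_cthickening_of_isCompact hZ))).const_mul _
  have := ge_of_tendsto hlim (by filter_upwards [self_mem_nhdsWithin] with ε hε using step2 ε hε)
  rw [Real.exp_neg, inv_le_iff_one_le_mul₀ (Real.exp_pos E), mul_comm]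
  exact this

end Transport

end LorentzianPreLengthSpace

namespace LorentzianPreLengthSpace

section Transport

variable {M : Type*} [MetricSpace M] [ProperSpace M] [MeasurableSpace M] [BorelSpace M]
  {L : LorentzianPreLengthSpace M} {p : ℝ}

lemma exists_cthickening_chronological {A C : Set M} (hA : IsCompact A) (hC : IsCompact C)
    (hAC : ∀ x ∈ A, ∀ y ∈ C, L.ll x y) : ∃ r > 0, ∀ x ∈ Metric.cthickening r A,
      ∀ y ∈ Metric.cthickening r C, L.ll x y := by
  obtain ⟨u, v, hu, hv, hAu, hCv, huv⟩ := generalized_tube_lemma hA hC (isOpen_ll L)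
    fun z hz => hAC _ hz.1 _ hz.2
  obtain ⟨r₁, hr₁, h₁⟩ := hA.exists_cthickening_subset_open hu hAu
  obtain ⟨r₂, hr₂, h₂⟩ := hC.exists_cthickening_subset_open hv hCv
  refine ⟨min r₁ r₂, lt_min hr₁ hr₂, fun x hx y hy => huv (a := (x, y)) ⟨h₁ ?_, h₂ ?_⟩⟩
  · exact Metric.cthickening_mono (min_le_left _ _) _ hx
  · exact Metric.cthickening_mono (min_le_right _ _) _ hy

/-- The entropy excess allowed by `WTCD.exists_geodesic` is less than `δ` at small times. -/
lemma exists_log_bound {N H δ : ℝ} (hδ : 0 < δ) :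
    ∃ s₀ ∈ Ioo (0 : ℝ) 1, ∀ s ∈ Ioo (0 : ℝ) s₀, s * H < 1 ∧ -N * Real.log (1 - s * H) < δ := by
  have hc : ContinuousAt (fun s : ℝ => -N * Real.log (1 - s * H)) 0 := by
    refine continuousAt_const.mul (ContinuousAt.log (by fun_prop) (by norm_num))
  have h1 : ∀ᶠ s : ℝ in 𝓝 0, -N * Real.log (1 - s * H) < δ :=
    hc.eventually_lt continuousAt_const (by simpa using hδ)
  have h2 : ∀ᶠ s : ℝ in 𝓝 0, s * H < 1 :=
    (by fun_prop : ContinuousAt (fun s : ℝ => s * H) 0).eventually_lt continuousAt_const (by norm_num)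
  obtain ⟨r, hr, hsub⟩ := Metric.eventually_nhds_iff.1 (h1.and h2)
  refine ⟨min r (1 / 2), ⟨by positivity, (min_le_right _ _).trans_lt (by norm_num)⟩, fun s hs => ?_⟩
  have := hsub (y := s) (by
    rw [dist_zero_right, Real.norm_eq_abs, abs_of_pos hs.1]; exact hs.2.trans_le (min_le_left _ _))
  exact ⟨this.2, this.1⟩

variable {m : Measure M} [m.Regular] [m.IsOpenPosMeasure] {K N : ℝ}

/-- Transport from the normalized restriction of `m` to `A` to an arbitrary probability measure on
`C`, with `A` and `C` chronologically related: at small times, the intermediate points along some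
maximal coupling fill a set of almost the measure of `A`. For a target of bounded density this
follows from the curvature condition; the general case is a weak limit. -/
lemma WTCD.exists_intermediate_large (hTCD : L.WTCD m p K N) (hL : L.RegularGeometry) (hp₀ : 0 < p)
    (hp₁ : p < 1) (hN : 0 < N) {A C : Set M} (hA : IsCompact A) (hC : IsCompact C)
    (hAC : ∀ x ∈ A, ∀ y ∈ C, L.ll x y) (h0 : m A ≠ 0) {δ : ℝ} (hδ : 0 < δ) :
    ∃ s₀ ∈ Ioo (0 : ℝ) 1, ∀ s ∈ Ioo 0 s₀, ∀ ν : ProbabilityMeasure M, (ν : Measure M) Cᶜ = 0 →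
      ∃ κ : Measure (M × M × M), κ.map Prod.fst = uniformOn m A h0 hA.measure_ne_top ∧
        κ.map (fun w => w.2.2) = ν ∧ L.IsMaximal p (κ.map fun w => (w.1, w.2.2)) ∧
        (∀ᵐ w ∂κ, L.IsIntermediate s w.1 w.2.1 w.2.2) ∧
        ∀ Z : Set M, IsCompact Z → (∀ᵐ w ∂κ, w.2.1 ∈ Z) → Real.exp (-δ) * m.real A ≤ m.real Z := by
  obtain ⟨r, hr, hrll⟩ := exists_cthickening_chronological hA hC hAC
  set C' := Metric.cthickening r C with hC'
  have hC'c : IsCompact C' := hC.cthickening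
  have hAC' : ∀ x ∈ A, ∀ y ∈ C', L.ll x y := fun x hx y hy =>
    hrll x (Metric.self_subset_cthickening A hx) y hy
  obtain ⟨H, hH, hflow⟩ := hTCD.exists_geodesic hL hp₀ hN hA hC'c hAC' h0
  obtain ⟨s₀, hs₀, hs₀H⟩ := exists_log_bound (N := N) (H := H) hδ
  refine ⟨s₀, hs₀, fun s hs ν hν => ?_⟩
  have ht := hA.measure_ne_top (μ := m)
  have hmA : 0 < m.real A := ENNReal.toReal_pos h0 ht
  set μ₀ := uniformOn m A h0 ht with hμ₀
  have hμ₀A : (μ₀ : Measure M) Aᶜ = 0 := uniformOn_compl hA.measurableSet h0 ht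
  have hs1 : s < 1 := hs.2.trans hs₀.2
  set sI : unitInterval := ⟨s, hs.1.le, hs1.le⟩ with hsI
  obtain ⟨ν', hν', hν'2⟩ := exists_tendsto_of_bounded_density m hC hν hr
  choose μ hμ hent using fun n => hflow (ν' n) (hν'2 n).1 (hν'2 n).2
  have hent' : ∀ n, entropy m (μ n sI) ≤ ((δ - Real.log (m.real A) : ℝ) : EReal) := fun n => by
    refine (hent n sI (hs₀H s hs).1).trans (EReal.coe_le_coe_iff.2 ?_)
    linarith [(hs₀H s hs).2]
  set J := L.causalDiamond A C' with hJ
  have hJc : IsCompact J := hL.isCompact_diamond A C' hA hC'c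
  choose κ hκ0 hκ1 hκ2 hκmax hκint using fun n => (hμ n).exists_intermediate hL hp₀ hp₁ hA hC'c
    hμ₀A (hν'2 n).1 (show (0 : unitInterval) < sI from hs.1) (show sI < 1 from hs1)
  have hκint : ∀ n, ∀ᵐ w ∂(κ n), L.IsIntermediate s w.1 w.2.1 w.2.2 := fun n => by
    simpa using hκint n
  have hκ0' : ∀ n, (κ n).map Prod.fst = μ₀ := fun n => by rw [hκ0 n, (hμ n).1]
  have hκ2' : ∀ n, (κ n).map (fun w => w.2.2) = ν' n := fun n => by rw [hκ2 n, (hμ n).2.1]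
  have hκp : ∀ n, IsProbabilityMeasure (κ n) := fun n => isProbabilityMeasure_of_fst (hκ0' n)
  have hκA : ∀ n, ∀ᵐ w ∂(κ n), w.1 ∈ A := fun n =>
    (ae_map_iff (p := fun x => x ∈ A) (f := Prod.fst) (by fun_prop) hA.measurableSet).1
      (by rw [hκ0' n]; exact mem_ae_iff.2 hμ₀A)
  have hκC : ∀ n, ∀ᵐ w ∂(κ n), w.2.2 ∈ C' := fun n =>
    (ae_map_iff (p := fun x => x ∈ C') (f := fun w : M × M × M => w.2.2) (by fun_prop)
      hC'c.measurableSet).1 (by rw [hκ2' n]; exact mem_ae_iff.2 (hν'2 n).1)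
  have hκall : ∀ n, ∀ᵐ w ∂(κ n), w ∈ A ×ˢ J ×ˢ C' := fun n => by
    filter_upwards [hκA n, hκC n, hκint n] with w h1 h2 h3
    exact ⟨h1, ⟨⟨w.1, h1, h3.1⟩, w.2.2, h2, h3.2.1⟩, h2⟩
  set Q : ℕ → ProbabilityMeasure (M × M × M) := fun n => ⟨κ n, hκp n⟩ with hQ
  obtain ⟨P, hPK, φ, hφ, hlim⟩ := exists_subseq_tendsto (hA.prod (hJc.prod hC'c)) Q
    fun n => mem_ae_iff.1 (hκall n)
  have hPall : ∀ᵐ w ∂(P : Measure (M × M × M)), w ∈ A ×ˢ J ×ˢ C' := mem_ae_iff.2 hPK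
  have hc0 : Continuous (Prod.fst : M × M × M → M) := continuous_fst
  have hc1 : Continuous fun w : M × M × M => w.2.1 := by fun_prop
  have hc2 : Continuous fun w : M × M × M => w.2.2 := by fun_prop
  have hc02 : Continuous fun w : M × M × M => (w.1, w.2.2) := by fun_prop
  refine ⟨P, ?_, ?_, ?_, ?_, ?_⟩
  · exact map_tendsto_unique hlim hc0 (ν := μ₀) (νn := fun _ => μ₀) tendsto_const_nhds
      fun n => hκ0' (φ n)
  · exact map_tendsto_unique hlim hc2 (hν'.comp hφ.tendsto_atTop) fun n => hκ2' (φ n)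
  · have hlim02 := ProbabilityMeasure.tendsto_map_of_tendsto_of_continuous _ P hlim hc02
    have hmono := timelikeMonotone_support_of_tendsto hL hp₀ hlim02 fun n => by
      have e : (((Q ∘ φ) n).map hc02.aemeasurable : Measure (M × M)) =
          (κ (φ n)).map fun w => (w.1, w.2.2) := rfl
      have : IsProbabilityMeasure ((κ (φ n)).map fun w => (w.1, w.2.2)) :=
        Measure.isProbabilityMeasure_map hc02.aemeasurable
      rw [e]
      refine (hκmax (φ n)).timelikeMonotone_support hL hp₀
        (hL.totalCost_ne_top hp₀ hA hC'c ?_)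
      refine (ae_map_iff (p := fun z : M × M => z.1 ∈ A ∧ z.2 ∈ C') hc02.aemeasurable
        (hA.measurableSet.prod hC'c.measurableSet)).2 ?_
      filter_upwards [hκall (φ n)] with w hw using ⟨hw.1, hw.2.2⟩
    have : IsProbabilityMeasure ((P : Measure (M × M × M)).map fun w => (w.1, w.2.2)) :=
      Measure.isProbabilityMeasure_map hc02.aemeasurable
    refine hmono.isMaximal hL hp₀ hA hC'c hAC' ?_ (ae_mem_support _)
    refine support_subset_prod hA.isClosed hC'c.isClosed ?_
    refine (ae_map_iff (p := fun z : M × M => z.1 ∈ A ∧ z.2 ∈ C') hc02.aemeasurable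
      (hA.measurableSet.prod hC'c.measurableSet)).2 ?_
    filter_upwards [hPall] with w hw using ⟨hw.1, hw.2.2⟩
  · exact mem_ae_iff.2 (measure_compl_eq_zero_of_tendsto hlim
      (hL.isClosed_isIntermediate_right s) fun n => mem_ae_iff.1 (hκint (φ n)))
  · intro Z hZ hPZ
    have hlim1 := ProbabilityMeasure.tendsto_map_of_tendsto_of_continuous _ P hlim hc1
    have e : ∀ n, ((Q ∘ φ) n).map hc1.aemeasurable = μ (φ n) sI := fun n =>
      Subtype.ext (hκ1 (φ n))
    have := exp_neg_le_measure_of_tendsto (m := m) hlim1 hJc hZ (fun n => by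
      rw [e n]
      exact (hμ (φ n)).measure_compl_diamond hL hA hC'c hμ₀A (hν'2 (φ n)).1 sI)
      (E := δ - Real.log (m.real A)) (fun n => by rw [e n]; exact hent' (φ n))
      (mem_ae_iff.1 ((ae_map_iff (p := fun x => x ∈ Z) hc1.aemeasurable hZ.measurableSet).2 hPZ))
    rwa [neg_sub, Real.exp_sub, Real.exp_log hmA, div_eq_inv_mul, ← Real.exp_neg] at this

/-- A short flow starting from the normalized restriction of `m` to a compact set `A` lying in the
chronological past of a point: at small times at least half of the mass is found in `A`, and
points move to the future at a uniform rate. -/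
lemma WTCD.exists_short_flow (hTCD : L.WTCD m p K N) (hL : L.RegularGeometry) (hp₀ : 0 < p)
    (hp₁ : p < 1) (hN : 0 < N) {A : Set M} (hA : IsCompact A) {b : M} (hAb : ∀ x ∈ A, L.ll x b)
    (h0 : m A ≠ 0) :
    ∃ (μ : ℝ → ProbabilityMeasure M) (c s₀ : ℝ), 0 < c ∧ 0 < s₀ ∧
      (μ 0 : Measure M) Aᶜ = 0 ∧ (∀ s ∈ Icc 0 s₀, 1 / 2 ≤ (μ s : Measure M).real A) ∧
      ∀ s t, 0 ≤ s → s < t → t ≤ s₀ → ∃ π : Measure (M × M), π.fst = μ s ∧ π.snd = μ t ∧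
        ∀ᵐ z ∂π, L.le z.1 z.2 ∧ (t - s) * c ≤ (L.τ z.1 z.2).toReal := by
  have ht := hA.measure_ne_top (μ := m)
  have hmA : 0 < m.real A := ENNReal.toReal_pos h0 ht
  obtain ⟨r, hr, hrll⟩ := exists_cthickening_chronological hA (isCompact_singleton (x := b))
    fun x hx y hy => by rw [mem_singleton_iff.1 hy]; exact hAb x hx
  set C := Metric.closedBall b r with hCdef
  have hCr : Metric.cthickening r {b} = C := Metric.cthickening_singleton b hr.le
  rw [hCr] at hrll
  have hC : IsCompact C := isCompact_closedBall b r
  have hAC : ∀ x ∈ A, ∀ y ∈ C, L.ll x y := fun x hx => hrll x (Metric.self_subset_cthickening A hx)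
  have hmC : m C ≠ 0 := (Metric.measure_closedBall_pos m b hr).ne'
  obtain ⟨H, hH, hflow⟩ := hTCD.exists_geodesic hL hp₀ hN hA hC hAC h0
  set μ₀ := uniformOn m A h0 ht with hμ₀
  set μ₁ := uniformOn m C hmC hC.measure_ne_top with hμ₁
  have hμ₀A : (μ₀ : Measure M) Aᶜ = 0 := uniformOn_compl hA.measurableSet h0 ht
  have hμ₁C : (μ₁ : Measure M) Cᶜ = 0 := uniformOn_compl hC.measurableSet hmC hC.measure_ne_top
  obtain ⟨μ, hμ, hent⟩ := hflow μ₁ hμ₁C ⟨_, inv_pos.2 (ENNReal.toReal_pos hmC hC.measure_ne_top),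
    uniformOn_le hmC hC.measure_ne_top⟩
  -- A neighbourhood of `A` in which the mass added to `A` is negligible.
  obtain ⟨ε, hε0, hεr, hεm⟩ : ∃ ε > 0, ε ≤ r ∧
      m.real (Metric.cthickening ε A) ≤ m.real A + Real.exp (-4) * m.real A := by
    have hlim : Tendsto (fun ε => m.real (Metric.cthickening ε A)) (𝓝[>] (0 : ℝ)) (𝓝 (m.real A)) :=
      tendsto_nhdsWithin_of_tendsto_nhds ((ENNReal.tendsto_toReal hA.measure_ne_top).comp
        (tendsto_measure_cthickening_of_isCompact hA))
    have h1 : ∀ᶠ ε in 𝓝[>] (0 : ℝ),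
        m.real (Metric.cthickening ε A) < m.real A + Real.exp (-4) * m.real A :=
      hlim.eventually_lt_const (by linarith [mul_pos (Real.exp_pos (-4)) hmA])
    obtain ⟨ε, ⟨h1, h2⟩⟩ := (h1.and (Ioo_mem_nhdsGT hr)).exists
    exact ⟨ε, h2.1, h2.2.le, h1.le⟩
  set A' := Metric.cthickening ε A with hA'
  have hA'c : IsCompact A' := hA.cthickening
  have hAA' : A ⊆ A' := Metric.self_subset_cthickening A
  have hA'C : ∀ x ∈ A', ∀ y ∈ C, L.ll x y := fun x hx =>
    hrll x (Metric.cthickening_mono hεr A hx)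
  have hAne : A.Nonempty := by
    by_contra h
    rw [not_nonempty_iff_eq_empty] at h
    exact h0 (by rw [h]; exact measure_empty)
  obtain ⟨c, hc, hcτ⟩ : ∃ c > 0, ∀ x ∈ A', ∀ y ∈ C, c ≤ (L.τ x y).toReal := by
    obtain ⟨w, hw, hmin⟩ := (hA'c.prod hC).exists_isMinOn
      ((hAne.mono hAA').prod ⟨b, Metric.mem_closedBall_self hr.le⟩)
      hL.continuous_toReal.continuousOn
    refine ⟨(L.τ w.1 w.2).toReal, ENNReal.toReal_pos
      ((L.τ_pos_iff _ _).2 (hA'C _ hw.1 _ hw.2)).ne' (hL.τ_ne_top _ _), fun x hx y hy => ?_⟩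
    exact hmin (show (x, y) ∈ A' ×ˢ C from ⟨hx, hy⟩)
  obtain ⟨s₁, hs₁, hdist⟩ := hL.dist_lt_of_isIntermediate hA hC hAC hε0
  obtain ⟨s₂, hs₂, hlog⟩ := exists_log_bound (N := N) (H := H) one_pos
  -- For small times the flow stays near `A`.
  have hA's : ∀ s : unitInterval, (s : ℝ) < s₁ → (μ s : Measure M) A'ᶜ = 0 := by
    intro s hs
    rcases eq_or_ne s 0 with rfl | hs0
    · rw [hμ.1]; exact measure_mono_null (compl_subset_compl.2 hAA') hμ₀A
    have hs0 : (0 : unitInterval) < s := unitInterval.pos_iff_ne_zero.2 hs0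
    obtain ⟨κ, k0, k1, k2, -, k3⟩ := hμ.exists_intermediate hL hp₀ hp₁ hA hC hμ₀A hμ₁C hs0
      (show s < 1 from hs.trans hs₁.2)
    rw [← k1, ← mem_ae_iff]
    refine (ae_map_iff (p := fun x => x ∈ A') (by fun_prop) hA'c.measurableSet).2 ?_
    have e0 : ∀ᵐ w ∂κ, w.1 ∈ A :=
      (ae_map_iff (p := fun x => x ∈ A) (f := Prod.fst) (by fun_prop) hA.measurableSet).1
        (by rw [k0, hμ.1]; exact mem_ae_iff.2 hμ₀A)
    have e2 : ∀ᵐ w ∂κ, w.2.2 ∈ C :=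
      (ae_map_iff (p := fun x => x ∈ C) (f := fun w : M × M × M => w.2.2) (by fun_prop)
        hC.measurableSet).1 (by rw [k2, hμ.2.1]; exact mem_ae_iff.2 hμ₁C)
    filter_upwards [k3, e0, e2] with w hw h1 h2
    have hw' : L.IsIntermediate (s : ℝ) w.1 w.2.1 w.2.2 := by simpa using hw
    refine Metric.mem_cthickening_of_dist_le _ w.1 ε A h1 ?_
    rw [dist_comm]
    exact (hdist s ⟨hs0, hs⟩ w.1 h1 w.2.2 h2 w.2.1 hw').le
  set s₀ := min s₁ s₂ / 2 with hs₀
  have hs₀0 : 0 < s₀ := by have := lt_min hs₁.1 hs₂.1; positivity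
  have hs₀1 : s₀ < s₁ := by
    have := min_le_left s₁ s₂; rw [hs₀]; linarith [hs₁.1, lt_min hs₁.1 hs₂.1]
  have hs₀2 : s₀ < s₂ := by
    have := min_le_right s₁ s₂; rw [hs₀]; linarith [hs₂.1, lt_min hs₁.1 hs₂.1]
  have hpr : ∀ s, 0 ≤ s → s ≤ s₀ → ((projIcc (0 : ℝ) 1 zero_le_one s : unitInterval) : ℝ) = s :=
    fun s h1 h2 => by rw [projIcc_of_mem zero_le_one ⟨h1, h2.trans (hs₀1.trans hs₁.2).le⟩]
  refine ⟨fun s => μ (projIcc 0 1 zero_le_one s), c, s₀, hc, hs₀0, ?_, ?_, ?_⟩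
  · simp only [projIcc_left]
    exact (congrArg (fun ρ : ProbabilityMeasure M => (ρ : Measure M) Aᶜ) hμ.1).trans hμ₀A
  · intro s hs
    simp only
    have hprs := hpr s hs.1 hs.2
    set sI := projIcc (0 : ℝ) 1 zero_le_one s
    rcases hs.1.eq_or_lt with rfl | hspos
    · have : sI = 0 := Subtype.ext hprs
      rw [this, hμ.1]
      have : (μ₀ : Measure M).real A = 1 := by
        have := (prob_eq_one_iff_ae (π := (μ₀ : Measure M)) hA.measurableSet).2 (mem_ae_iff.2 hμ₀A)
        rw [Measure.real, this, ENNReal.toReal_one]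
      rw [this]; norm_num
    -- Jensen's inequality with weights `1 / m A` on `A` and `e⁴ / m A` outside of `A`.
    obtain ⟨hsH, hsl⟩ := hlog s ⟨hspos, hs.2.trans_lt hs₀2⟩
    have h1 := hent sI (by rw [hprs]; exact hsH)
    rw [hprs] at h1
    have hBm : MeasurableSet (A' \ A) := hA'c.measurableSet.diff hA.measurableSet
    have hBfin : m (A' \ A) ≠ ∞ := measure_ne_top_of_subset sdiff_subset hA'c.measure_ne_top
    have hnull := hA's sI (by rw [hprs]; exact hs.2.trans_lt hs₀1)
    have h2 := le_entropy (m := m) (μ := μ sI) hA.measurableSet hBm disjoint_sdiff_right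
      (by rwa [union_sdiff_cancel hAA']) ht hBfin (inv_pos.2 hmA)
      (mul_pos (Real.exp_pos 4) (inv_pos.2 hmA))
    have h3 := EReal.coe_le_coe_iff.1 (h2.trans h1)
    have h4 : (μ sI : Measure M).real (A' \ A) = 1 - (μ sI : Measure M).real A := by
      rw [← probReal_compl_eq_one_sub hA.measurableSet]
      refine measureReal_congr ?_
      filter_upwards [mem_ae_iff.2 hnull] with x hx
      exact propext ⟨fun hx' => hx'.2, fun hx' => ⟨hx, hx'⟩⟩
    have h5 : m.real (A' \ A) = m.real A' - m.real A :=
      measureReal_sdiff hAA' hA.measurableSet hA'c.measure_ne_top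
    rw [h4, Real.log_mul (Real.exp_pos 4).ne' (inv_pos.2 hmA).ne', Real.log_exp, Real.log_inv,
      inv_mul_cancel₀ hmA.ne'] at h3
    have h6 : Real.exp 4 * (m.real A)⁻¹ * m.real (A' \ A) ≤ 1 := by
      have : m.real (A' \ A) ≤ Real.exp (-4) * m.real A := by rw [h5]; linarith
      calc Real.exp 4 * (m.real A)⁻¹ * m.real (A' \ A)
          ≤ Real.exp 4 * (m.real A)⁻¹ * (Real.exp (-4) * m.real A) := by gcongr
        _ = 1 := by rw [Real.exp_neg]; field_simp
    nlinarith
  · intro s t hs hst hts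
    simp only
    have hps := hpr s hs (hst.le.trans hts)
    have hpt := hpr t (hs.trans hst.le) hts
    set sI := projIcc (0 : ℝ) 1 zero_le_one s
    set tI := projIcc (0 : ℝ) 1 zero_le_one t
    have hstI : sI < tI := by rw [← Subtype.coe_lt_coe, hps, hpt]; exact hst
    have ht1 : tI < 1 := by
      rw [← Subtype.coe_lt_coe, hpt]; exact hts.trans_lt (hs₀1.trans hs₁.2)
    obtain ⟨κ, k0, k1, k2, -, k3⟩ := hμ.exists_intermediate hL hp₀ hp₁ hA hC hμ₀A hμ₁C hstI ht1
    refine ⟨κ.map fun w => (w.1, w.2.1), by rw [map_e01_fst, k0], by rw [map_e01_snd, k1], ?_⟩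
    refine (ae_map_iff (p := fun z : M × M => L.le z.1 z.2 ∧ (t - s) * c ≤ (L.τ z.1 z.2).toReal)
      measurable_e01.aemeasurable (hL.isClosed_le.measurableSet.inter (measurableSet_le
        measurable_const hL.continuous_toReal.measurable))).2 ?_
    have e0 : ∀ᵐ w ∂κ, w.1 ∈ A' :=
      (ae_map_iff (p := fun x => x ∈ A') (f := Prod.fst) (by fun_prop) hA'c.measurableSet).1
        (by rw [k0]; exact mem_ae_iff.2 (hA's sI (by rw [hps]; exact (hst.trans_le hts).trans hs₀1)))
    have e2 : ∀ᵐ w ∂κ, w.2.2 ∈ C :=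
      (ae_map_iff (p := fun x => x ∈ C) (f := fun w : M × M × M => w.2.2) (by fun_prop)
        hC.measurableSet).1 (by rw [k2, hμ.2.1]; exact mem_ae_iff.2 hμ₁C)
    filter_upwards [k3, e0, e2] with w hw h1 h2
    refine ⟨hw.1, ?_⟩
    rw [hw.2.2.1, hps, hpt, Icc.coe_one]
    have hc' := hcτ w.1 h1 w.2.2 h2
    have hs1 : 0 < 1 - s := by linarith [hs₁.2]
    have : t - s ≤ (t - s) / (1 - s) := by
      rw [le_div_iff₀ hs1]; nlinarith
    exact mul_le_mul this hc' hc.le (by have := sub_pos.2 hst; positivity)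

/-- Compact achronal sets are negligible, as their points can be moved to the future without most of
the mass leaving the set. -/
lemma WTCD.measure_achronal (hTCD : L.WTCD m p K N) (hL : L.RegularGeometry) (hp₀ : 0 < p)
    (hp₁ : p < 1) (hN : 0 < N) {A : Set M} (hA : IsCompact A) {b : M} (hAb : ∀ x ∈ A, L.ll x b)
    (hach : ∀ x ∈ A, ∀ y ∈ A, ¬ L.ll x y) : m A = 0 := by
  by_contra h0
  obtain ⟨μ, c, s₀, hc, hs₀, hμ0, hμA, hπ⟩ := hTCD.exists_short_flow hL hp₀ hp₁ hN hA hAb h0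
  obtain ⟨π, h1, h2, h3⟩ := hπ 0 s₀ le_rfl hs₀ le_rfl
  have e1 : ∀ᵐ z ∂π, z.1 ∈ A := (ae_fst_mem_iff hA.measurableSet).1 (by
    rw [h1]; exact mem_ae_iff.2 hμ0)
  have e2 : ∀ᵐ y ∂π.snd, y ∈ Aᶜ := by
    refine (ae_snd_mem_iff hA.measurableSet.compl).2 ?_
    filter_upwards [h3, e1] with z hz hz1 hz2
    refine hach _ hz1 _ hz2 ?_
    rw [← L.τ_pos_iff]
    exact (ENNReal.toReal_pos_iff.1 ((mul_pos (sub_pos.2 hs₀) hc).trans_le hz.2)).1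
  rw [h2, ae_iff] at e2
  have h4 := hμA s₀ ⟨hs₀.le, le_rfl⟩
  simp only [mem_compl_iff, not_not, ofPred_mem_eq] at e2
  rw [Measure.real, e2] at h4
  norm_num at h4

end Transport

end LorentzianPreLengthSpace

namespace LorentzianPreLengthSpace

section Geometry

variable {M : Type*} [MetricSpace M] [ProperSpace M] {L : LorentzianPreLengthSpace M}

/-! ### Nonbranching and crossing of transport rays -/

lemma RegularGeometry.isTGeo_iff (hL : L.RegularGeometry) {γ : ℝ → M} :
    L.IsTGeo γ ↔ ContinuousOn γ (Icc 0 1) ∧ L.ll (γ 0) (γ 1) ∧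
      ∀ s ∈ Icc (0 : ℝ) 1, ∀ t ∈ Icc (0 : ℝ) 1, s < t →
        (L.τ (γ s) (γ t)).toReal = (t - s) * (L.τ (γ 0) (γ 1)).toReal := by
  constructor
  · rintro ⟨hc, h⟩
    refine ⟨hc, (L.τ_pos_iff _ _).1 (h 0 (by simp) 1 (by simp) one_pos).2, fun s hs t ht hst => ?_⟩
    rw [(h s hs t ht hst).1, ENNReal.toReal_mul, ENNReal.toReal_ofReal (sub_pos.2 hst).le]
  · rintro ⟨hc, hll, h⟩
    refine ⟨hc, fun s hs t ht hst => ?_⟩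
    have hpos := ENNReal.toReal_pos ((L.τ_pos_iff _ _).2 hll).ne' (hL.τ_ne_top _ _)
    have e : L.τ (γ s) (γ t) = ENNReal.ofReal (t - s) * L.τ (γ 0) (γ 1) := by
      rw [← ENNReal.toReal_eq_toReal_iff' (hL.τ_ne_top _ _)
        (ENNReal.mul_ne_top ENNReal.ofReal_ne_top (hL.τ_ne_top _ _)), h s hs t ht hst,
        ENNReal.toReal_mul, ENNReal.toReal_ofReal (sub_pos.2 hst).le]
    refine ⟨e, ?_⟩
    rw [e]
    exact ENNReal.mul_pos (ENNReal.ofReal_pos.2 (sub_pos.2 hst)).ne' ((L.τ_pos_iff _ _).2 hll).ne'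

lemma IsTGeo.le {γ : ℝ → M} (h : L.IsTGeo γ) {s t : ℝ}
    (hs : s ∈ Icc (0 : ℝ) 1) (ht : t ∈ Icc (0 : ℝ) 1) (hst : s ≤ t) : L.le (γ s) (γ t) := by
  rcases hst.eq_or_lt with rfl | hst
  · exact L.le_refl _
  · exact L.le_of_ll _ _ ((L.τ_pos_iff _ _).1 (h.2 s hs t ht hst).2)

lemma IsTGeo.toReal_eq (hL : L.RegularGeometry) {γ : ℝ → M} (h : L.IsTGeo γ) {s t : ℝ}
    (hs : s ∈ Icc (0 : ℝ) 1) (ht : t ∈ Icc (0 : ℝ) 1) (hst : s ≤ t) :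
    (L.τ (γ s) (γ t)).toReal = (t - s) * (L.τ (γ 0) (γ 1)).toReal := by
  rcases hst.eq_or_lt with rfl | hst
  · rw [τ_eq_zero_of_not_ll (hL.not_ll_self _)]; simp
  · exact (hL.isTGeo_iff.1 h).2.2 s hs t ht hst

/-- Two geodesics which meet at an intermediate point, concatenated and parametrized proportionally
to `τ`-arclength. -/
lemma IsTGeo.concat (hL : L.RegularGeometry) {η₀ η₁ : ℝ → M} (h₀ : L.IsTGeo η₀) (h₁ : L.IsTGeo η₁)
    (h01 : η₀ 1 = η₁ 0) {s : ℝ} (hs : s ∈ Ioo (0 : ℝ) 1)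
    (hi : L.IsIntermediate s (η₀ 0) (η₀ 1) (η₁ 1)) :
    L.IsTGeo fun t => if t ≤ s then η₀ (t / s) else η₁ ((t - s) / (1 - s)) := by
  have hs' : 0 < 1 - s := sub_pos.2 hs.2
  set γ : ℝ → M := fun t => if t ≤ s then η₀ (t / s) else η₁ ((t - s) / (1 - s)) with hγ
  have hγl : ∀ t ≤ s, γ t = η₀ (t / s) := fun t ht => if_pos ht
  have hγr : ∀ t, s ≤ t → γ t = η₁ ((t - s) / (1 - s)) := by
    intro t ht
    rcases ht.eq_or_lt with rfl | ht
    · rw [hγl _ le_rfl, div_self hs.1.ne', sub_self, zero_div, h01]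
    · exact if_neg (not_le.2 ht)
  have ml : ∀ t ∈ Icc 0 s, t / s ∈ Icc (0 : ℝ) 1 := fun t ht =>
    ⟨div_nonneg ht.1 hs.1.le, (div_le_one hs.1).2 ht.2⟩
  have mr : ∀ t ∈ Icc s 1, (t - s) / (1 - s) ∈ Icc (0 : ℝ) 1 := fun t ht =>
    ⟨div_nonneg (sub_nonneg.2 ht.1) hs'.le, (div_le_one hs').2 (by linarith [ht.2])⟩
  have hγ0 : γ 0 = η₀ 0 := by rw [hγl 0 hs.1.le, zero_div]
  have hγ1 : γ 1 = η₁ 1 := by rw [hγr 1 hs.2.le, div_self hs'.ne']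
  have hγs : γ s = η₀ 1 := by rw [hγl s le_rfl, div_self hs.1.ne']
  set a := (L.τ (η₀ 0) (η₁ 1)).toReal with ha
  have hll : L.ll (η₀ 0) (η₁ 1) :=
    ll_of_ll_of_le (hL.isTGeo_iff.1 h₀).2.1 hi.2.1
  have el : ∀ u ∈ Icc 0 s, ∀ v ∈ Icc 0 s, u ≤ v →
      L.le (γ u) (γ v) ∧ (L.τ (γ u) (γ v)).toReal = (v - u) * a := by
    intro u hu v hv huv
    rw [hγl u hu.2, hγl v hv.2]
    have hd : u / s ≤ v / s := div_le_div_of_nonneg_right huv hs.1.le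
    refine ⟨h₀.le (ml u hu) (ml v hv) hd, ?_⟩
    rw [h₀.toReal_eq hL (ml u hu) (ml v hv) hd, hi.2.2.1, ← ha]
    have := hs.1.ne'
    field_simp
  have er : ∀ u ∈ Icc s 1, ∀ v ∈ Icc s 1, u ≤ v →
      L.le (γ u) (γ v) ∧ (L.τ (γ u) (γ v)).toReal = (v - u) * a := by
    intro u hu v hv huv
    rw [hγr u hu.1, hγr v hv.1]
    have hd : (u - s) / (1 - s) ≤ (v - s) / (1 - s) :=
      div_le_div_of_nonneg_right (by linarith) hs'.le
    refine ⟨h₁.le (mr u hu) (mr v hv) hd, ?_⟩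
    rw [h₁.toReal_eq hL (mr u hu) (mr v hv) hd, ← h01, hi.2.2.2, ← ha]
    have := hs'.ne'
    field_simp
    ring
  refine hL.isTGeo_iff.2 ⟨?_, by rw [hγ0, hγ1]; exact hll, ?_⟩
  · have cl : ContinuousOn γ (Icc 0 s) := by
      refine ContinuousOn.congr (f := fun t => η₀ (t / s)) ?_ fun t ht => hγl t ht.2
      exact h₀.1.comp (by fun_prop) ml
    have cr : ContinuousOn γ (Icc s 1) := by
      refine ContinuousOn.congr (f := fun t => η₁ ((t - s) / (1 - s))) ?_ fun t ht => hγr t ht.1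
      exact h₁.1.comp (by fun_prop) mr
    rw [← Icc_union_Icc_eq_Icc hs.1.le hs.2.le]
    exact cl.union_of_isClosed cr isClosed_Icc isClosed_Icc
  · intro u hu v hv huv
    rw [hγ0, hγ1]
    rcases le_total v s with hvs | hvs
    · exact (el u ⟨hu.1, huv.le.trans hvs⟩ v ⟨hv.1, hvs⟩ huv.le).2
    rcases le_total s u with hsu | hsu
    · exact (er u ⟨hsu, hu.2⟩ v ⟨hvs, hv.2⟩ huv.le).2
    obtain ⟨a1, a2⟩ := el u ⟨hu.1, hsu⟩ s ⟨hs.1.le, le_rfl⟩ hsu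
    obtain ⟨b1, b2⟩ := er s ⟨le_rfl, hs.2.le⟩ v ⟨hvs, hv.2⟩ hvs
    obtain ⟨c1, c2⟩ := el 0 ⟨le_rfl, hs.1.le⟩ u ⟨hu.1, hsu⟩ hu.1
    obtain ⟨d1, d2⟩ := er v ⟨hvs, hv.2⟩ 1 ⟨hs.2.le, le_rfl⟩ hv.2
    have huv' := L.le_trans _ _ _ a1 b1
    -- The reverse triangle inequality bounds `τ (γ u) (γ v)` from below by passing through the
    -- meeting point, and from above by passing from `γ 0` to `γ 1` through `γ u` and `γ v`.
    have l1 := hL.toReal_add_le a1 b1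
    have l2 := hL.toReal_add_le c1 huv'
    have l3 := hL.toReal_add_le (L.le_trans _ _ _ c1 huv') d1
    rw [hγ0, hγ1, ← ha] at l3
    rw [hγ0] at l2 c2
    rw [hγ1] at d2
    linarith

/-- A point and an intermediate point determine the endpoint, by nonbranching. -/
lemma RegularGeometry.eq_of_isIntermediate (hL : L.RegularGeometry) {s : ℝ} (hs : s ∈ Ioo (0 : ℝ) 1)
    {x z y y' : M} (h : L.IsIntermediate s x z y) (h' : L.IsIntermediate s x z y') (hll : L.ll x y)
    (hll' : L.ll x y') : y = y' := by
  obtain ⟨η, hη, hη0, hη1⟩ := hL.exists_isTGeo x z (h.ll_left hL hs.1 hll)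
  obtain ⟨ζ, hζ, hζ0, hζ1⟩ := hL.exists_isTGeo z y (h.ll_right hL hs.2 hll)
  obtain ⟨ζ', hζ', hζ0', hζ1'⟩ := hL.exists_isTGeo z y' (h'.ll_right hL hs.2 hll')
  have g := hη.concat hL hζ (hη1.trans hζ0.symm) hs (by rwa [hη0, hη1, hζ1])
  have g' := hη.concat hL hζ' (hη1.trans hζ0'.symm) hs (by rwa [hη0, hη1, hζ1'])
  have := (hL.nonbranching _ _ g g').1 ⟨s, hs, fun t ht => by simp only [if_pos ht.2]⟩ 1 (by simp)
  simpa [not_le.2 hs.2, div_self (sub_pos.2 hs.2).ne', hζ1, hζ1'] using this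

end Geometry

section Transport

variable {M : Type*} [MetricSpace M] [ProperSpace M] [MeasurableSpace M] [BorelSpace M]
  {L : LorentzianPreLengthSpace M} {p : ℝ}

/-- Transport rays which cross at the same intermediate time have the same endpoint: exchanging the
endpoints does not increase the cost, which by strict concavity forces the rays to have equal length
and the exchanged rays to be maximal. -/
lemma TimelikeMonotone.eq_of_isIntermediate (hL : L.RegularGeometry) (hp₀ : 0 < p) (hp₁ : p < 1)
    {S : Set (M × M)} (hS : L.TimelikeMonotone p S) {s : ℝ} (hs : s ∈ Ioo (0 : ℝ) 1)
    {x z y x' y' : M} (hxy : (x, y) ∈ S) (hxy' : (x', y') ∈ S) (hll : L.ll x y) (hll' : L.ll x' y')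
    (h : L.IsIntermediate s x z y) (h' : L.IsIntermediate s x' z y') : y = y' := by
  have h1 : L.ll x y' := ll_of_ll_of_le (h.ll_left hL hs.1 hll) h'.2.1
  have h2 : L.ll x' y := ll_of_ll_of_le (h'.ll_left hL hs.1 hll') h.2.1
  have hmono := hS Bool (fun i => cond i (x, y) (x', y')) Equiv.boolNot
    (fun i => by cases i <;> simpa) (fun i => by cases i <;> simpa)
  simp only [Fintype.sum_bool, Equiv.boolNot_apply, Bool.not_true, Bool.not_false, cond_true,
    cond_false, realCost] at hmono
  set a := (L.τ x y).toReal with ha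
  set a' := (L.τ x' y').toReal with ha'
  have ha0 : 0 < a := ENNReal.toReal_pos ((L.τ_pos_iff _ _).2 hll).ne' (hL.τ_ne_top _ _)
  have ha0' : 0 < a' := ENNReal.toReal_pos ((L.τ_pos_iff _ _).2 hll').ne' (hL.τ_ne_top _ _)
  have l1 : s * a + (1 - s) * a' ≤ (L.τ x y').toReal := by
    have := hL.toReal_add_le h.1 h'.2.1
    rwa [h.2.2.1, h'.2.2.2] at this
  have l2 : s * a' + (1 - s) * a ≤ (L.τ x' y).toReal := by
    have := hL.toReal_add_le h'.1 h.2.1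
    rwa [h'.2.2.1, h.2.2.2] at this
  have hs' : 0 < 1 - s := sub_pos.2 hs.2
  have p1 := Real.rpow_le_rpow
    (add_nonneg (mul_nonneg hs.1.le ha0.le) (mul_nonneg hs'.le ha0'.le)) l1 hp₀.le
  have p2 := Real.rpow_le_rpow
    (add_nonneg (mul_nonneg hs.1.le ha0'.le) (mul_nonneg hs'.le ha0.le)) l2 hp₀.le
  have c1 := rpow_concave hp₀ hp₁ hs ha0.le ha0'.le
  have c2 := rpow_concave hp₀ hp₁ hs ha0'.le ha0.le
  -- Strict concavity gives equal lengths, and then `y'` also prolongs the ray from `x` to `z`.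
  have haa : a = a' := eq_of_rpow_concave_eq hp₀ hp₁ hs ha0.le ha0'.le (by linarith)
  have hxy'' : (L.τ x y').toReal = a := by
    rw [← haa] at l1 p2 c2 hmono
    refine le_antisymm ?_ (by linarith)
    refine (Real.rpow_le_rpow_iff ENNReal.toReal_nonneg ha0.le hp₀).1 ?_
    linarith
  refine hL.eq_of_isIntermediate hs h ⟨h.1, h'.2.1, ?_, ?_⟩ hll h1
  · rw [hxy'']; exact h.2.2.1
  · rw [hxy'', haa]; exact h'.2.2.2

lemma IsMaximal.totalCost_eq {π σ : Measure (M × M)} (hπ : L.IsMaximal p π) (hσ : L.IsMaximal p σ)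
    (h1 : σ.fst = π.fst) (h2 : σ.snd = π.snd) : L.totalCost p σ = L.totalCost p π :=
  le_antisymm (hπ.2 σ h1 h2 hσ.1) (hσ.2 π h1.symm h2.symm hπ.1)

lemma IsMaximal.of_totalCost_le {π σ : Measure (M × M)} (hπ : L.IsMaximal p π)
    (h1 : σ.fst = π.fst) (h2 : σ.snd = π.snd) (hσ : ∀ᵐ z ∂σ, L.le z.1 z.2)
    (hle : L.totalCost p π ≤ L.totalCost p σ) : L.IsMaximal p σ :=
  ⟨hσ, fun ρ e1 e2 e3 => (hπ.2 ρ (e1.trans h1) (e2.trans h2) e3).trans hle⟩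

lemma IsMaximal.add {π σ : Measure (M × M)} (hπ : L.IsMaximal p π) (hσ : L.IsMaximal p σ)
    (h1 : σ.fst = π.fst) (h2 : σ.snd = π.snd) : L.IsMaximal p (π + σ) := by
  refine (hπ.smul (c := 2) two_ne_zero (by simp)).of_totalCost_le ?_ ?_
    (ae_add_measure_iff.2 ⟨hπ.1, hσ.1⟩) ?_
  · rw [fst_add', fst_smul', h1, two_smul]
  · rw [snd_add', snd_smul', h2, two_smul]
  · rw [totalCost_add, totalCost_smul, hπ.totalCost_eq hσ h1 h2, two_mul]

lemma map_withDensity_comp {X Y : Type*} [MeasurableSpace X] [MeasurableSpace Y] {μ : Measure X}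
    {f : X → Y} (hf : Measurable f) {h : Y → ℝ≥0∞} (hh : Measurable h) :
    (μ.withDensity (h ∘ f)).map f = (μ.map f).withDensity h := by
  ext s hs
  rw [Measure.map_apply hf hs, withDensity_apply _ (hf hs), withDensity_apply _ hs,
    setLIntegral_map hs hh hf]
  rfl

variable {m : Measure M} [m.Regular] [m.IsOpenPosMeasure] {K N : ℝ}

/-- If two monotone couplings send the same mass of a compact set `A` to disjoint compact sets,
their transport rays would have to fill disjoint sets of almost full measure at small times. -/
lemma WTCD.not_disjoint_targets (hTCD : L.WTCD m p K N) (hL : L.RegularGeometry) (hp₀ : 0 < p)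
    (hp₁ : p < 1) (hN : 0 < N) {A B B' : Set M} (hA : IsCompact A) (hB : IsCompact B)
    (hB' : IsCompact B') (hBB' : Disjoint B B') (hAB : ∀ x ∈ A, ∀ y ∈ B ∪ B', L.ll x y)
    (h0 : m A ≠ 0) {S : Set (M × M)} (hS : L.TimelikeMonotone p S) {σ σ' : Measure (M × M)}
    (h1 : σ.fst = uniformOn m A h0 hA.measure_ne_top)
    (h1' : σ'.fst = uniformOn m A h0 hA.measure_ne_top) (hσ : ∀ᵐ z ∂σ, z ∈ S ∩ A ×ˢ B)
    (hσ' : ∀ᵐ z ∂σ', z ∈ S ∩ A ×ˢ B') : False := by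
  have hmA : 0 < m.real A := ENNReal.toReal_pos h0 hA.measure_ne_top
  have hC := hB.union hB'
  have : IsProbabilityMeasure σ := isProbabilityMeasure_of_fst h1
  have : IsProbabilityMeasure σ' := isProbabilityMeasure_of_fst h1'
  set Γ := S ∩ A ×ˢ (B ∪ B') with hΓ
  have hΓm : L.TimelikeMonotone p Γ := hS.mono inter_subset_left
  have hσΓ : ∀ᵐ z ∂σ, z ∈ Γ := hσ.mono fun z hz => ⟨hz.1, hz.2.1, Or.inl hz.2.2⟩
  have hσΓ' : ∀ᵐ z ∂σ', z ∈ Γ := hσ'.mono fun z hz => ⟨hz.1, hz.2.1, Or.inr hz.2.2⟩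
  have hmax : L.IsMaximal p σ := hΓm.isMaximal hL hp₀ hA hC hAB inter_subset_right hσΓ
  have hmax' : L.IsMaximal p σ' := hΓm.isMaximal hL hp₀ hA hC hAB inter_subset_right hσΓ'
  have hsum : L.IsMaximal p (σ + σ') :=
    hΓm.isMaximal hL hp₀ hA hC hAB inter_subset_right (ae_add_measure_iff.2 ⟨hσΓ, hσΓ'⟩)
  have hs2 : σ.snd Bᶜ = 0 := mem_ae_iff.1 ((ae_snd_mem_iff hB.measurableSet).2
    (hσ.mono fun z hz => hz.2.2))
  have hs2' : σ'.snd B'ᶜ = 0 := mem_ae_iff.1 ((ae_snd_mem_iff hB'.measurableSet).2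
    (hσ'.mono fun z hz => hz.2.2))
  -- A neighbourhood of `A` of measure less than `5 / 4 * m A`.
  obtain ⟨ε, hε0, hεm⟩ : ∃ ε > 0, m.real (Metric.cthickening ε A) < 5 / 4 * m.real A := by
    have hlim : Tendsto (fun ε => m.real (Metric.cthickening ε A)) (𝓝[>] (0 : ℝ)) (𝓝 (m.real A)) :=
      tendsto_nhdsWithin_of_tendsto_nhds ((ENNReal.tendsto_toReal hA.measure_ne_top).comp
        (tendsto_measure_cthickening_of_isCompact hA))
    obtain ⟨ε, h1, h2⟩ := ((hlim.eventually_lt_const (u := 5 / 4 * m.real A) (by linarith)).and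
      self_mem_nhdsWithin).exists
    exact ⟨ε, h2, h1⟩
  obtain ⟨s₁, hs₁, hdist⟩ := hL.dist_lt_of_isIntermediate hA hC hAB hε0
  obtain ⟨s₂, hs₂, hlarge⟩ := hTCD.exists_intermediate_large hL hp₀ hp₁ hN hA hC hAB h0
    (δ := 1 / 4) (by norm_num)
  set s := min s₁ s₂ / 2 with hs
  have hmin : 0 < min s₁ s₂ := lt_min hs₁.1 hs₂.1
  have hs0 : 0 < s := by positivity
  have hss₁ : s < s₁ := by have := min_le_left s₁ s₂; rw [hs]; linarith
  have hss₂ : s < s₂ := by have := min_le_right s₁ s₂; rw [hs]; linarith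
  have hsI : s ∈ Ioo (0 : ℝ) 1 := ⟨hs0, hss₁.trans hs₁.2⟩
  obtain ⟨κ, k0, k2, kmax, kint, kZ⟩ := hlarge s ⟨hs0, hss₂⟩ ⟨σ.snd, inferInstance⟩
    (measure_mono_null (compl_subset_compl.2 subset_union_left) hs2)
  obtain ⟨κ', k0', k2', kmax', kint', kZ'⟩ := hlarge s ⟨hs0, hss₂⟩ ⟨σ'.snd, inferInstance⟩
    (measure_mono_null (compl_subset_compl.2 subset_union_right) hs2')
  simp only [ProbabilityMeasure.coe_mk] at k2 k2'
  have e1 : (κ.map fun w => (w.1, w.2.2)).fst = σ.fst := by rw [map_e02_fst, k0, h1]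
  have e2 : (κ.map fun w => (w.1, w.2.2)).snd = σ.snd := by rw [map_e02_snd, k2]
  have e1' : (κ'.map fun w => (w.1, w.2.2)).fst = σ'.fst := by rw [map_e02_fst, k0', h1']
  have e2' : (κ'.map fun w => (w.1, w.2.2)).snd = σ'.snd := by rw [map_e02_snd, k2']
  -- The rays provided by the curvature condition need not be those of `σ` and `σ'`, but they have
  -- the same total cost. Hence they are jointly maximal, and do not cross.
  set ω := (κ.map fun w => (w.1, w.2.2)) + κ'.map fun w => (w.1, w.2.2) with hω
  have hωmax : L.IsMaximal p ω := by
    refine hsum.of_totalCost_le ?_ ?_ (ae_add_measure_iff.2 ⟨kmax.1, kmax'.1⟩) ?_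
    · rw [hω, fst_add', fst_add', e1, e1']
    · rw [hω, snd_add', snd_add', e2, e2']
    · rw [hω, totalCost_add, totalCost_add, hmax.totalCost_eq kmax e1 e2,
        hmax'.totalCost_eq kmax' e1' e2']
  have kA : ∀ᵐ w ∂κ, w.1 ∈ A := (ae_map_iff (p := fun x => x ∈ A) (f := Prod.fst) (by fun_prop)
    hA.measurableSet).1 (by rw [k0]; exact mem_ae_iff.2 (uniformOn_compl hA.measurableSet _ _))
  have kA' : ∀ᵐ w ∂κ', w.1 ∈ A := (ae_map_iff (p := fun x => x ∈ A) (f := Prod.fst) (by fun_prop)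
    hA.measurableSet).1 (by rw [k0']; exact mem_ae_iff.2 (uniformOn_compl hA.measurableSet _ _))
  have kB : ∀ᵐ w ∂κ, w.2.2 ∈ B := (ae_map_iff (p := fun x => x ∈ B) (f := fun w : M × M × M => w.2.2)
    (by fun_prop) hB.measurableSet).1 (by rw [k2]; exact mem_ae_iff.2 hs2)
  have kB' : ∀ᵐ w ∂κ', w.2.2 ∈ B' := (ae_map_iff (p := fun x => x ∈ B')
    (f := fun w : M × M × M => w.2.2) (by fun_prop) hB'.measurableSet).1
    (by rw [k2']; exact mem_ae_iff.2 hs2')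
  have ip : IsProbabilityMeasure κ := isProbabilityMeasure_of_fst k0
  have ip' : IsProbabilityMeasure κ' := isProbabilityMeasure_of_fst k0'
  have hωfin : IsFiniteMeasure ω := by rw [hω]; infer_instance
  have hωAC : ∀ᵐ z ∂ω, z.1 ∈ A ∧ z.2 ∈ B ∪ B' := by
    have hm : MeasurableSet {z : M × M | z.1 ∈ A ∧ z.2 ∈ B ∪ B'} :=
      hA.measurableSet.prod hC.measurableSet
    refine ae_add_measure_iff.2 ⟨(ae_map_iff (p := fun z : M × M => z.1 ∈ A ∧ z.2 ∈ B ∪ B')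
      measurable_e02.aemeasurable hm).2 ?_, (ae_map_iff (p := fun z : M × M => z.1 ∈ A ∧ z.2 ∈ B ∪ B')
      measurable_e02.aemeasurable hm).2 ?_⟩
    · filter_upwards [kA, kB] with w h1 h2 using ⟨h1, Or.inl h2⟩
    · filter_upwards [kA', kB'] with w h1 h2 using ⟨h1, Or.inr h2⟩
  have hωmono := hωmax.timelikeMonotone_support hL hp₀ (hL.totalCost_ne_top hp₀ hA hC hωAC)
  have hωs := ae_add_measure_iff.1 (ae_mem_support ω)
  have kS : ∀ᵐ w ∂κ, (w.1, w.2.2) ∈ ω.support :=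
    (ae_map_iff (p := fun z => z ∈ ω.support) measurable_e02.aemeasurable
      Measure.isClosed_support.measurableSet).1 hωs.1
  have kS' : ∀ᵐ w ∂κ', (w.1, w.2.2) ∈ ω.support :=
    (ae_map_iff (p := fun z => z ∈ ω.support) measurable_e02.aemeasurable
      Measure.isClosed_support.measurableSet).1 hωs.2
  set J := L.causalDiamond A (B ∪ B') with hJ
  have hJc : IsCompact J := hL.isCompact_diamond _ _ hA hC
  -- The intermediate points of rays ending in `E`.
  set R : Set M → Set (M × M × M) := fun E => {w | (w.1, w.2.2) ∈ ω.support} ∩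
    {w | L.IsIntermediate s w.1 w.2.1 w.2.2} ∩ A ×ˢ J ×ˢ E with hR
  have hRc : ∀ E, IsCompact E → IsCompact (R E) := fun E hE =>
    (hA.prod (hJc.prod hE)).inter_left ((Measure.isClosed_support.preimage
      (by fun_prop : Continuous fun w : M × M × M => (w.1, w.2.2))).inter
      (hL.isClosed_isIntermediate_right s))
  set Z : Set M → Set M := fun E => (fun w : M × M × M => w.2.1) '' R E with hZ
  have hZc : ∀ E, IsCompact E → IsCompact (Z E) := fun E hE => (hRc E hE).image (by fun_prop)
  have hZA : ∀ E ⊆ B ∪ B', Z E ⊆ Metric.cthickening ε A := by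
    rintro E hE _ ⟨w, ⟨⟨-, hw⟩, hwA, -, hwE⟩, rfl⟩
    refine Metric.mem_cthickening_of_dist_le _ w.1 ε A hwA ?_
    rw [dist_comm]
    exact (hdist s ⟨hs0, hss₁⟩ w.1 hwA w.2.2 (hE hwE) w.2.1 hw).le
  have hdisj : Disjoint (Z B) (Z B') := by
    rw [Set.disjoint_left]
    rintro _ ⟨w, ⟨⟨hw1, hw2⟩, hw3⟩, rfl⟩ ⟨w', ⟨⟨hw1', hw2'⟩, hw3'⟩, he⟩
    have he : w'.2.1 = w.2.1 := he
    have hw2' : L.IsIntermediate s w'.1 w.2.1 w'.2.2 := he ▸ hw2'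
    have := hωmono.eq_of_isIntermediate hL hp₀ hp₁ hsI hw1 hw1'
      (hAB _ hw3.1 _ (Or.inl hw3.2.2)) (hAB _ hw3'.1 _ (Or.inr hw3'.2.2)) hw2 hw2'
    exact Set.disjoint_left.1 hBB' hw3.2.2 (this ▸ hw3'.2.2)
  have l1 := kZ (Z B) (hZc B hB) (by
    filter_upwards [kA, kB, kS, kint] with w a1 a2 a3 a4
    exact ⟨w, ⟨⟨a3, a4⟩, a1, ⟨⟨w.1, a1, a4.1⟩, w.2.2, Or.inl a2, a4.2.1⟩, a2⟩, rfl⟩)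
  have l2 := kZ' (Z B') (hZc B' hB') (by
    filter_upwards [kA', kB', kS', kint'] with w a1 a2 a3 a4
    exact ⟨w, ⟨⟨a3, a4⟩, a1, ⟨⟨w.1, a1, a4.1⟩, w.2.2, Or.inr a2, a4.2.1⟩, a2⟩, rfl⟩)
  have l3 : m.real (Z B) + m.real (Z B') ≤ m.real (Metric.cthickening ε A) := by
    rw [← measureReal_union hdisj (hZc B' hB').measurableSet (hZc B hB).measure_ne_top
      (hZc B' hB').measure_ne_top]
    exact measureReal_mono (union_subset (hZA B subset_union_left) (hZA B' subset_union_right))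
      hA.cthickening.measure_ne_top
  -- Two disjoint sets of measure at least `3 / 4 * m A` do not fit into one of `5 / 4 * m A`.
  have l4 : (3 : ℝ) / 4 ≤ Real.exp (-(1 / 4)) := by
    have := Real.add_one_le_exp (-(1 / 4) : ℝ); linarith
  nlinarith

/-- Couplings carried by a common monotone set of chronologically related pairs, with a common
absolutely continuous first marginal, coincide. -/
lemma WTCD.coupling_unique (hTCD : L.WTCD m p K N) (hL : L.RegularGeometry) (hp₀ : 0 < p)
    (hp₁ : p < 1) (hN : 0 < N) {σ σ' : Measure (M × M)} [IsProbabilityMeasure σ]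
    [IsProbabilityMeasure σ'] (h1 : σ.fst = σ'.fst) (hac : σ.fst ≪ m) {S : Set (M × M)}
    (hScl : IsClosed S)
    (hS : L.TimelikeMonotone p S) (hσ : ∀ᵐ z ∂σ, z ∈ S ∧ L.ll z.1 z.2)
    (hσ' : ∀ᵐ z ∂σ', z ∈ S ∧ L.ll z.1 z.2) : σ = σ' := by
  have : Nonempty (M × M) := nonempty_of_isProbabilityMeasure σ
  have : Nonempty M := this.map Prod.fst
  -- Glue along the common first marginal: a triple is a source in the middle of two targets.
  have hfin : IsProbabilityMeasure (σ.map Prod.swap) :=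
    Measure.isProbabilityMeasure_map (by fun_prop)
  obtain ⟨κ, k1, k2⟩ := exists_gluing (σ.map Prod.swap) σ' (by rw [Measure.snd_map_swap, h1])
  have kp : IsProbabilityMeasure κ := by
    have : IsProbabilityMeasure (κ.map Prod.snd) := by rw [k2]; infer_instance
    exact Measure.isProbabilityMeasure_of_map Prod.snd
  have kσ : κ.map (fun w => (w.2.1, w.1)) = σ := by
    have := congrArg (Measure.map Prod.swap) k1
    rw [Measure.map_map (by fun_prop) (by fun_prop), Measure.map_map (by fun_prop) (by fun_prop),
      Prod.swap_swap_eq, Measure.map_id] at this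
    exact this
  have h10 : Measurable fun w : M × M × M => (w.2.1, w.1) := by fun_prop
  have c1 : ∀ᵐ w ∂κ, (w.2.1, w.1) ∈ S ∧ L.ll w.2.1 w.1 := by
    rw [← kσ] at hσ
    exact ae_of_ae_map h10.aemeasurable hσ
  have c2 : ∀ᵐ w ∂κ, w.2 ∈ S ∧ L.ll w.2.1 w.2.2 := by
    rw [← k2] at hσ'
    exact ae_of_ae_map measurable_snd.aemeasurable hσ'
  by_contra hne
  have hdiag : ¬ ∀ᵐ w ∂κ, w.1 = w.2.2 := by
    intro h
    refine hne ?_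
    rw [← kσ, ← k2]
    refine Measure.map_congr ?_
    filter_upwards [h] with w hw
    rw [hw]
  -- A point of the support of `κ` with distinct targets.
  obtain ⟨w, hws, hw1, hw2, hw3⟩ : ∃ w ∈ κ.support, L.ll w.2.1 w.1 ∧ L.ll w.2.1 w.2.2 ∧
      w.1 ≠ w.2.2 := by
    by_contra hc
    push Not at hc
    refine hdiag ?_
    filter_upwards [c1, c2, ae_mem_support κ] with w a1 a2 a3 using hc w a3 a1.2 a2.2
  obtain ⟨r, hr, hrll⟩ := exists_cthickening_chronological (isCompact_singleton (x := w.2.1))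
    (C := {w.1, w.2.2}) ((Set.toFinite _).isCompact) (by
      rintro x rfl y (rfl | rfl)
      · exact hw1
      · exact hw2)
  set ρ := min r (dist w.1 w.2.2 / 3) with hρ
  have hd : 0 < dist w.1 w.2.2 := dist_pos.2 hw3
  have hρ0 : 0 < ρ := lt_min hr (by positivity)
  set B := Metric.closedBall w.1 ρ with hB
  set U := Metric.closedBall w.2.1 ρ with hU
  set B' := Metric.closedBall w.2.2 ρ with hB'
  have hBB' : Disjoint B B' := by
    refine Metric.closedBall_disjoint_closedBall ?_
    have := min_le_right r (dist w.1 w.2.2 / 3)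
    linarith
  have hUB : ∀ x ∈ U, ∀ y ∈ B ∪ B', L.ll x y := by
    intro x hx y hy
    refine hrll x ?_ y ?_
    · exact Metric.mem_cthickening_of_dist_le _ w.2.1 _ _ rfl (hx.trans (min_le_left _ _))
    · rcases hy with hy | hy
      · exact Metric.mem_cthickening_of_dist_le _ w.1 _ _ (Or.inl rfl) (hy.trans (min_le_left _ _))
      · exact Metric.mem_cthickening_of_dist_le _ w.2.2 _ _ (Or.inr rfl)
          (hy.trans (min_le_left _ _))
  set Q : Set (M × M × M) := B ×ˢ U ×ˢ B' with hQ
  have hQm : MeasurableSet Q := (Metric.isClosed_closedBall.prod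
    (Metric.isClosed_closedBall.prod Metric.isClosed_closedBall)).measurableSet
  have hQ0 : κ Q ≠ 0 := by
    refine ((Measure.mem_support_iff_forall w).1 hws Q ?_).ne'
    exact prod_mem_nhds (Metric.closedBall_mem_nhds _ hρ0)
      (prod_mem_nhds (Metric.closedBall_mem_nhds _ hρ0) (Metric.closedBall_mem_nhds _ hρ0))
  have hmid : Measurable fun w : M × M × M => w.2.1 := by fun_prop
  set θ := (κ.restrict Q).map fun w => w.2.1 with hθ
  have hθac : θ ≪ m := by
    have e : κ.map (fun w => w.2.1) = σ.fst := by
      rw [← kσ, Measure.fst, Measure.map_map measurable_fst (by fun_prop)]; rfl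
    rw [← e] at hac
    exact (Measure.absolutelyContinuous_of_le (Measure.map_mono Measure.restrict_le_self hmid)).trans
      hac
  have hθU : θ Uᶜ = 0 := by
    rw [← mem_ae_iff]
    refine (ae_map_iff (p := fun x => x ∈ U) hmid.aemeasurable
      Metric.isClosed_closedBall.measurableSet).2 ?_
    filter_upwards [ae_restrict_mem hQm] with w hw using hw.2.1
  have hθ0 : θ ≠ 0 := by
    rw [hθ, Ne, Measure.map_eq_zero_iff hmid.aemeasurable, Measure.restrict_eq_zero]
    exact hQ0
  set g := θ.rnDeriv m with hg
  have hgm : Measurable g := Measure.measurable_rnDeriv θ m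
  have hθg : m.withDensity g = θ := Measure.withDensity_rnDeriv_eq θ m hθac
  -- A compact subset of `U` of positive measure on which the density of `θ` is positive.
  have hGm : MeasurableSet ({x | 0 < g x ∧ g x < ∞} ∩ U) :=
    ((measurableSet_lt measurable_const hgm).inter (measurableSet_lt hgm measurable_const)).inter
      Metric.isClosed_closedBall.measurableSet
  have hUc : IsCompact U := isCompact_closedBall _ _
  have hG0 : m ({x | 0 < g x ∧ g x < ∞} ∩ U) ≠ 0 := by
    intro h0
    refine hθ0 ?_
    have h1 : ∀ᵐ x ∂θ, x ∉ {x | 0 < g x ∧ g x < ∞} ∩ U :=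
      hθac (measure_eq_zero_iff_ae_notMem.1 h0)
    have h2 : ∀ᵐ x ∂θ, 0 < g x := Measure.rnDeriv_pos hθac
    have h3 : ∀ᵐ x ∂θ, g x < ∞ := hθac.ae_le (Measure.rnDeriv_lt_top θ m)
    have h4 : ∀ᵐ x ∂θ, False := by
      filter_upwards [h1, h2, h3, mem_ae_iff.2 hθU] with x a1 a2 a3 a4 using a1 ⟨⟨a2, a3⟩, a4⟩
    simpa using h4
  obtain ⟨A, hAG, hA, hA0⟩ := hGm.exists_lt_isCompact_of_ne_top
    (measure_ne_top_of_subset inter_subset_right hUc.measure_ne_top) (pos_iff_ne_zero.2 hG0)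
  have hmA0 : m A ≠ 0 := hA0.ne'
  -- Reweighting `κ` so that the middle marginal becomes uniform on `A`.
  set h : M → ℝ≥0∞ := A.indicator fun x => (m A)⁻¹ * (g x)⁻¹ with hh
  have hhm : Measurable h := (hgm.inv.const_mul _).indicator hA.measurableSet
  set κ' := (κ.restrict Q).withDensity (h ∘ fun w => w.2.1) with hκ'
  have hmidκ' : κ'.map (fun w => w.2.1) = uniformOn m A hmA0 hA.measure_ne_top := by
    rw [hκ', map_withDensity_comp hmid hhm, ← hθ, ← hθg, ← withDensity_mul _ hgm hhm, coe_uniformOn,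
      ← withDensity_indicator_one hA.measurableSet, ← withDensity_smul _ (measurable_one.indicator
        hA.measurableSet)]
    congr 1
    funext x
    by_cases hx : x ∈ A
    · have hgx := (hAG hx).1
      simp only [hh, Pi.mul_apply, indicator_of_mem hx, Pi.smul_apply, Pi.one_apply, smul_eq_mul,
        mul_one]
      rw [mul_left_comm, ENNReal.mul_inv_cancel hgx.1.ne' hgx.2.ne, mul_one]
    · simp [hh, hx]
  have hκ'ac : κ' ≪ κ.restrict Q := withDensity_absolutelyContinuous _ _
  have hκ'κ : κ' ≪ κ := hκ'ac.trans Measure.absolutelyContinuous_restrict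
  have dQ : ∀ᵐ w ∂κ', w ∈ Q := hκ'ac.ae_le (ae_restrict_mem hQm)
  have dA : ∀ᵐ w ∂κ', w.2.1 ∈ A := (ae_map_iff (p := fun x => x ∈ A) hmid.aemeasurable
    hA.measurableSet).1 (by rw [hmidκ']; exact mem_ae_iff.2 (uniformOn_compl hA.measurableSet _ _))
  have d1 := hκ'κ.ae_le c1
  have d2 := hκ'κ.ae_le c2
  refine hTCD.not_disjoint_targets hL hp₀ hp₁ hN hA (isCompact_closedBall w.1 ρ)
    (isCompact_closedBall w.2.2 ρ) hBB' (fun x hx => hUB x (hAG hx).2) hmA0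
    hS
    (σ := κ'.map fun w => (w.2.1, w.1)) (σ' := κ'.map Prod.snd) ?_ ?_ ?_ ?_
  · rw [Measure.fst, Measure.map_map measurable_fst (by fun_prop)]
    exact hmidκ'
  · rw [map_snd_fst]
    exact hmidκ'
  · refine (ae_map_iff (p := fun z => z ∈ S ∩ A ×ˢ B) h10.aemeasurable
      (hScl.measurableSet.inter (hA.measurableSet.prod Metric.isClosed_closedBall.measurableSet))).2 ?_
    filter_upwards [d1, dA, dQ] with w a1 a2 a3 using ⟨a1.1, a2, a3.1⟩
  · refine (ae_map_iff (p := fun z => z ∈ S ∩ A ×ˢ B') measurable_snd.aemeasurable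
      (hScl.measurableSet.inter (hA.measurableSet.prod Metric.isClosed_closedBall.measurableSet))).2 ?_
    filter_upwards [d2, dA, dQ] with w a1 a2 a3 using ⟨a1.1, a2, a3.2.2⟩

end Transport

end LorentzianPreLengthSpace

namespace LorentzianPreLengthSpace

section Transport

variable {M : Type*} [MetricSpace M] [ProperSpace M] [MeasurableSpace M] [BorelSpace M]
  {L : LorentzianPreLengthSpace M} {p : ℝ}

/-! ### Maximal couplings do not charge null pairs -/

lemma RegularGeometry.realCost_mono (hL : L.RegularGeometry) (hp : 0 < p) {x z y : M}
    (h₁ : L.le x z) (h₂ : L.le z y) :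
    L.realCost p x z ≤ L.realCost p x y ∧ L.realCost p z y ≤ L.realCost p x y := by
  have h := hL.toReal_add_le h₁ h₂
  have h1 : 0 ≤ (L.τ x z).toReal := ENNReal.toReal_nonneg
  have h2 : 0 ≤ (L.τ z y).toReal := ENNReal.toReal_nonneg
  exact ⟨Real.rpow_le_rpow h1 (by linarith) hp.le, Real.rpow_le_rpow h2 (by linarith) hp.le⟩

/-- If the points of `T` belong both to null pairs and to timelike pairs of a monotone set, then
there is a function, bounded on `T`, which decreases along the chronological order, and does so at a
definite rate upon arrival in `T`. Its value at `x` is the supremum of the costs of the chains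
which start from `x` and proceed along null pairs. -/
lemma TimelikeMonotone.exists_height (hL : L.RegularGeometry) (hp : 0 < p) {S : Set (M × M)}
    (hS : L.TimelikeMonotone p S) (hSle : ∀ z ∈ S, L.le z.1 z.2) {T V : Set M} (hT : IsCompact T)
    (hV : IsCompact V) (hTV : ∀ x ∈ T, ∀ y ∈ V, L.ll x y)
    (hnull : ∀ x ∈ T, ∃ y, (x, y) ∈ S ∧ ¬ L.ll x y) (hll : ∀ x ∈ T, ∃ y ∈ V, (x, y) ∈ S) :
    ∃ (f : M → ℝ≥0∞) (D : ℝ), Measurable f ∧ (∀ x ∈ T, f x ≤ ENNReal.ofReal D) ∧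
      (∀ x x', L.ll x x' → f x' ≤ f x) ∧
      ∀ x x', L.ll x x' → x' ∈ T → ENNReal.ofReal (L.realCost p x x') + f x' ≤ f x := by
  classical
  obtain ⟨D, -, hD⟩ := hL.exists_cost_bound hp hT hV
  -- Chains of null pairs. The indicator is needed since `realCost` is `0`, and not `-∞`, on pairs
  -- which are not chronologically related.
  set I := {nw : ℕ × (ℕ → M × M) // (∀ i, nw.2 i ∈ S ∧ (nw.2 i).1 ∈ T ∧
    ¬ L.ll (nw.2 i).1 (nw.2 i).2) ∧ ∀ i < nw.1, L.ll (nw.2 (i + 1)).1 (nw.2 i).2} with hI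
  set R : I → ℝ := fun k => ∑ i ∈ Finset.range k.1.1,
    L.realCost p (k.1.2 (i + 1)).1 (k.1.2 i).2 with hR
  set b : I → M := fun k => (k.1.2 k.1.1).2 with hb
  have hR0 : ∀ k, 0 ≤ R k := fun k => Finset.sum_nonneg fun i _ => realCost_nonneg _ _
  set f : M → ℝ≥0∞ := fun x => ⨆ k, (ENNReal.ofReal (L.realCost p x (b k)) +
    {x | L.ll x (b k)}.indicator (fun _ => ENNReal.ofReal (R k)) x) with hf
  have hterm : ∀ k x, L.ll x (b k) → (ENNReal.ofReal (L.realCost p x (b k)) +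
      {x | L.ll x (b k)}.indicator (fun _ => ENNReal.ofReal (R k)) x) =
      ENNReal.ofReal (L.realCost p x (b k) + R k) := by
    intro k x hx
    rw [indicator_of_mem (show x ∈ {x | L.ll x (b k)} from hx),
      ENNReal.ofReal_add (realCost_nonneg _ _) (hR0 k)]
  have hterm0 : ∀ k x, ¬ L.ll x (b k) → (ENNReal.ofReal (L.realCost p x (b k)) +
      {x | L.ll x (b k)}.indicator (fun _ => ENNReal.ofReal (R k)) x) = 0 := by
    intro k x hx
    rw [indicator_of_notMem (show x ∉ {x | L.ll x (b k)} from hx),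
      RegularGeometry.realCost_eq_zero hp hx]
    simp
  have hle : ∀ {x : M} {B : ℝ≥0∞}, (∀ k, L.ll x (b k) → ENNReal.ofReal
      (L.realCost p x (b k) + R k) ≤ B) → f x ≤ B := by
    intro x B h
    refine iSup_le fun k => ?_
    by_cases hx : L.ll x (b k)
    · rw [hterm k x hx]; exact h k hx
    · rw [hterm0 k x hx]; exact zero_le
  have hge : ∀ {x : M} k, L.ll x (b k) → ENNReal.ofReal (L.realCost p x (b k) + R k) ≤ f x := by
    intro x k hx
    rw [← hterm k x hx]
    exact le_iSup (fun k => (ENNReal.ofReal (L.realCost p x (b k)) +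
      {x | L.ll x (b k)}.indicator (fun _ => ENNReal.ofReal (R k)) x)) k
  refine ⟨f, D, LowerSemicontinuous.measurable ?_, ?_, ?_, ?_⟩
  · refine lowerSemicontinuous_iSup fun k => LowerSemicontinuous.add ?_ ?_
    · exact (ENNReal.continuous_ofReal.comp ((hL.continuous_realCost hp).comp
        (continuous_id.prodMk continuous_const))).lowerSemicontinuous
    · exact IsOpen.lowerSemicontinuous_indicator
        ((isOpen_ll L).preimage (continuous_id.prodMk continuous_const)) zero_le
  · -- The chain is closed by the timelike pair starting from `x`.
    intro x hx
    refine hle fun k hxk => ENNReal.ofReal_le_ofReal ?_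
    obtain ⟨y, hy, hxy⟩ := hll x hx
    set w : ℕ → M × M := fun i => if i ≤ k.1.1 then k.1.2 i else (x, y) with hw
    have hwk : ∀ i ≤ k.1.1, w i = k.1.2 i := fun i hi => if_pos hi
    have hwl : w (k.1.1 + 1) = (x, y) := if_neg (by omega)
    have := hS.chain (k.1.1 + 1) w (fun i hi => by
        rcases Nat.lt_or_ge k.1.1 i with h | h
        · rw [show i = k.1.1 + 1 by omega, hwl]; exact hxy
        · rw [hwk i h]; exact (k.2.1 i).1)
      (fun i hi => by
        rcases Nat.lt_or_ge i k.1.1 with h | h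
        · rw [hwk i h.le, hwk (i + 1) h]; exact k.2.2 i h
        · rw [show i = k.1.1 by omega, hwl, hwk _ le_rfl]; exact hxk)
      (by rw [hwl, hwk 0 (Nat.zero_le _)]; exact hTV _ (k.2.1 0).2.1 _ hy)
    rw [Finset.sum_range_succ, Finset.sum_range_succ, hwl, hwk _ le_rfl] at this
    have e1 : ∑ i ∈ Finset.range k.1.1, L.realCost p (w (i + 1)).1 (w i).2 = R k :=
      Finset.sum_congr rfl fun i hi => by
        have := Finset.mem_range.1 hi
        rw [hwk i (by omega), hwk (i + 1) (by omega)]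
    have e2 : ∑ i ∈ Finset.range k.1.1, L.realCost p (w i).1 (w i).2 = 0 :=
      Finset.sum_eq_zero fun i hi => by
        have := Finset.mem_range.1 hi
        rw [hwk i (by omega)]
        exact RegularGeometry.realCost_eq_zero hp (k.2.1 i).2.2
    rw [e1, e2, RegularGeometry.realCost_eq_zero hp (k.2.1 k.1.1).2.2] at this
    have h0 : 0 ≤ L.realCost p (w 0).1 y := realCost_nonneg _ _
    have hDxy := hD x hx y hy
    simp only [hb]
    linarith
  · intro x x' hxx'
    refine hle fun k hk => _root_.le_trans ?_ (hge k (L.ll_trans _ _ _ hxx' hk))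
    refine ENNReal.ofReal_le_ofReal (add_le_add_left ?_ _)
    exact (hL.realCost_mono hp (L.le_of_ll _ _ hxx') (L.le_of_ll _ _ hk)).2
  · -- A chain starting from `x'` is prolonged by the null pair starting from `x'`.
    intro x x' hxx' hx'
    obtain ⟨y, hy, hxy⟩ := hnull x' hx'
    have hxy' := ll_of_ll_of_le hxx' (hSle _ hy)
    have hc : L.realCost p x x' ≤ L.realCost p x y :=
      (hL.realCost_mono hp (L.le_of_ll _ _ hxx') (hSle _ hy)).1
    have h1 : ENNReal.ofReal (L.realCost p x x') ≤ f x := by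
      set k : I := ⟨(0, fun _ => (x', y)), fun _ => ⟨hy, hx', hxy⟩, fun i hi => absurd hi (by simp)⟩
      have := hge (x := x) k hxy'
      refine (ENNReal.ofReal_le_ofReal ?_).trans this
      linarith [hR0 k, show L.realCost p x (b k) = L.realCost p x y from rfl]
    rw [add_comm]
    refine add_le_of_le_tsub_right_of_le h1 (hle fun k hk => ?_)
    refine ENNReal.le_sub_of_add_le_right ENNReal.ofReal_ne_top ?_
    set k' : I := ⟨(k.1.1 + 1, fun i => if i ≤ k.1.1 then k.1.2 i else (x', y)), fun i => by
      by_cases h : i ≤ k.1.1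
      · simp only [h, if_true]; exact k.2.1 i
      · simp only [h, if_false]; exact ⟨hy, hx', hxy⟩, fun i hi => by
      have hi : i < k.1.1 + 1 := hi
      rcases Nat.lt_or_ge i k.1.1 with h | h
      · simp only [h.le, Nat.succ_le_of_lt h, if_true]; exact k.2.2 i h
      · obtain rfl : i = k.1.1 := by omega
        simp only [Nat.not_succ_le_self, if_false, if_pos le_rfl]; exact hk⟩ with hk'
    have hbk' : b k' = y := by simp [hb, hk']
    have hRk' : R k' = R k + L.realCost p x' (b k) := by
      simp only [hR, hk', hb]
      rw [Finset.sum_range_succ]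
      congr 1
      · refine Finset.sum_congr rfl fun i hi => ?_
        have := Finset.mem_range.1 hi
        rw [if_pos (by omega), if_pos (by omega)]
      · simp
    have := hge (x := x) k' (by rw [hbk']; exact hxy')
    rw [hbk', hRk'] at this
    rw [← ENNReal.ofReal_add (add_nonneg (realCost_nonneg _ _) (hR0 k)) (realCost_nonneg _ _)]
    refine (ENNReal.ofReal_le_ofReal ?_).trans this
    linarith

variable {m : Measure M} [m.Regular] [m.IsOpenPosMeasure] {K N : ℝ}

/-- A set carrying a function as in `TimelikeMonotone.exists_height` is negligible: along a short
flow, subdivided into `n` steps, the function would decrease by at least a multiple of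
`n * (1 / n) ^ p`. -/
lemma WTCD.measure_eq_zero_of_height (hTCD : L.WTCD m p K N) (hL : L.RegularGeometry) (hp₀ : 0 < p)
    (hp₁ : p < 1) (hN : 0 < N) {T : Set M} (hT : IsCompact T) {b : M} (hTb : ∀ x ∈ T, L.ll x b)
    {f : M → ℝ≥0∞} {D : ℝ} (hf : Measurable f) (hfT : ∀ x ∈ T, f x ≤ ENNReal.ofReal D)
    (hmono : ∀ x x', L.ll x x' → f x' ≤ f x)
    (hdec : ∀ x x', L.ll x x' → x' ∈ T → ENNReal.ofReal (L.realCost p x x') + f x' ≤ f x) :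
    m T = 0 := by
  classical
  by_contra h0
  obtain ⟨μ, c, s₀, hc, hs₀, hμ0, hμT, hπ⟩ := hTCD.exists_short_flow hL hp₀ hp₁ hN hT hTb h0
  have hstep : ∀ s t, 0 ≤ s → s < t → t ≤ s₀ →
      ENNReal.ofReal (((t - s) * c) ^ p / 2) + ∫⁻ x, f x ∂(μ t : Measure M) ≤
        ∫⁻ x, f x ∂(μ s : Measure M) := by
    intro s t hs hst hts
    obtain ⟨π, h1, h2, h3⟩ := hπ s t hs hst hts
    have hpos : 0 < (t - s) * c := mul_pos (sub_pos.2 hst) hc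
    have hpw : ∀ᵐ z ∂π, T.indicator (fun _ => ENNReal.ofReal (((t - s) * c) ^ p)) z.2 + f z.2 ≤
        f z.1 := by
      filter_upwards [h3] with z hz
      have hll : L.ll z.1 z.2 := by
        rw [← L.τ_pos_iff]
        exact (ENNReal.toReal_pos_iff.1 (hpos.trans_le hz.2)).1
      by_cases hzT : z.2 ∈ T
      · rw [indicator_of_mem hzT]
        refine (add_le_add_left (ENNReal.ofReal_le_ofReal ?_) _).trans (hdec _ _ hll hzT)
        exact Real.rpow_le_rpow hpos.le hz.2 hp₀.le
      · rw [indicator_of_notMem hzT, zero_add]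
        exact hmono _ _ hll
    have hm : Measurable (T.indicator fun _ : M => ENNReal.ofReal (((t - s) * c) ^ p)) :=
      measurable_const.indicator hT.measurableSet
    have hmf : Measurable fun x : M =>
        T.indicator (fun _ => ENNReal.ofReal (((t - s) * c) ^ p)) x + f x := hm.add hf
    have hi : ∫⁻ x, (T.indicator (fun _ => ENNReal.ofReal (((t - s) * c) ^ p)) x + f x) ∂π.snd ≤
        ∫⁻ x, f x ∂π.fst := by
      rw [Measure.snd, Measure.fst, lintegral_map hmf measurable_snd,
        lintegral_map hf measurable_fst]
      exact lintegral_mono_ae hpw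
    rw [lintegral_add_left hm, h1, h2, lintegral_indicator hT.measurableSet, lintegral_const,
      Measure.restrict_apply_univ] at hi
    refine (add_le_add_left ?_ _).trans hi
    rw [div_eq_mul_one_div, ENNReal.ofReal_mul (by positivity)]
    refine mul_le_mul_right ?_ _
    rw [← ENNReal.ofReal_toReal (measure_ne_top (μ t : Measure M) T)]
    exact ENNReal.ofReal_le_ofReal (hμT t ⟨hs.trans hst.le, hts⟩)
  have hH0 : ∫⁻ x, f x ∂(μ 0 : Measure M) ≤ ENNReal.ofReal D := by
    calc ∫⁻ x, f x ∂(μ 0 : Measure M) ≤ ∫⁻ _, ENNReal.ofReal D ∂(μ 0 : Measure M) := by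
          refine lintegral_mono_ae ?_
          filter_upwards [mem_ae_iff.2 hμ0] with x hx using hfT x hx
      _ = ENNReal.ofReal D := by simp
  have hchain : ∀ n : ℕ, 0 < n → n * ((s₀ / n * c) ^ p / 2) ≤ max D 0 := by
    intro n hn
    have hn' : (0 : ℝ) < n := by exact_mod_cast hn
    have hind : ∀ k ≤ n, k * ENNReal.ofReal ((s₀ / n * c) ^ p / 2) +
        ∫⁻ x, f x ∂(μ (k * (s₀ / n)) : Measure M) ≤ ENNReal.ofReal D := by
      intro k
      induction k with
      | zero => intro _; simpa using hH0
      | succ k ih =>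
        intro hk
        have hk' : ((k + 1 : ℕ) : ℝ) ≤ n := by exact_mod_cast hk
        have := hstep (k * (s₀ / n)) ((k + 1 : ℕ) * (s₀ / n)) (by positivity)
          (by push_cast; rw [add_mul, one_mul]; linarith [div_pos hs₀ hn'])
          (by rw [mul_div_assoc']; exact (div_le_iff₀ hn').2 (by nlinarith))
        rw [show ((k + 1 : ℕ) * (s₀ / n) - k * (s₀ / n) : ℝ) = s₀ / n by push_cast; ring] at this
        refine _root_.le_trans ?_ (ih (by omega))
        rw [Nat.cast_succ, add_mul, one_mul, add_assoc]
        gcongr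
    have h1 : (n : ℝ≥0∞) * ENNReal.ofReal ((s₀ / n * c) ^ p / 2) ≤ ENNReal.ofReal D :=
      le_self_add.trans (hind n le_rfl)
    rw [← ENNReal.ofReal_natCast, ← ENNReal.ofReal_mul hn'.le] at h1
    by_contra hcon
    have hcon := not_le.1 hcon
    refine absurd h1 (not_le.2 ((ENNReal.ofReal_lt_ofReal_iff ?_).2
      ((le_max_left _ _).trans_lt hcon)))
    exact (le_max_right _ _).trans_lt hcon
  -- As `p < 1`, the total decrease `n * (1 / n) ^ p` is unbounded in `n`.
  have htend : Tendsto (fun n : ℕ => (s₀ * c) ^ p / 2 * (n : ℝ) ^ (1 - p)) atTop atTop :=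
    ((tendsto_rpow_atTop (sub_pos.2 hp₁)).comp tendsto_natCast_atTop_atTop).const_mul_atTop
      (by positivity)
  obtain ⟨n, hn, hn0⟩ := ((htend.eventually_gt_atTop (max D 0)).and (eventually_gt_atTop 0)).exists
  have hn' : (0 : ℝ) < n := by exact_mod_cast hn0
  have := hchain n hn0
  rw [show s₀ / n * c = s₀ * c / n by ring, Real.div_rpow (by positivity) hn'.le] at this
  rw [Real.rpow_sub hn', Real.rpow_one] at hn
  have e : (n : ℝ) * ((s₀ * c) ^ p / n ^ p / 2) = (s₀ * c) ^ p / 2 * (n / n ^ p) := by ring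
  linarith

/-- If one maximal coupling is chronological, then all of them are: otherwise a set of positive measure
would consist of initial points of both null and timelike pairs in the support of the sum of two
maximal couplings, and carry a height function. -/
lemma WTCD.chronological_of_isMaximal (hTCD : L.WTCD m p K N) (hL : L.RegularGeometry) (hp₀ : 0 < p)
    (hp₁ : p < 1) (hN : 0 < N) {A C : Set M} (hA : IsCompact A) (hC : IsCompact C)
    {π π' : Measure (M × M)} [IsProbabilityMeasure π] [IsProbabilityMeasure π']
    (hac : π.fst ≪ m) (h1 : π'.fst = π.fst) (h2 : π'.snd = π.snd) (hπ : L.IsMaximal p π)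
    (hπ' : L.IsMaximal p π') (hAC : ∀ᵐ z ∂π, z.1 ∈ A ∧ z.2 ∈ C) (hll : ∀ᵐ z ∂π, L.ll z.1 z.2) :
    ∀ᵐ z ∂π', L.ll z.1 z.2 := by
  have hAC' : ∀ᵐ z ∂π', z.1 ∈ A ∧ z.2 ∈ C :=
    ((ae_fst_mem_iff hA.measurableSet).1 (by
      rw [h1]; exact (ae_fst_mem_iff hA.measurableSet).2 (hAC.mono fun z hz => hz.1))).and
    ((ae_snd_mem_iff hC.measurableSet).1 (by
      rw [h2]; exact (ae_snd_mem_iff hC.measurableSet).2 (hAC.mono fun z hz => hz.2)))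
  have hsum := hπ.add hπ' h1 h2
  have hsumAC : ∀ᵐ z ∂(π + π'), z.1 ∈ A ∧ z.2 ∈ C := ae_add_measure_iff.2 ⟨hAC, hAC'⟩
  set S := (π + π').support with hS
  have hmono : L.TimelikeMonotone p S :=
    hsum.timelikeMonotone_support hL hp₀ (hL.totalCost_ne_top hp₀ hA hC hsumAC)
  have hScl : IsClosed S := Measure.isClosed_support
  have hSc : IsCompact S := (hA.prod hC).of_isClosed_subset hScl
    (support_subset_prod hA.isClosed hC.isClosed hsumAC)
  have hSle : ∀ z ∈ S, L.le z.1 z.2 := fun z hz => support_subset_of_ae hL.isClosed_le hsum.1 hz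
  obtain ⟨hπS, hπS'⟩ := ae_add_measure_iff.1 (ae_mem_support (π + π'))
  by_contra hcon
  -- The initial points of null pairs of the common support.
  set P := Prod.fst '' (S ∩ {z | L.ll z.1 z.2}ᶜ) with hP
  have hPc : IsCompact P := (hSc.inter_right (isOpen_ll L).isClosed_compl).image continuous_fst
  have hP0 : π.restrict (Prod.fst ⁻¹' P) ≠ 0 := by
    rw [Ne, Measure.restrict_eq_zero]
    intro h0
    refine hcon ?_
    have h3 : π'.fst P = 0 := by
      rw [h1, Measure.fst_apply hPc.measurableSet, h0]
    have h4 : ∀ᵐ z ∂π', z.1 ∈ Pᶜ := (ae_fst_mem_iff hPc.measurableSet.compl).1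
      (measure_eq_zero_iff_ae_notMem.1 h3)
    filter_upwards [h4, hπS'] with z hz hzS
    by_contra hzl
    exact hz ⟨z, ⟨hzS, hzl⟩, rfl⟩
  obtain ⟨z₀, hz₀, hz₀l⟩ : ∃ z ∈ (π.restrict (Prod.fst ⁻¹' P)).support, L.ll z.1 z.2 := by
    by_contra hc
    push Not at hc
    have h3 := ae_mem_support (π.restrict (Prod.fst ⁻¹' P))
    have h4 : ∀ᵐ z ∂(π.restrict (Prod.fst ⁻¹' P)), False := by
      filter_upwards [h3, ae_restrict_of_ae hll] with z a1 a2 using hc z a1 a2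
    exact hP0 (by simpa using h4)
  obtain ⟨r, hr, hrll⟩ := exists_cthickening_chronological (isCompact_singleton (x := z₀.1))
    (isCompact_singleton (x := z₀.2)) (by
      rintro x rfl y rfl
      exact hz₀l)
  rw [Metric.cthickening_singleton _ hr.le, Metric.cthickening_singleton _ hr.le] at hrll
  set U := Metric.closedBall z₀.1 r with hU
  set V := Metric.closedBall z₀.2 r with hV
  have hUc : IsCompact U := isCompact_closedBall _ _
  have hVc : IsCompact V := isCompact_closedBall _ _
  -- Those which are also the initial points of timelike pairs near `z₀`.
  set T := P ∩ Prod.fst '' (S ∩ U ×ˢ V) with hT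
  have hTc : IsCompact T := hPc.inter ((hSc.inter (hUc.prod hVc)).image continuous_fst)
  have hTU : T ⊆ U := by
    rintro _ ⟨-, z, hz, rfl⟩
    exact hz.2.1
  have hTV : ∀ x ∈ T, ∀ y ∈ V, L.ll x y := fun x hx => hrll x (hTU hx)
  have hmT : m T ≠ 0 := by
    intro h0
    have h3 := hac h0
    rw [Measure.fst_apply hTc.measurableSet] at h3
    have h4 : 0 < π.restrict (Prod.fst ⁻¹' P) (U ×ˢ V) :=
      (Measure.mem_support_iff_forall z₀).1 hz₀ _ (prod_mem_nhds
        (Metric.closedBall_mem_nhds _ hr) (Metric.closedBall_mem_nhds _ hr))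
    rw [Measure.restrict_apply (hUc.measurableSet.prod hVc.measurableSet)] at h4
    refine h4.ne' (measure_mono_null_ae ?_ h3)
    filter_upwards [hπS] with z hz hz'
    exact ⟨hz'.2, z, ⟨hz, hz'.1⟩, rfl⟩
  obtain ⟨f, D, hf, hfT, hf1, hf2⟩ := hmono.exists_height hL hp₀ hSle hTc hVc hTV
    (by
      rintro x ⟨⟨z, hz, rfl⟩, -⟩
      exact ⟨z.2, hz.1, hz.2⟩)
    (by
      rintro x ⟨-, z, hz, rfl⟩
      exact ⟨z.2, hz.2.2, hz.1⟩)
  exact hmT (hTCD.measure_eq_zero_of_height hL hp₀ hp₁ hN hTc (b := z₀.2)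
    (fun x hx => hTV x hx _ (Metric.mem_closedBall_self hr.le)) hf hfT hf1 hf2)

end Transport

end LorentzianPreLengthSpace

namespace LorentzianPreLengthSpace

section Transport

variable {M : Type*} [MetricSpace M] [ProperSpace M] [MeasurableSpace M] [BorelSpace M]
  {L : LorentzianPreLengthSpace M} {p : ℝ}

/-! ### Uniqueness of maximal couplings and strong dualizability -/

/-- A maximal measure on chronologically related pairs in a compact set `A × C`, whose first
marginal is absolutely continuous with respect to `m`. -/
structure IsChronologicalTransport (L : LorentzianPreLengthSpace M) (p : ℝ) (m : Measure M)
    (A C : Set M) (π : Measure (M × M)) : Prop where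
  isCompact_left : IsCompact A
  isCompact_right : IsCompact C
  ae_mem : ∀ᵐ z ∂π, z.1 ∈ A ∧ z.2 ∈ C
  isMaximal : L.IsMaximal p π
  ae_ll : ∀ᵐ z ∂π, L.ll z.1 z.2
  absolutelyContinuous : π.fst ≪ m

variable {m : Measure M} [m.Regular] [m.IsOpenPosMeasure] {K N : ℝ}

/-- Maximal couplings are unique: two of them add up to a maximal measure, and are therefore both
carried by the same monotone set. -/
lemma WTCD.eq_of_isMaximal (hTCD : L.WTCD m p K N) (hL : L.RegularGeometry) (hp₀ : 0 < p)
    (hp₁ : p < 1) (hN : 0 < N) {A C : Set M} {π σ : Measure (M × M)} [IsProbabilityMeasure π]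
    [IsProbabilityMeasure σ] (hπ : L.IsChronologicalTransport p m A C π) (hσ : L.IsMaximal p σ)
    (h1 : σ.fst = π.fst) (h2 : σ.snd = π.snd) : σ = π := by
  have hA := hπ.isCompact_left
  have hC := hπ.isCompact_right
  have hAC' : ∀ᵐ z ∂σ, z.1 ∈ A ∧ z.2 ∈ C :=
    ((ae_fst_mem_iff hA.measurableSet).1 (by
      rw [h1]; exact (ae_fst_mem_iff hA.measurableSet).2 (hπ.ae_mem.mono fun z hz => hz.1))).and
    ((ae_snd_mem_iff hC.measurableSet).1 (by
      rw [h2]; exact (ae_snd_mem_iff hC.measurableSet).2 (hπ.ae_mem.mono fun z hz => hz.2)))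
  have hll := hTCD.chronological_of_isMaximal hL hp₀ hp₁ hN hA hC hπ.absolutelyContinuous h1 h2
    hπ.isMaximal hσ hπ.ae_mem hπ.ae_ll
  have hsum := hπ.isMaximal.add hσ h1 h2
  have hmono := hsum.timelikeMonotone_support hL hp₀
    (hL.totalCost_ne_top hp₀ hA hC (ae_add_measure_iff.2 ⟨hπ.ae_mem, hAC'⟩))
  obtain ⟨s1, s2⟩ := ae_add_measure_iff.1 (ae_mem_support (π + σ))
  refine (hTCD.coupling_unique hL hp₀ hp₁ hN h1.symm hπ.absolutelyContinuous
    Measure.isClosed_support hmono (s1.and hπ.ae_ll) (s2.and hll)).symm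

/-- The first marginal of a chronological transport does not charge achronal compact sets. -/
lemma WTCD.ae_notMem_achronal (hTCD : L.WTCD m p K N) (hL : L.RegularGeometry) (hp₀ : 0 < p)
    (hp₁ : p < 1) (hN : 0 < N) {π : Measure (M × M)} (hac : π.fst ≪ m)
    (hll : ∀ᵐ z ∂π, L.ll z.1 z.2) {E : Set M} (hE : IsCompact E)
    (hach : ∀ x ∈ E, ∀ y ∈ E, ¬ L.ll x y) : ∀ᵐ z ∂π, z.1 ∉ E := by
  have hEm : MeasurableSet (Prod.fst ⁻¹' E : Set (M × M)) := measurable_fst hE.measurableSet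
  refine measure_eq_zero_iff_ae_notMem (s := Prod.fst ⁻¹' E) |>.1 ?_
  rw [← Measure.restrict_eq_zero]
  by_contra h0
  obtain ⟨z₀, hz₀, hz₀l⟩ : ∃ z ∈ (π.restrict (Prod.fst ⁻¹' E)).support, L.ll z.1 z.2 := by
    by_contra hc
    push Not at hc
    have h4 : ∀ᵐ z ∂(π.restrict (Prod.fst ⁻¹' E)), False := by
      filter_upwards [ae_mem_support (π.restrict (Prod.fst ⁻¹' E)), ae_restrict_of_ae hll]
        with z a1 a2 using hc z a1 a2
    exact h0 (by simpa using h4)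
  obtain ⟨r, hr, hrll⟩ := exists_cthickening_chronological (isCompact_singleton (x := z₀.1))
    (isCompact_singleton (x := z₀.2)) (by
      rintro x rfl y rfl
      exact hz₀l)
  rw [Metric.cthickening_singleton _ hr.le, Metric.cthickening_singleton _ hr.le] at hrll
  set U := Metric.closedBall z₀.1 r with hU
  have hUc : IsCompact U := isCompact_closedBall _ _
  have hm := hTCD.measure_achronal hL hp₀ hp₁ hN (hE.inter hUc) (b := z₀.2)
    (fun x hx => hrll x hx.2 _ (Metric.mem_closedBall_self hr.le))
    fun x hx y hy => hach x hx.1 y hy.1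
  have h3 := hac hm
  rw [Measure.fst_apply (hE.inter hUc).measurableSet] at h3
  have h4 : 0 < π.restrict (Prod.fst ⁻¹' E) (U ×ˢ univ) :=
    (Measure.mem_support_iff_forall z₀).1 hz₀ _ (prod_mem_nhds
      (Metric.closedBall_mem_nhds _ hr) univ_mem)
  rw [Measure.restrict_apply (hUc.measurableSet.prod MeasurableSet.univ)] at h4
  refine h4.ne' (measure_mono_null (t := Prod.fst ⁻¹' (E ∩ U)) ?_ h3)
  exact fun z hz => ⟨hz.2, hz.1.1⟩

/-- A chronological transport is carried by pairs which can be approximated, within its support, by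
pairs whose initial points lie in the chronological past. -/
lemma WTCD.exists_approximable (hTCD : L.WTCD m p K N) (hL : L.RegularGeometry) (hp₀ : 0 < p)
    (hp₁ : p < 1) (hN : 0 < N) {A C : Set M} {π : Measure (M × M)}
    (hπ : L.IsChronologicalTransport p m A C π) :
    ∃ Γ : Set (M × M), MeasurableSet Γ ∧ (∀ᵐ z ∂π, z ∈ Γ) ∧ (∀ z ∈ Γ, z ∈ π.support ∧
      L.ll z.1 z.2) ∧ ∀ z ∈ Γ, ∀ ε > 0, ∃ w ∈ π.support, dist w z < ε ∧ L.ll w.1 z.1 := by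
  rcases isEmpty_or_nonempty M with hM | hM
  · refine ⟨∅, .empty, .of_forall fun z => (hM.false z.1).elim, ?_, ?_⟩ <;>
      exact fun z => (hM.false z.1).elim
  set S := π.support with hS
  have hScl : IsClosed S := Measure.isClosed_support
  set V : ℕ × ℕ → Set (M × M) := fun j =>
    Metric.closedBall (TopologicalSpace.denseSeq (M × M) j.1) (1 / (j.2 + 1 : ℝ)) with hV
  have hVc : ∀ j, IsCompact (V j) := fun j => isCompact_closedBall _ _
  -- Initial points of pairs in `V j` which are minimal for the chronological order.
  set P : ℕ × ℕ → Set M := fun j => Prod.fst '' (S ∩ V j) with hP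
  set E : ℕ × ℕ → Set M := fun j => P j ∩ ⋂ x' ∈ P j, {x | L.ll x' x}ᶜ with hE
  have hEc : ∀ j, IsCompact (E j) := fun j =>
    (((hVc j).inter_left hScl).image continuous_fst).inter_right
      (isClosed_biInter fun x' _ => ((isOpen_ll L).preimage
        (continuous_const.prodMk continuous_id)).isClosed_compl)
  have hEach : ∀ j, ∀ x ∈ E j, ∀ y ∈ E j, ¬ L.ll x y := fun j x hx y hy =>
    mem_iInter₂.1 hy.2 x hx.1
  have hEm : ∀ j, MeasurableSet {z : M × M | z ∈ V j ∧ z.1 ∈ E j} := fun j =>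
    (hVc j).measurableSet.inter (measurable_fst (hEc j).measurableSet)
  refine ⟨S ∩ {z | L.ll z.1 z.2} ∩ ⋂ j, {z : M × M | z ∈ V j ∧ z.1 ∈ E j}ᶜ,
    (hScl.measurableSet.inter (isOpen_ll L).measurableSet).inter
      (MeasurableSet.iInter fun j => (hEm j).compl), ?_, fun z hz => hz.1, ?_⟩
  · have hall : ∀ᵐ z ∂π, ∀ j, z.1 ∉ E j := ae_all_iff.2 fun j =>
      hTCD.ae_notMem_achronal hL hp₀ hp₁ hN hπ.absolutelyContinuous hπ.ae_ll (hEc j) (hEach j)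
    filter_upwards [ae_mem_support π, hπ.ae_ll, hall] with z h1 h2 h3
    exact ⟨⟨h1, h2⟩, mem_iInter.2 fun j hj => h3 j hj.2⟩
  · intro z hz ε hε
    obtain ⟨n, hn⟩ := exists_nat_one_div_lt (show (0 : ℝ) < ε / 2 by positivity)
    obtain ⟨i, hi⟩ := (TopologicalSpace.denseRange_denseSeq (M × M)).exists_dist_lt z
      (show (0 : ℝ) < 1 / (n + 1 : ℝ) by positivity)
    have hzV : z ∈ V (i, n) := hi.le
    have hzE : z.1 ∉ E (i, n) := fun h => mem_iInter.1 hz.2 (i, n) ⟨hzV, h⟩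
    have hzP : z.1 ∈ P (i, n) := ⟨z, ⟨hz.1.1, hzV⟩, rfl⟩
    have : ∃ x' ∈ P (i, n), L.ll x' z.1 := by
      by_contra hc
      push Not at hc
      exact hzE ⟨hzP, mem_iInter₂.2 fun x' hx' => hc x' hx'⟩
    obtain ⟨_, ⟨w, ⟨hwS, hwV⟩, rfl⟩, hw⟩ := this
    refine ⟨w, hwS, ?_, hw⟩
    have h1 : dist w (TopologicalSpace.denseSeq (M × M) i) ≤ 1 / (n + 1 : ℝ) := hwV
    have := dist_triangle_right w z (TopologicalSpace.denseSeq (M × M) i)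
    linarith

/-- On approximable pairs, monotonicity for chronological rearrangements extends to all
rearrangements. For a cycle of pairs `(x i, y i)` with `x (i + 1) ≤ y i` one takes nearby pairs
`(x' i, y' i)` with `x' i ≪ x i`, and sends `x' (i + 1)` to `y i` and `x i` to `y' i`. -/
lemma TimelikeMonotone.cyclicallyMonotone (hL : L.RegularGeometry) (hp : 0 < p) {S Γ : Set (M × M)}
    (hS : L.TimelikeMonotone p S) (hΓ : ∀ z ∈ Γ, z ∈ S ∧ L.ll z.1 z.2)
    (happrox : ∀ z ∈ Γ, ∀ ε > 0, ∃ w ∈ S, dist w z < ε ∧ L.ll w.1 z.1) :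
    L.CyclicallyMonotone p Γ := by
  intro n z hz
  by_cases hle : ∀ i, L.le (z (i + 1)).1 (z i).2
  swap
  · push Not at hle
    obtain ⟨i, hi⟩ := hle
    rw [ereal_sum_eq_bot Finset.univ (fun i => L.cost p (z (i + 1)).1 (z i).2) (Finset.mem_univ i)
      (if_neg hi)]
    exact bot_le
  have e1 : ∀ i, L.cost p (z (i + 1)).1 (z i).2 = (L.realCost p (z (i + 1)).1 (z i).2 : EReal) :=
    fun i => cost_eq_realCost hL hp (hle i)
  have e2 : ∀ i, L.cost p (z i).1 (z i).2 = (L.realCost p (z i).1 (z i).2 : EReal) :=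
    fun i => cost_eq_realCost hL hp (L.le_of_ll _ _ (hΓ _ (hz i)).2)
  simp only [e1, e2]
  rw [← ereal_coe_sum, ← ereal_coe_sum, EReal.coe_le_coe_iff]
  choose w hwS hwd hwl using fun (k : ℕ) i => happrox (z i) (hz i) (1 / (k + 1 : ℝ)) (by positivity)
  have hlim : ∀ i, Tendsto (fun k => w k i) atTop (𝓝 (z i)) := fun i =>
    tendsto_iff_dist_tendsto_zero.2 (squeeze_zero (fun _ => dist_nonneg) (fun k => (hwd k i).le)
      tendsto_one_div_add_atTop_nhds_zero_nat)
  have hl1 : ∀ i, Tendsto (fun k => (w k i).1) atTop (𝓝 (z i).1) := fun i =>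
    (continuous_fst.tendsto (z i)).comp (hlim i)
  have hl2 : ∀ i, Tendsto (fun k => (w k i).2) atTop (𝓝 (z i).2) := fun i =>
    (continuous_snd.tendsto (z i)).comp (hlim i)
  have hc : ∀ {u v : ℕ → M} {x y : M}, Tendsto u atTop (𝓝 x) → Tendsto v atTop (𝓝 y) →
      Tendsto (fun k => L.realCost p (u k) (v k)) atTop (𝓝 (L.realCost p x y)) := by
    intro u v x y hu hv
    have := ((hL.continuous_realCost hp).tendsto (x, y)).comp (hu.prodMk_nhds hv)
    simpa only [Function.comp_def] using this
  have hev : ∀ᶠ k in atTop, ∀ i, L.ll (z i).1 (w k i).2 := eventually_all.2 fun i =>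
    (tendsto_const_nhds.prodMk_nhds (hl2 i)).eventually
      ((isOpen_ll L).mem_nhds (hΓ _ (hz i)).2)
  set σ : Equiv.Perm (Fin (n + 1) ⊕ Fin (n + 1)) := (Equiv.sumComm _ _).trans
    (Equiv.sumCongr (Equiv.refl _) (Equiv.addRight 1)) with hσ
  have hineq : ∀ᶠ k in atTop,
      ∑ i, L.realCost p (w k (i + 1)).1 (z i).2 + ∑ i, L.realCost p (z i).1 (w k i).2 ≤
        ∑ i, L.realCost p (z i).1 (z i).2 + ∑ i, L.realCost p (w k i).1 (w k i).2 := by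
    filter_upwards [hev] with k hk
    have := hS (Fin (n + 1) ⊕ Fin (n + 1)) (Sum.elim z (w k)) σ
      (by rintro (i | i); exacts [(hΓ _ (hz i)).1, hwS k i])
      (by
        rintro (i | i)
        · exact ll_of_ll_of_le (hwl k (i + 1)) (hle i)
        · exact hk i)
    rw [Fintype.sum_sum_type, Fintype.sum_sum_type] at this
    exact this
  have t1 := tendsto_finsetSum Finset.univ fun i (_ : i ∈ Finset.univ) =>
    hc (hl1 (i + 1)) (tendsto_const_nhds (x := (z i).2))
  have t2 := tendsto_finsetSum Finset.univ fun i (_ : i ∈ Finset.univ) =>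
    hc (tendsto_const_nhds (x := (z i).1)) (hl2 i)
  have t3 := tendsto_finsetSum Finset.univ fun i (_ : i ∈ Finset.univ) => hc (hl1 i) (hl2 i)
  have := le_of_tendsto_of_tendsto (t1.add t2)
    (t3.const_add (∑ i, L.realCost p (z i).1 (z i).2)) hineq
  linarith

/-- The curvature condition upgrades dualizability to strong dualizability. -/
lemma WTCD.isStronglyTimelikeDualizable (hTCD : L.WTCD m p K N) (hL : L.RegularGeometry)
    (hp₀ : 0 < p) (hp₁ : p < 1) (hN : 0 < N) {μ ν : ProbabilityMeasure M}
    (hμ : IsCompact (μ : Measure M).support) (hν : IsCompact (ν : Measure M).support)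
    {A C : Set M} {π : Measure (M × M)} (hπ : L.IsChronologicalTransport p m A C π)
    (h1 : π.fst = μ) (h2 : π.snd = ν) : L.IsStronglyTimelikeDualizable p μ ν := by
  have hπp : IsProbabilityMeasure π := isProbabilityMeasure_of_fst h1
  have hae : ∀ᵐ z ∂π, z.1 ∈ (μ : Measure M).support ∧ z.2 ∈ (ν : Measure M).support :=
    ae_mem_prod_of_marginals hμ.measurableSet hν.measurableSet
      (by rw [h1]; exact Measure.measure_compl_support)
      (by rw [h2]; exact Measure.measure_compl_support)
  have hsupp := support_subset_prod hμ.isClosed hν.isClosed hae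
  have hmono := hπ.isMaximal.timelikeMonotone_support hL hp₀
    (hL.totalCost_ne_top hp₀ hπ.isCompact_left hπ.isCompact_right hπ.ae_mem)
  obtain ⟨Γ, hΓm, hπΓ, hΓ, happrox⟩ := hTCD.exists_approximable hL hp₀ hp₁ hN hπ
  refine ⟨⟨π, isTimelikeDualizable_bounded hL hp₀ hμ hν ⟨⟨h1, h2⟩, hπ.ae_ll⟩ hπ.isMaximal⟩, Γ, hΓm,
    hmono.cyclicallyMonotone hL hp₀ hΓ happrox,
    fun z hz => ⟨(hΓ z hz).2, (hsupp (hΓ z hz).1).1, (hsupp (hΓ z hz).1).2⟩, fun σ hσ => ?_⟩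
  have hσp : IsProbabilityMeasure σ := isProbabilityMeasure_of_fst hσ.1.1
  rw [isOptimalCoupling_iff hp₀, prob_eq_one_iff_ae hΓm]
  constructor
  · rintro ⟨-, hσmax⟩
    rw [hTCD.eq_of_isMaximal hL hp₀ hp₁ hN hπ hσmax (hσ.1.1.trans h1.symm) (hσ.1.2.trans h2.symm)]
    exact hπΓ
  · intro hσΓ
    have e : π = σ := hTCD.coupling_unique hL hp₀ hp₁ hN (h1.trans hσ.1.1.symm)
      hπ.absolutelyContinuous Measure.isClosed_support hmono
      (hπΓ.mono fun z hz => hΓ z hz) (hσΓ.mono fun z hz => hΓ z hz)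
    exact ⟨hσ.1, e ▸ hπ.isMaximal⟩

/-! ### Uniqueness of intermediate measures -/

/-- The distribution of the intermediate points of a chronological transport is unique. The couplings
of the initial points with two families of intermediate points have a maximal sum, hence they are
carried by a common monotone set, and `WTCD.coupling_unique` applies to them. -/
lemma WTCD.intermediate_unique (hTCD : L.WTCD m p K N) (hL : L.RegularGeometry) (hp₀ : 0 < p)
    (hp₁ : p < 1) (hN : 0 < N) {A C : Set M} {π : Measure (M × M)} [IsProbabilityMeasure π]
    (hπ : L.IsChronologicalTransport p m A C π) {s : ℝ} (hs : s ∈ Ioo (0 : ℝ) 1)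
    {κ κ' : Measure (M × M × M)} (hκ : κ.map (fun w => (w.1, w.2.2)) = π)
    (hκ' : κ'.map (fun w => (w.1, w.2.2)) = π)
    (hi : ∀ᵐ w ∂κ, L.IsIntermediate s w.1 w.2.1 w.2.2)
    (hi' : ∀ᵐ w ∂κ', L.IsIntermediate s w.1 w.2.1 w.2.2) :
    κ.map (fun w => w.2.1) = κ'.map fun w => w.2.1 := by
  have hs' : 0 < 1 - s := sub_pos.2 hs.2
  have hkp : IsProbabilityMeasure κ := by
    have : IsProbabilityMeasure (κ.map fun w => (w.1, w.2.2)) := by rw [hκ]; infer_instance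
    exact Measure.isProbabilityMeasure_of_map fun w : M × M × M => (w.1, w.2.2)
  have hkp' : IsProbabilityMeasure κ' := by
    have : IsProbabilityMeasure (κ'.map fun w => (w.1, w.2.2)) := by rw [hκ']; infer_instance
    exact Measure.isProbabilityMeasure_of_map fun w : M × M × M => (w.1, w.2.2)
  have : Nonempty (M × M) := nonempty_of_isProbabilityMeasure π
  have : Nonempty M := this.map Prod.fst
  set ω := κ + κ' with hω
  have hiω : ∀ᵐ w ∂ω, L.IsIntermediate s w.1 w.2.1 w.2.2 := ae_add_measure_iff.2 ⟨hi, hi'⟩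
  have hω02 : ω.map (fun w => (w.1, w.2.2)) = π + π := by
    rw [hω, Measure.map_add _ _ measurable_e02, hκ, hκ']
  have hππ : L.IsMaximal p (π + π) := hπ.isMaximal.add hπ.isMaximal rfl rfl
  have hfin : L.totalCost p (π + π) ≠ ∞ := hL.totalCost_ne_top hp₀ hπ.isCompact_left
    hπ.isCompact_right (ae_add_measure_iff.2 ⟨hπ.ae_mem, hπ.ae_mem⟩)
  have hcost := hL.totalCost_of_isIntermediate hp₀ hs hiω
  rw [hω02] at hcost
  have ha0 : ENNReal.ofReal (s ^ (1 - p)) ≠ 0 :=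
    (ENNReal.ofReal_pos.2 (Real.rpow_pos_of_pos hs.1 _)).ne'
  set α := ω.map fun w => (w.1, w.2.1) with hα
  set β := ω.map Prod.snd with hβ
  have hfin1 : ENNReal.ofReal (s ^ (1 - p)) * L.totalCost p α ≠ ∞ :=
    ne_top_of_le_ne_top (hcost ▸ hfin) le_self_add
  have hfin2 : ENNReal.ofReal ((1 - s) ^ (1 - p)) * L.totalCost p β ≠ ∞ :=
    ne_top_of_le_ne_top (hcost ▸ hfin) le_add_self
  have hfinα : L.totalCost p α ≠ ∞ := fun h => hfin1 (by rw [h, ENNReal.mul_top ha0])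
  have hle : MeasurableSet {z : M × M | L.le z.1 z.2} := hL.isClosed_le.measurableSet
  have hαle : ∀ᵐ z ∂α, L.le z.1 z.2 :=
    (ae_map_iff (p := fun z : M × M => L.le z.1 z.2) measurable_e01.aemeasurable hle).2
      (hiω.mono fun w hw => hw.1)
  have hβle : ∀ᵐ z ∂β, L.le z.1 z.2 :=
    (ae_map_iff (p := fun z : M × M => L.le z.1 z.2) measurable_snd.aemeasurable hle).2
      (hiω.mono fun w hw => hw.2.1)
  have hαβ : α.snd = β.fst := by rw [hα, hβ, map_e01_snd, map_snd_fst]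
  -- Otherwise a better coupling of the first half could be concatenated with the second half.
  have hαmax : L.IsMaximal p α := by
    refine ⟨hαle, fun ρ r1 r2 r3 => ?_⟩
    have hρfin : IsFiniteMeasure ρ := ⟨by
      rw [← Measure.fst_univ, r1]; exact measure_lt_top _ _⟩
    obtain ⟨θ, t1, t2, t3⟩ := exists_gluing_causal hL (r2.trans hαβ) r3 hβle
    have htri := (hL.totalCost_triangle hp₀ hp₁ hs t3).1
    rw [t1, t2] at htri
    have hθle : ∀ᵐ z ∂(θ.map fun w => (w.1, w.2.2)), L.le z.1 z.2 :=
      (ae_map_iff (p := fun z : M × M => L.le z.1 z.2) measurable_e02.aemeasurable hle).2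
        (t3.mono fun w hw => L.le_trans _ _ _ hw.1 hw.2)
    have hmax := hππ.2 _ (by rw [← hω02, map_e02_fst, map_e02_fst, ← map_e01_fst θ, t1, r1, hα,
        map_e01_fst]) (by rw [← hω02, map_e02_snd, map_e02_snd, ← map_snd_snd θ, t2, hβ,
        map_snd_snd]) hθle
    rw [← hcost] at hmax
    have := (ENNReal.add_le_add_iff_right hfin2).1 (htri.trans hmax)
    exact (ENNReal.mul_le_mul_iff_right ha0 ENNReal.ofReal_ne_top).1 this
  have hmono := hαmax.timelikeMonotone_support hL hp₀ hfinα
  have hαadd : α = (κ.map fun w => (w.1, w.2.1)) + κ'.map fun w => (w.1, w.2.1) :=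
    Measure.map_add _ _ measurable_e01
  have hsupp : ∀ᵐ z ∂((κ.map fun w => (w.1, w.2.1)) + κ'.map fun w => (w.1, w.2.1)),
      z ∈ α.support := by
    rw [← hαadd]
    exact ae_mem_support α
  obtain ⟨u1, u2⟩ := ae_add_measure_iff.1 hsupp
  have hlls : MeasurableSet {z : M × M | L.ll z.1 z.2} := (isOpen_ll L).measurableSet
  have v : ∀ ω : Measure (M × M × M), ω.map (fun w => (w.1, w.2.2)) = π →
      (∀ᵐ w ∂ω, L.IsIntermediate s w.1 w.2.1 w.2.2) →
      ∀ᵐ z ∂(ω.map fun w => (w.1, w.2.1)), L.ll z.1 z.2 := by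
    intro ω e hi
    refine (ae_map_iff (p := fun z : M × M => L.ll z.1 z.2) measurable_e01.aemeasurable hlls).2 ?_
    have : ∀ᵐ w ∂ω, L.ll w.1 w.2.2 :=
      (ae_map_iff (p := fun z : M × M => L.ll z.1 z.2) measurable_e02.aemeasurable hlls).1
        (by rw [e]; exact hπ.ae_ll)
    filter_upwards [this, hi] with w h1 h2 using h2.ll_left hL hs.1 h1
  have hf : ∀ ω : Measure (M × M × M), ω.map (fun w => (w.1, w.2.2)) = π →
      (ω.map fun w => (w.1, w.2.1)).fst = π.fst := fun ω e => by
    rw [map_e01_fst, ← map_e02_fst, e]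
  have : IsProbabilityMeasure (κ.map fun w => (w.1, w.2.1)) :=
    Measure.isProbabilityMeasure_map measurable_e01.aemeasurable
  have : IsProbabilityMeasure (κ'.map fun w => (w.1, w.2.1)) :=
    Measure.isProbabilityMeasure_map measurable_e01.aemeasurable
  have := hTCD.coupling_unique hL hp₀ hp₁ hN ((hf κ hκ).trans (hf κ' hκ').symm)
    (by rw [hf κ hκ]; exact hπ.absolutelyContinuous) Measure.isClosed_support hmono
    (u1.and (v κ hκ hi)) (u2.and (v κ' hκ' hi'))
  rw [← map_e01_snd, this, map_e01_snd]

end Transport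

end LorentzianPreLengthSpace

namespace LorentzianPreLengthSpace

section Transport

variable {M : Type*} [MetricSpace M] [ProperSpace M] [MeasurableSpace M] [BorelSpace M]
  {L : LorentzianPreLengthSpace M} {p : ℝ}
  {m : Measure M} [m.Regular] [m.IsOpenPosMeasure] {K N : ℝ}

/-! ### Entropy and density bounds along geodesics -/

lemma exists_le_smul_of_densityNorm_lt_top {μ : ProbabilityMeasure M} (hac : (μ : Measure M) ≪ m)
    (h : densityNorm m μ < ∞) : ∃ c : ℝ, 0 < c ∧ (μ : Measure M) ≤ ENNReal.ofReal c • m := by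
  -- Adding `1` makes the constant positive.
  refine ⟨(densityNorm m μ).toReal + 1, by positivity, Measure.le_iff.2 fun s hs => ?_⟩
  rw [← Measure.withDensity_rnDeriv_eq _ _ hac, withDensity_apply _ hs, Measure.smul_apply,
    smul_eq_mul, ← setLIntegral_const]
  refine lintegral_mono_ae (ae_restrict_of_ae ?_)
  filter_upwards [ENNReal.ae_le_essSup ((μ : Measure M).rnDeriv m)] with x hx
  exact hx.trans ((ENNReal.ofReal_toReal h.ne).symm.le.trans
    (ENNReal.ofReal_le_ofReal (lt_add_one _).le))

lemma densityNorm_le_of_le_smul {μ : ProbabilityMeasure M} {c : ℝ}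
    (h : (μ : Measure M) ≤ ENNReal.ofReal c • m) : densityNorm m μ ≤ ENNReal.ofReal c :=
  essSup_le_of_ae_le _ (rnDeriv_le_of_le_smul h)

/-- The convexity inequality bounds the entropy along a geodesic by that of the end measures, up to a
constant. -/
lemma ConvexityInequality.entropy_le (hN : 0 < N) {π : Measure (M × M)}
    {μ : unitInterval → ProbabilityMeasure M} (h : L.ConvexityInequality m K N π μ) {D E : ℝ}
    (hD : 0 ≤ D) (hθ : L.τNorm 2 π ≤ ENNReal.ofReal D) (h0 : entropy m (μ 0) ≤ (E : EReal))
    (h1 : entropy m (μ 1) ≤ (E : EReal)) (t : unitInterval) :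
    entropy m (μ t) ≤ ((N * Real.log (Real.cosh (D * √(-K / N))) + E : ℝ) : EReal) := by
  have hH : 0 < Real.cosh (D * √(-K / N)) := Real.cosh_pos _
  set H := Real.cosh (D * √(-K / N)) with hHdef
  have ht0 := t.2.1
  have ht1 := sub_nonneg.2 t.2.2
  have d0 := (le_distortion (K := K) (r := 1 - (t : ℝ)) hN hD hθ ⟨ht1, by linarith⟩).2
  have d1 := (le_distortion (K := K) (r := (t : ℝ)) hN hD hθ t.2).2
  -- The two distortion coefficients are at least `(1 - t) / H` and `t / H`, of sum `1 / H`.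
  have hu : ENNReal.ofReal (1 / H * Real.exp (-E / N)) ≤ expEntropy m N (μ t) := by
    refine _root_.le_trans (le_of_eq ?_) ((add_le_add (mul_le_mul' d0 (le_expEntropy_of_le hN h0))
      (mul_le_mul' d1 (le_expEntropy_of_le hN h1))).trans (h t))
    rw [← add_mul, ← ENNReal.ofReal_add (by positivity) (by positivity),
      ← ENNReal.ofReal_mul (by positivity)]
    congr 2
    rw [← add_div]
    ring
  have := entropy_le_of_le_expEntropy hN (by positivity) hu
  rwa [Real.log_mul (by positivity) (Real.exp_pos _).ne', Real.log_exp, one_div, Real.log_inv,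
    show -N * (-Real.log H + -E / N) = N * Real.log H + E by field_simp; ring] at this

lemma IsChronologicalTransport.fst_compl {A C : Set M} {π : Measure (M × M)}
    (hπ : L.IsChronologicalTransport p m A C π) : π.fst Aᶜ = 0 :=
  mem_ae_iff.1 ((ae_fst_mem_iff hπ.isCompact_left.measurableSet).2
    (hπ.ae_mem.mono fun _ hz => hz.1))

lemma IsChronologicalTransport.snd_compl {A C : Set M} {π : Measure (M × M)}
    (hπ : L.IsChronologicalTransport p m A C π) : π.snd Cᶜ = 0 :=
  mem_ae_iff.1 ((ae_snd_mem_iff hπ.isCompact_right.measurableSet).2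
    (hπ.ae_mem.mono fun _ hz => hz.2))

/-- Marginals of bounded density of a chronological transport are joined by a geodesic of uniformly
bounded entropy. -/
lemma WTCD.exists_geodesic_of_le_smul (hTCD : L.WTCD m p K N) (hL : L.RegularGeometry)
    (hp₀ : 0 < p) (hp₁ : p < 1) (hN : 0 < N) {A C : Set M} {D : ℝ} (hD0 : 0 ≤ D)
    (hD : ∀ x ∈ A, ∀ y ∈ C, (L.τ x y).toReal ≤ D) {μ ν : ProbabilityMeasure M}
    {π : Measure (M × M)} (hπ : L.IsChronologicalTransport p m A C π) (h1 : π.fst = μ)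
    (h2 : π.snd = ν) {c : ℝ} (hc : 0 < c) (hμ : (μ : Measure M) ≤ ENNReal.ofReal c • m)
    (hν : (ν : Measure M) ≤ ENNReal.ofReal c • m) :
    ∃ (π' : Measure (M × M)) (η : unitInterval → ProbabilityMeasure M),
      L.IsChronologicalCoupling μ ν π' ∧ L.IsOptimalCoupling p μ ν π' ∧
      L.τNorm 2 π' ≤ ENNReal.ofReal D ∧ L.IsGeodesicFromTo p μ ν η ∧
      L.ConvexityInequality m K N π' η ∧ ∀ t, entropy m (η t) ≤
        ((N * Real.log (Real.cosh (D * √(-K / N))) + Real.log c : ℝ) : EReal) := by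
  have hA := hπ.isCompact_left
  have hC := hπ.isCompact_right
  have hμA : (μ : Measure M) Aᶜ = 0 := h1 ▸ hπ.fst_compl
  have hνC : (ν : Measure M) Cᶜ = 0 := h2 ▸ hπ.snd_compl
  have hcA := isCompact_support_of_compl hA hμA
  have hcC := isCompact_support_of_compl hC hνC
  obtain ⟨hf0, he0⟩ := entropy_le_of_le_smul hA.measurableSet hμA hA.measure_ne_top hc hμ
  obtain ⟨hf1, he1⟩ := entropy_le_of_le_smul hC.measurableSet hνC hC.measure_ne_top hc hν
  have hstrong := hTCD.isStronglyTimelikeDualizable hL hp₀ hp₁ hN hcA hcC hπ h1 h2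
  have hπp : IsProbabilityMeasure π := isProbabilityMeasure_of_fst h1
  have hWtop : L.lorentzWasserstein p μ ν < ⊤ := by
    rw [lorentzWasserstein_eq hp₀ h1 h2 hπ.isMaximal]
    refine lt_of_le_of_ne le_top fun h => ?_
    rw [EReal.coe_ennreal_eq_top_iff, ENNReal.rpow_eq_top_iff_of_pos (by positivity)] at h
    exact hL.totalCost_ne_top hp₀ hA hC hπ.ae_mem h
  obtain ⟨π', η, hπ1, hπ2, hη, hconv⟩ := hTCD μ ν hstrong hcA hcC hf0 hf1 hWtop
  have hπp' : IsProbabilityMeasure π' := isProbabilityMeasure_of_fst hπ1.1.1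
  have hθ := hL.τNorm_le (π := π') (D := D) (by
    filter_upwards [ae_mem_prod_of_marginals hA.measurableSet hC.measurableSet
      (hπ1.1.1 ▸ hμA) (hπ1.1.2 ▸ hνC)] with z hz using hD _ hz.1 _ hz.2)
  exact ⟨π', η, hπ1, hπ2, hθ, hη, hconv, hconv.entropy_le hN hD0 hθ (by rwa [hη.1])
    (by rwa [hη.2.1])⟩

/-- Every geodesic between the marginals of a chronological transport is induced by intermediate
points of that transport. -/
lemma WTCD.exists_intermediate (hTCD : L.WTCD m p K N) (hL : L.RegularGeometry)
    (hp₀ : 0 < p) (hp₁ : p < 1) (hN : 0 < N) {A C : Set M} {μ ν : ProbabilityMeasure M}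
    {π : Measure (M × M)} (hπ : L.IsChronologicalTransport p m A C π) (h1 : π.fst = μ)
    (h2 : π.snd = ν) {η : unitInterval → ProbabilityMeasure M} (hη : L.IsGeodesicFromTo p μ ν η)
    {t : unitInterval} (h0t : 0 < t) (ht1 : t < 1) :
    ∃ κ : Measure (M × M × M), κ.map (fun w => w.2.1) = η t ∧ κ.map (fun w => (w.1, w.2.2)) = π ∧
      ∀ᵐ w ∂κ, L.IsIntermediate t w.1 w.2.1 w.2.2 := by
  obtain ⟨κ, k0, kt, k1, hmax, hi⟩ := hη.exists_intermediate hL hp₀ hp₁ hπ.isCompact_left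
    hπ.isCompact_right (h1 ▸ hπ.fst_compl) (h2 ▸ hπ.snd_compl) h0t ht1
  have hπp : IsProbabilityMeasure π := isProbabilityMeasure_of_fst h1
  have e1 : (κ.map fun w => (w.1, w.2.2)).fst = π.fst := by rw [map_e02_fst, k0, hη.1, h1]
  have e2 : (κ.map fun w => (w.1, w.2.2)).snd = π.snd := by rw [map_e02_snd, k1, hη.2.1, h2]
  have hκp : IsProbabilityMeasure (κ.map fun w => (w.1, w.2.2)) :=
    isProbabilityMeasure_of_fst (e1.trans h1)
  exact ⟨κ, kt, hTCD.eq_of_isMaximal hL hp₀ hp₁ hN hπ hmax e1 e2, by simpa using hi⟩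

/-- There is at most one geodesic between the marginals of a chronological transport. -/
lemma WTCD.geodesic_unique (hTCD : L.WTCD m p K N) (hL : L.RegularGeometry)
    (hp₀ : 0 < p) (hp₁ : p < 1) (hN : 0 < N) {A C : Set M} {μ ν : ProbabilityMeasure M}
    {π : Measure (M × M)} (hπ : L.IsChronologicalTransport p m A C π) (h1 : π.fst = μ)
    (h2 : π.snd = ν) {η η' : unitInterval → ProbabilityMeasure M}
    (hη : L.IsGeodesicFromTo p μ ν η) (hη' : L.IsGeodesicFromTo p μ ν η') : η = η' := by
  have hπp : IsProbabilityMeasure π := isProbabilityMeasure_of_fst h1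
  funext t
  rcases eq_or_ne t 0 with rfl | ht0
  · rw [hη.1, hη'.1]
  rcases eq_or_ne t 1 with rfl | ht1
  · rw [hη.2.1, hη'.2.1]
  have ht0 := unitInterval.pos_iff_ne_zero.2 ht0
  have ht1 := unitInterval.lt_one_iff_ne_one.2 ht1
  obtain ⟨κ, a1, a2, a3⟩ := hTCD.exists_intermediate hL hp₀ hp₁ hN hπ h1 h2 hη ht0 ht1
  obtain ⟨κ', b1, b2, b3⟩ := hTCD.exists_intermediate hL hp₀ hp₁ hN hπ h1 h2 hη' ht0 ht1
  refine Subtype.ext ?_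
  change ((η t : ProbabilityMeasure M) : Measure M) = η' t
  rw [← a1, ← b1]
  exact hTCD.intermediate_unique hL hp₀ hp₁ hN hπ ⟨ht0, ht1⟩ a2 b2 a3 b3

/-- Densities stay bounded along geodesics. The part of the transport which is in a set `S` at time
`t`, after normalization, is a transport of the same kind, so that its distribution at time `t` is
of bounded entropy, whereas it is carried by `S`. -/
lemma WTCD.le_smul_of_isGeodesicFromTo (hTCD : L.WTCD m p K N) (hL : L.RegularGeometry)
    (hp₀ : 0 < p) (hp₁ : p < 1) (hN : 0 < N) {A C : Set M} {D : ℝ} (hD0 : 0 ≤ D)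
    (hD : ∀ x ∈ A, ∀ y ∈ C, (L.τ x y).toReal ≤ D) {μ ν : ProbabilityMeasure M}
    {π : Measure (M × M)} (hπ : L.IsChronologicalTransport p m A C π) (h1 : π.fst = μ)
    (h2 : π.snd = ν) {c : ℝ} (hc : 0 < c) (hμ : (μ : Measure M) ≤ ENNReal.ofReal c • m)
    (hν : (ν : Measure M) ≤ ENNReal.ofReal c • m) {η : unitInterval → ProbabilityMeasure M}
    (hη : L.IsGeodesicFromTo p μ ν η) {t : unitInterval} (h0t : 0 < t) (ht1 : t < 1) :
    (η t : Measure M) ≤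
      ENNReal.ofReal (c * Real.exp (N * Real.log (Real.cosh (D * √(-K / N))))) • m := by
  have hπp : IsProbabilityMeasure π := isProbabilityMeasure_of_fst h1
  set B := N * Real.log (Real.cosh (D * √(-K / N))) with hB
  obtain ⟨κ, kt, k02, ki⟩ := hTCD.exists_intermediate hL hp₀ hp₁ hN hπ h1 h2 hη h0t ht1
  have hm1 : Measurable fun w : M × M × M => w.2.1 := by fun_prop
  refine Measure.le_iff.2 fun S hS => ?_
  rw [Measure.smul_apply, smul_eq_mul]
  rcases eq_or_ne (m S) ∞ with hmS | hmS
  · rw [hmS, ENNReal.mul_top (ENNReal.ofReal_pos.2 (by positivity)).ne']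
    exact le_top
  rcases eq_or_ne ((η t : Measure M) S) 0 with hq0 | hq0
  · rw [hq0]; exact zero_le
  set q := (η t : Measure M) S with hq
  have hqt : q ≠ ∞ := measure_ne_top _ _
  have hqi0 : q⁻¹ ≠ 0 := ENNReal.inv_ne_zero.2 hqt
  have hqit : q⁻¹ ≠ ∞ := ENNReal.inv_ne_top.2 hq0
  set T := (fun w : M × M × M => w.2.1) ⁻¹' S with hT
  have hTm : MeasurableSet T := hm1 hS
  have hκT : κ T = q := by rw [hq, ← kt, Measure.map_apply hm1 hS]
  set ξ := q⁻¹ • κ.restrict T with hξ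
  have hξle : ξ ≤ q⁻¹ • κ := by
    refine Measure.le_iff.2 fun s _ => ?_
    rw [hξ, Measure.smul_apply, Measure.smul_apply, smul_eq_mul, smul_eq_mul]
    exact mul_le_mul_right (Measure.restrict_le_self s) _
  have hξp : IsProbabilityMeasure ξ := ⟨by
    rw [hξ, Measure.smul_apply, Measure.restrict_apply_univ, hκT, smul_eq_mul,
      ENNReal.inv_mul_cancel hq0 hqt]⟩
  have hξac : ξ ≪ κ := (Measure.absolutelyContinuous_of_le hξle).trans
    Measure.smul_absolutelyContinuous
  set ρ := ξ.map fun w => (w.1, w.2.2) with hρ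
  have hρp : IsProbabilityMeasure ρ := Measure.isProbabilityMeasure_map measurable_e02.aemeasurable
  have hρle : ρ ≤ q⁻¹ • π := by
    rw [← k02, ← Measure.map_smul]
    exact Measure.map_mono hξle measurable_e02
  have hρac : ρ ≪ π := (Measure.absolutelyContinuous_of_le hρle).trans
    Measure.smul_absolutelyContinuous
  have : IsFiniteMeasure (q⁻¹ • π) := Measure.smul_finite π hqit
  have hρfst : ρ.fst ≤ q⁻¹ • (μ : Measure M) := by
    rw [← h1, ← fst_smul']
    exact Measure.map_mono hρle measurable_fst
  have hρsnd : ρ.snd ≤ q⁻¹ • (ν : Measure M) := by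
    rw [← h2, ← snd_smul']
    exact Measure.map_mono hρle measurable_snd
  have hρ' : L.IsChronologicalTransport p m A C ρ :=
    { isCompact_left := hπ.isCompact_left
      isCompact_right := hπ.isCompact_right
      ae_mem := hρac.ae_le hπ.ae_mem
      isMaximal := (hπ.isMaximal.smul hqi0 hqit).of_le (by
        rw [totalCost_smul]
        exact ENNReal.mul_ne_top hqit (hL.totalCost_ne_top hp₀ hπ.isCompact_left
          hπ.isCompact_right hπ.ae_mem)) hρle
      ae_ll := hρac.ae_le hπ.ae_ll
      absolutelyContinuous := (hρac.map measurable_fst).trans hπ.absolutelyContinuous }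
  have hqr : 0 < q.toReal := ENNReal.toReal_pos hq0 hqt
  have hscale : ∀ {α : Measure M}, α ≤ ENNReal.ofReal c • m →
      q⁻¹ • α ≤ ENNReal.ofReal (c / q.toReal) • m := fun {α} h => by
    refine Measure.le_iff.2 fun s _ => ?_
    rw [div_eq_inv_mul, ENNReal.ofReal_mul (by positivity), ENNReal.ofReal_inv_of_pos hqr,
      ENNReal.ofReal_toReal hqt, Measure.smul_apply, Measure.smul_apply, smul_eq_mul, smul_eq_mul,
      mul_assoc]
    have := h s
    rw [Measure.smul_apply, smul_eq_mul] at this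
    exact mul_le_mul_right this _
  obtain ⟨-, η', -, -, -, hη', -, hent⟩ := hTCD.exists_geodesic_of_le_smul hL hp₀ hp₁ hN hD0 hD
    (μ := ⟨ρ.fst, inferInstance⟩) (ν := ⟨ρ.snd, inferInstance⟩) hρ' rfl rfl
    (div_pos hc hqr) (hρfst.trans (hscale hμ)) (hρsnd.trans (hscale hν))
  obtain ⟨κ', kt', k02', ki'⟩ := hTCD.exists_intermediate hL hp₀ hp₁ hN hρ' rfl rfl hη' h0t ht1
  have hmid : (η' t : Measure M) = ξ.map fun w => w.2.1 := by
    rw [← kt']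
    exact hTCD.intermediate_unique hL hp₀ hp₁ hN hρ' ⟨h0t, ht1⟩ k02' rfl ki' (hξac.ae_le ki)
  have hS' : (η' t : Measure M) Sᶜ = 0 := by
    rw [hmid, Measure.map_apply hm1 hS.compl, hξ, Measure.smul_apply,
      Measure.restrict_apply (hm1 hS.compl), preimage_compl, compl_inter_self, measure_empty,
      smul_zero]
  have hS1 : (η' t : Measure M).real S = 1 := by
    rw [Measure.real, (prob_compl_eq_zero_iff hS).1 hS', ENNReal.toReal_one]
  -- Jensen's inequality: entropy at most `E` forces volume at least `exp (-E)`.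
  set E := B + Real.log (c / q.toReal) with hE
  have hJ := (le_entropy (m := m) (μ := η' t) (A := S) (B := ∅) hS .empty (disjoint_empty S)
    (by rwa [union_empty]) hmS (by simp) (Real.exp_pos E) one_pos).trans (hent t)
  rw [EReal.coe_le_coe_iff, hS1, Real.log_exp] at hJ
  simp only [measureReal_empty, zero_mul, mul_zero, one_mul, sub_zero, add_zero] at hJ
  have hexp : Real.exp E = c * Real.exp B / q.toReal := by
    rw [hE, Real.exp_add, Real.exp_log (div_pos hc hqr)]; ring
  have hfinal : q.toReal ≤ c * Real.exp B * m.real S := by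
    have h1 : 1 ≤ c * Real.exp B / q.toReal * m.real S := by
      rw [← hexp]; linarith
    rw [div_mul_eq_mul_div, le_div_iff₀ hqr, one_mul] at h1
    exact h1
  rw [← ENNReal.ofReal_toReal hqt, ← ENNReal.ofReal_toReal hmS, ← ENNReal.ofReal_mul (by positivity)]
  exact ENNReal.ofReal_le_ofReal hfinal

end Transport

end LorentzianPreLengthSpace

theorem corollary1p3 {M : Type*} [MetricSpace M] [ProperSpace M] [MeasurableSpace M] [BorelSpace M]
    (L : LorentzianPreLengthSpace M) (m : Measure M) [m.Regular] [m.IsOpenPosMeasure]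
    (hbranch : L.TimelikeNonbranching) (hclosed : L.LocallyCausallyClosed)
    (hhyp : L.KGloballyHyperbolic) (hreg : L.IsRegular) (hgeo : L.IsGeodesicSpace)
    (p K N : ℝ) (hp₀ : 0 < p) (hp₁ : p < 1) (hN : 0 < N) (hTCD : L.WTCD m p K N)
    (μ₀ μ₁ : ProbabilityMeasure M)
    (hcomp₀ : IsCompact (μ₀ : Measure M).support) (hcomp₁ : IsCompact (μ₁ : Measure M).support)
    (hac₀ : (μ₀ : Measure M) ≪ m) (hac₁ : (μ₁ : Measure M) ≪ m)
    (hdual : L.IsTimelikeDualizable p μ₀ μ₁)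
    (hbdd₀ : LorentzianPreLengthSpace.densityNorm m μ₀ < ∞)
    (hbdd₁ : LorentzianPreLengthSpace.densityNorm m μ₁ < ∞) :
    (∃! μ : unitInterval → ProbabilityMeasure M, L.IsGeodesicFromTo p μ₀ μ₁ μ) ∧
      ∀ μ : unitInterval → ProbabilityMeasure M, L.IsGeodesicFromTo p μ₀ μ₁ μ →
        L.IsGood m p K N μ := by
  have hL := LorentzianPreLengthSpace.regularGeometry hbranch hclosed hhyp hreg hgeo
  obtain ⟨π, ⟨⟨h1, h2⟩, hll⟩, hopt, -⟩ := hdual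
  obtain ⟨c₀, hc₀, hle₀⟩ :=
    LorentzianPreLengthSpace.exists_le_smul_of_densityNorm_lt_top hac₀ hbdd₀
  obtain ⟨c₁, hc₁, hle₁⟩ :=
    LorentzianPreLengthSpace.exists_le_smul_of_densityNorm_lt_top hac₁ hbdd₁
  -- A common bound `c` for both densities.
  set c := max c₀ c₁ with hc
  have hcpos : 0 < c := lt_max_of_lt_left hc₀
  have hmono : ∀ {a b : ℝ}, a ≤ b → ENNReal.ofReal a • m ≤ ENNReal.ofReal b • m := fun {a b} h s => by
    simp only [Measure.smul_apply, smul_eq_mul]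
    exact mul_le_mul_left (ENNReal.ofReal_le_ofReal h) _
  replace hle₀ := hle₀.trans (hmono (le_max_left c₀ c₁))
  replace hle₁ := hle₁.trans (hmono (le_max_right c₀ c₁))
  set A := (μ₀ : Measure M).support with hA
  set C := (μ₁ : Measure M).support with hC
  have hA0 : (μ₀ : Measure M) Aᶜ = 0 := Measure.measure_compl_support
  have hC0 : (μ₁ : Measure M) Cᶜ = 0 := Measure.measure_compl_support
  have hπ : L.IsChronologicalTransport p m A C π :=
    { isCompact_left := hcomp₀
      isCompact_right := hcomp₁
      ae_mem := LorentzianPreLengthSpace.ae_mem_prod_of_marginals hcomp₀.measurableSet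
        hcomp₁.measurableSet (by rw [h1]; exact hA0) (by rw [h2]; exact hC0)
      isMaximal := ((LorentzianPreLengthSpace.isOptimalCoupling_iff hp₀).1 hopt).2
      ae_ll := hll
      absolutelyContinuous := by rw [h1]; exact hac₀ }
  obtain ⟨D, hD0, hD⟩ := hL.exists_τ_bound hcomp₀ hcomp₁
  obtain ⟨π', η, hπ1, hπ2, hθ, hη, hconv, hent⟩ := hTCD.exists_geodesic_of_le_smul hL hp₀ hp₁ hN
    hD0.le hD hπ h1 h2 hcpos hle₀ hle₁
  have huniq : ∀ μ : unitInterval → ProbabilityMeasure M, L.IsGeodesicFromTo p μ₀ μ₁ μ → μ = η :=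
    fun μ hμ => hTCD.geodesic_unique hL hp₀ hp₁ hN hπ h1 h2 hμ hη
  refine ⟨⟨η, hη, huniq⟩, fun μ hμ => ?_⟩
  obtain rfl := huniq μ hμ
  have hJ := hL.isCompact_diamond _ _ hcomp₀ hcomp₁
  have htop : ∀ t, LorentzianPreLengthSpace.entropy m (μ t) ≠ ⊤ := fun t =>
    ne_top_of_le_ne_top (EReal.coe_ne_top _) (hent t)
  refine ⟨⟨π', ?_, ?_, hθ.trans_lt ENNReal.ofReal_lt_top, hconv⟩, fun t =>
    ⟨LorentzianPreLengthSpace.absolutelyContinuous_of_entropy_ne_top (htop t),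
      LorentzianPreLengthSpace.finiteEntropy_of_ne_top hJ.measurableSet
        (hμ.measure_compl_diamond hL hcomp₀ hcomp₁ hA0 hC0 t) hJ.measure_ne_top (htop t)⟩, ?_⟩
  · rwa [hμ.1, hμ.2.1]
  · rwa [hμ.1, hμ.2.1]
  -- The density bound for intermediate times also exceeds `c`, which covers the end points.
  set B := c * Real.exp (N * Real.log (Real.cosh (D * √(-K / N)))) with hB
  have hcB : c ≤ B := le_mul_of_one_le_right hcpos.le (Real.one_le_exp (mul_nonneg hN.le
    (Real.log_nonneg (Real.one_le_cosh _))))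
  refine lt_of_le_of_lt (iSup_le fun t => ?_) (ENNReal.ofReal_lt_top (r := B))
  refine LorentzianPreLengthSpace.densityNorm_le_of_le_smul ?_
  rcases eq_or_ne t 0 with rfl | ht0
  · rw [hμ.1]
    exact hle₀.trans (hmono hcB)
  rcases eq_or_ne t 1 with rfl | ht1
  · rw [hμ.2.1]
    exact hle₁.trans (hmono hcB)
  exact hTCD.le_smul_of_isGeodesicFromTo hL hp₀ hp₁ hN hD0.le hD hπ h1 h2 hcpos hle₀ hle₁ hμ
    (unitInterval.pos_iff_ne_zero.2 ht0) (unitInterval.lt_one_iff_ne_one.2 ht1)
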